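/- Let $(X,\mu)$ be a non-atomic probability space. Let $\mathcal T$ be a tree on $X$, that is, a family of measurable sets of positive measure with $X\in\mathcal T$ such that: (a) every $I\in\mathcal T$ is assigned a finite or countable set $C(I)\subseteq\mathcal T$ with at least two elements, which are pairwise almost disjoint (their intersections are $\mu$-null) and have union $I$; (b) $\mathcal T=\bigcup_{m\ge0}\mathcal T_{(m)}$, where $\mathcal T_{(0)}=\{X\}$ and $\mathcal T_{(m+1)}=\bigcup_{I\in\mathcal T_{(m)}}C(I)$; (c) $\lim_{m\to\infty}\sup_{I\in\mathcal T_{(m)}}\mu(I)=0$. Put $$\mathcal M\varphi(x)=\sup\Big\{\frac1{\mu(I)}\int_I|\varphi|\,d\mu : x\in I\in\mathcal T\Big\},\qquad \|\varphi\|_{p,\infty}=\sup_{t>0}\,t\,\mu(\{|\varphi|\ge t\})^{1/p}.$$ Fix $1<q<p$ and write $\kappa=\frac{p-1}{p}$, $\Gamma=\kappa^q\frac{p}{p-q}$. For $0<f\le1$ let $A_f=f^q$ if $f\le\kappa$, and $A_f=\frac{\kappa^q}{p-q}\big\{p-q[p(1-f)]^{\frac{p-q}{p-1}}\big\}$ if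 $f>\kappa$. Let $D$ be the set of all $(f,A)$ with $0<f\le1$ and $A_f\le A\le\Gamma f^{\frac{p-q}{p-1}}$. For $\lambda>0$ let $$B_1(f,A,\lambda)=\sup\Big\{\mu(\{\mathcal M\varphi\ge\lambda\}) : \varphi\ge0 \text{ measurable},\ \int_X\varphi\,d\mu=f,\ \int_X\varphi^q\,d\mu=A,\ \|\varphi\|_{p,\infty}\le\kappa\Big\}.$$ For $\lambda\ge f$ and $0\le\alpha\le\lambda^{-p}$ define $$T_\lambda(\alpha)=\begin{cases}\lambda^q\alpha, & \alpha\le(\kappa/\lambda)^p,\\[2pt] \dfrac{\kappa^q}{p-q}\Big\{p\,\alpha^{1-\frac qp}-q\big[p(\alpha^{1-\frac1p}-\lambda\alpha)\big]^{\frac{p-q}{p-1}}\Big\}, & (\kappa/\lambda)^p<\alpha\le\lambda^{-p}.\end{cases}$$ For $\lambda>f$ and $0\le\alpha\le f/\lambda$ with $f-\lambda\alpha\le1-\alpha^{1-\frac1p}$ define $$F_\lambda(\alpha)=\begin{cases}\dfrac{(f-\lambda\alpha)^q}{(1-\alpha)^{q-1}}, & f\le\kappa,\ \text{ or } f>\kappa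 \text{ and } \alpha\ge\frac{f-\kappa}{\lambda-\kappa},\\[6pt] \kappa^qc^{-q/p}(c-\alpha)+\Gamma\big(1-c^{1-\frac qp}\big), & f>\kappa \text{ and } \alpha<\frac{f-\kappa}{\lambda-\kappa},\end{cases}$$ where $c\in[\alpha,1]$ is the solution of $\frac1pc^{1-\frac1p}+\big(1-\frac1p\big)\alpha c^{-\frac1p}=1-(f-\lambda\alpha)$. For $\lambda>f$ let $K_\lambda(\beta)=f-1+\beta^{1-\frac1p}-\lambda\beta$, $\beta_0=(\kappa/\lambda)^p$ and $m_\lambda=\min\{f/\lambda,\lambda^{-p}\}$. If $f>\kappa$ and $K_\lambda(\beta_0)\ge0$, let $\beta_2$ be the largest zero of $K_\lambda$ in $[0,\lambda^{-p}]$ and put $\Delta=[\beta_2,m_\lambda]$; otherwise put $\Delta=[0,m_\lambda]$. **Theorem.** Let $(f,A)\in D$ with $A>A_f$. There is exactly one $\lambda_1\in\big[(1/f)^{1/(p-1)},\infty\big)$ with $F_{\lambda_1}(\lambda_1^{-p})+\Gamma\lambda_1^{-(p-q)}=A$, and exactly one $\lambda_3\in\big[f,(1/f)^{1/(p-1)}\big]$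 with $T_{\lambda_3}(f/\lambda_3)=A$. For every $\lambda>0$, $$B_1(f,A,\lambda)=\begin{cases}1, & 0<\lambda\le f,\\ f/\lambda, & f<\lambda\le\lambda_3,\\ \delta, & \lambda_3<\lambda\le\lambda_1,\\ \lambda^{-p}, & \lambda\ge\lambda_1,\end{cases}\qquad \delta=\max\{\gamma\in\Delta : F_\lambda(\gamma)+T_\lambda(\gamma)=A\},$$ where the maximum exists for every $\lambda$ with $\lambda_3<\lambda\le\lambda_1$. -/

import Mathlib

open MeasureTheory Set Filter Topology
open scoped ENNReal

noncomputable section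

namespace DyadicBellman

/-! Measure-theoretic part: trees, the maximal operator, the weak quasi-norm. -/

section Tree

variable {X : Type*} [MeasurableSpace X]

/-- Non-atomic measures: every measurable set of positive measure has a measurable subset
whose measure lies strictly between zero and that of the set. -/
def NonAtomic (μ : Measure X) : Prop :=
  ∀ s : Set X, MeasurableSet s → 0 < μ s →
    ∃ t : Set X, MeasurableSet t ∧ t ⊆ s ∧ 0 < μ t ∧ μ t < μ s

/-- The `m`-th generation generated from the whole space by the children map `C`. -/
def level (C : Set X → Set (Set X)) : ℕ → Set (Set X)
  | 0 => {univ}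
  | m + 1 => ⋃ I ∈ level C m, C I

/-- A tree of measurable sets on `(X, μ)`; `C I` is the set of children of `I`. -/
def IsTree (μ : Measure X) (𝒯 : Set (Set X)) : Prop :=
  univ ∈ 𝒯 ∧ (∀ I ∈ 𝒯, MeasurableSet I ∧ 0 < μ I) ∧
  ∃ C : Set X → Set (Set X),
    (∀ I ∈ 𝒯, C I ⊆ 𝒯 ∧ (C I).Countable ∧ (C I).Nontrivial ∧
      (C I).Pairwise (AEDisjoint μ) ∧ I = ⋃₀ C I) ∧
    𝒯 = ⋃ m : ℕ, level C m ∧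
    Tendsto (fun m : ℕ => ⨆ I ∈ level C m, μ I) atTop (𝓝 0)

/-- The maximal operator of the tree, with values in `[0, ∞]`. -/
def maximal (μ : Measure X) (𝒯 : Set (Set X)) (φ : X → ℝ) (x : X) : ℝ≥0∞ :=
  ⨆ I ∈ 𝒯, ⨆ _ : x ∈ I, (∫⁻ y in I, ‖φ y‖ₑ ∂μ) / μ I

/-- The weak quasi-norm `sup {t μ(|φ| ≥ t)^{1/p} : t > 0}`, with values in `[0, ∞]`. -/
def weakNorm (μ : Measure X) (p : ℝ) (φ : X → ℝ) : ℝ≥0∞ :=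
  ⨆ t : ℝ, ⨆ _ : 0 < t, ENNReal.ofReal t * μ {x | t ≤ |φ x|} ^ (1 / p)

/-- The functions over which the supremum is taken. -/
def competitors (μ : Measure X) (p q f A : ℝ) : Set (X → ℝ) :=
  {φ | Measurable φ ∧ (∀ x, 0 ≤ φ x) ∧
    Integrable φ μ ∧ ∫ x, φ x ∂μ = f ∧
    Integrable (fun x => φ x ^ q) μ ∧ ∫ x, φ x ^ q ∂μ = A ∧
    weakNorm μ p φ ≤ ENNReal.ofReal ((p - 1) / p)}

/-- The localized distribution Bellman function `B₁(f, A, l)`. -/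
def B₁ (μ : Measure X) (𝒯 : Set (Set X)) (p q f A l : ℝ) : ℝ≥0∞ :=
  ⨆ φ ∈ competitors μ p q f A, μ {x | ENNReal.ofReal l ≤ maximal μ 𝒯 φ x}

end Tree

/-! Explicit functions of one real variable. The level is called `l`. -/

/-- The constant `Γ`. -/
def Gam (p q : ℝ) : ℝ := ((p - 1) / p) ^ q * (p / (p - q))

/-- The lower bound `A_f`. -/
def Amin (p q f : ℝ) : ℝ :=
  if f ≤ (p - 1) / p then f ^ q
  else ((p - 1) / p) ^ q * (1 / (p - q)) *
    (p - q * (p * (1 - f)) ^ ((p - q) / (p - 1)))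

/-- The domain of admissible pairs `(f, A)`. -/
def D (p q : ℝ) : Set (ℝ × ℝ) :=
  {z | 0 < z.1 ∧ z.1 ≤ 1 ∧ Amin p q z.1 ≤ z.2 ∧
    z.2 ≤ Gam p q * z.1 ^ ((p - q) / (p - 1))}

/-- `Δ_{f₁}(a)`. -/
def DeltaFun (p q f₁ a : ℝ) : ℝ :=
  ((p - 1) / p) ^ q * (1 / (p - q)) *
    (p * a ^ (1 - q / p) -
      q * (p * (a ^ (1 - 1 / p) - f₁)) ^ ((p - q) / (p - 1)))

/-- `T_l(a)`, for `0 ≤ a ≤ 1 / l ^ p`. -/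
def T (p q l a : ℝ) : ℝ :=
  if a ≤ ((p - 1) / p / l) ^ p then l ^ q * a else DeltaFun p q (l * a) a

/-- The number `c ∈ [a, 1]` with `(1/p) c^{1-1/p} + (1-1/p) a c^{-1/p} = 1 - f₂`. It exists and
is unique if `0 ≤ a < 1` and `(1 - a) (p-1)/p ≤ f₂ ≤ 1 - a^{1-1/p}`; the supremum only serves
to select it. -/
def cRoot (p a f₂ : ℝ) : ℝ :=
  sSup {c : ℝ | c ∈ Icc a 1 ∧
    1 / p * c ^ (1 - 1 / p) + (1 - 1 / p) * a * c ^ (-1 / p) = 1 - f₂}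

/-- `Γ_{f₂}(a)`. -/
def GamFun (p q f₂ a : ℝ) : ℝ :=
  ((p - 1) / p) ^ q * cRoot p a f₂ ^ (-q / p) * (cRoot p a f₂ - a) +
    Gam p q * (1 - cRoot p a f₂ ^ (1 - q / p))

/-- `F_l(a)`, for `l > f`, `0 ≤ a ≤ f / l` and `f - l a ≤ 1 - a^{1-1/p}`. -/
def F (p q f l a : ℝ) : ℝ :=
  if f ≤ (p - 1) / p then (f - l * a) ^ q / (1 - a) ^ (q - 1)
  else if (f - (p - 1) / p) / (l - (p - 1) / p) ≤ a then
    (f - l * a) ^ q / (1 - a) ^ (q - 1)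
  else GamFun p q (f - l * a) a

/-- `K(b) = f - 1 + b^{1-1/p} - l b`. -/
def K (p f l b : ℝ) : ℝ := f - 1 + b ^ (1 - 1 / p) - l * b

/-- The point `b₀` at which `K` is maximal. -/
def b₀ (p l : ℝ) : ℝ := ((p - 1) / p / l) ^ p

/-- The largest zero of `K` in `[0, 1 / l ^ p]` (used only if `K(b₀) ≥ 0`; it is `b₀` itself if
`K(b₀) = 0`). -/
def b₂ (p f l : ℝ) : ℝ := sSup {b : ℝ | b ∈ Icc 0 (1 / l ^ p) ∧ K p f l b = 0}

/-- The interval `Δ`. -/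
def DeltaSet (p f l : ℝ) : Set ℝ :=
  if (p - 1) / p < f ∧ 0 ≤ K p f l (b₀ p l) then Icc (b₂ p f l) (min (f / l) (1 / l ^ p))
  else Icc 0 (min (f / l) (1 / l ^ p))

/-- `l` solves the equation that defines `λ₁`. -/
def IsLam₁ (p q f A l : ℝ) : Prop :=
  (1 / f) ^ (1 / (p - 1)) ≤ l ∧ F p q f l (1 / l ^ p) + Gam p q / l ^ (p - q) = A

/-- `l` solves the equation that defines `λ₃`. -/
def IsLam₃ (p q f A l : ℝ) : Prop :=
  l ∈ Icc f ((1 / f) ^ (1 / (p - 1))) ∧ T p q l (f / l) = A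

end DyadicBellman

end

/-! The weak bound `‖φ‖_{p,∞} ≤ κ` says that the distribution function of `φ` is at most that of
`prof p u = κ u^{-1/p}` on `(0, ∞)`. The problem thereby becomes one about functions below `prof p`
on `(0, 1]`.

Upper bound. Let `E = {ℳφ ≥ λ}` and `α = μ(E)`. The covering argument `mul_measure_le_maximal` gives
`λα ≤ ∫_E φ`. Total mass then forces `α ≤ f/λ`, and comparison with `prof p` forces `α ≤ λ^{-p}`
(`level_set_bounds`). Among functions below `prof p` with prescribed integral on an interval, the
`q`-norm is least for a truncation `min b (prof p)`. The least values on `[0, α]` with integral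
`λα`, and on `[α, 1]` with integral `f - λα`, are `T_λ(α)` and `F_λ(α)` (`T_truncation`,
`offMin_truncation`). Lagrange duality (`lagrangian_le`) turns this into `F_λ(α) + T_λ(α) ≤ A`,
although `φ` need not be largest on `E`. Duality requires the truncation height off `E` to be at
most the one on `E`; `level_le_level` proves this, and it is the reason for the sign of `K_λ(β₀)` in
the definition of `Δ`.

Lower bound. `exists_layout` finds almost disjoint tree sets of total measure `α`, together with a
uniform variable `V` on `X` that maps each of them uniformly onto `(0, α]`. If `g` has average at
least `λ` on `(0, α]`, then `g ∘ V` has average at least `λ` on each chosen set. So any `α` with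
`F_λ(α) + T_λ(α) ≤ A` is attained, once the `q`-norm has been raised to exactly `A` by interpolating
with the profile of maximal `q`-norm (`exists_profile_interpolation`).

The four ranges. For `λ ≤ f` the whole space is already a set of large average. `T_λ(f/λ)` increases
strictly with `λ` (`T_div_lt`), so `α = f/λ` is affordable exactly up to `λ₃`. The value of `F_λ +
T_λ` at `λ^{-p}` decreases strictly (`saturatedMin_lt`), so `α = λ^{-p}` is affordable exactly from
`λ₁` on. In between, `F_λ + T_λ` is at most `A_f` at the left end of `Δ` and at least `A` at the
right end; by continuity, an affordable `α` beyond the largest solution `δ` would produce a still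
larger solution. -/

namespace DyadicBellman

/-! ### Probability integral transform -/

section Uniform

open ProbabilityTheory

/-- The jump of the distribution function at a point is the mass of that point. -/
lemma continuous_cdf_of_null_singletons (P : Measure ℝ) [IsProbabilityMeasure P] [NullSingletonClass P] :
    Continuous (cdf P) := by
  rw [continuous_iff_continuousAt]
  intro x
  have h0 : P {x} = 0 := measure_singleton x
  rw [← measure_cdf P, StieltjesFunction.measure_singleton, ENNReal.ofReal_eq_zero] at h0
  have hmono := (cdf P).mono
  have hle : Function.leftLim (cdf P) x ≤ cdf P x := hmono.leftLim_le le_rfl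
  rw [hmono.continuousAt_iff_leftLim_eq_rightLim]
  have : Function.rightLim (cdf P) x = cdf P x := (cdf P).rightLim_eq x
  rw [this]; linarith

/-- By continuity every `s` in `(0, 1)` is a value `cdf P y`. Half-lines ending at such points bound
the set from inside (value `t`) and from outside (values decreasing to `t`). -/
lemma measure_cdf_le (P : Measure ℝ) [IsProbabilityMeasure P] [NullSingletonClass P] {t : ℝ}
    (h0 : 0 ≤ t) (h1 : t < 1) : P {x | cdf P x ≤ t} = ENNReal.ofReal t := by
  have hc := continuous_cdf_of_null_singletons P
  have hex : ∀ s, 0 < s → s < 1 → ∃ y, cdf P y = s := by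
    intro s hs0 hs1
    obtain ⟨a, ha⟩ := ((tendsto_cdf_atBot P).eventually_lt_const hs0).exists
    obtain ⟨b, hb⟩ := ((tendsto_cdf_atTop P).eventually_const_lt hs1).exists
    exact mem_range_of_exists_le_of_exists_ge hc ⟨a, ha.le⟩ ⟨b, hb.le⟩
  apply le_antisymm
  · apply le_of_forall_gt
    intro c hc'
    obtain ⟨s, hts, hs1, hsc⟩ : ∃ s, t < s ∧ s < 1 ∧ ENNReal.ofReal s < c := by
      have hcont : Tendsto ENNReal.ofReal (𝓝[>] t) (𝓝 (ENNReal.ofReal t)) :=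
        (ENNReal.continuous_ofReal.tendsto t).mono_left nhdsWithin_le_nhds
      obtain ⟨s, hs⟩ := ((hcont.eventually_lt_const hc').and
        (Ioo_mem_nhdsGT h1)).exists
      exact ⟨s, hs.2.1, hs.2.2, hs.1⟩
    obtain ⟨y, hy⟩ := hex s (h0.trans_lt hts) hs1
    refine lt_of_le_of_lt ?_ hsc
    rw [← hy, ofReal_cdf]
    refine measure_mono fun z hz => ?_
    by_contra hzy
    have := (cdf P).mono (not_le.1 hzy).le
    have hz' : cdf P z ≤ t := hz
    linarith
  · rcases h0.eq_or_lt with rfl | h0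
    · simp
    obtain ⟨y, hy⟩ := hex t h0 h1
    rw [← hy, ofReal_cdf]
    exact measure_mono fun z hz => (cdf P).mono hz

lemma map_cdf_eq_volume (P : Measure ℝ) [IsProbabilityMeasure P] [NullSingletonClass P] :
    P.map (cdf P) = volume.restrict (Icc 0 1) := by
  have hm : Measurable (cdf P) := (cdf P).mono.measurable
  have : IsProbabilityMeasure (P.map (cdf P)) := Measure.isProbabilityMeasure_map hm.aemeasurable
  refine Measure.ext_of_Iic _ _ fun t => ?_
  rw [Measure.map_apply hm measurableSet_Iic, Measure.restrict_apply measurableSet_Iic]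
  rcases lt_or_ge t 0 with h | h0
  · have e1 : cdf P ⁻¹' Iic t = ∅ := by
      ext x; simpa using h.trans_le (cdf_nonneg P x)
    have e2 : Iic t ∩ Icc (0 : ℝ) 1 = ∅ := by
      ext x; simp only [mem_inter_iff, mem_Iic, mem_Icc, mem_empty_iff_false]; grind
    rw [e1, e2]; simp
  rcases lt_or_ge t 1 with h1 | h1
  · have e2 : Iic t ∩ Icc (0 : ℝ) 1 = Icc 0 t := by
      ext x; simp only [mem_inter_iff, mem_Iic, mem_Icc]; grind
    rw [e2, Real.volume_Icc, sub_zero]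
    exact measure_cdf_le P h0 h1
  · have e1 : cdf P ⁻¹' Iic t = univ := by
      ext x; simpa using (cdf_le_one P x).trans h1
    have e2 : Iic t ∩ Icc (0 : ℝ) 1 = Icc 0 1 := by
      ext x; simp only [mem_inter_iff, mem_Iic, mem_Icc]; grind
    rw [e1, e2]; simp

end Uniform

/-! ### Trees -/

section Tree

variable {X : Type*} [MeasurableSpace X]

/-- The children map `C` generates the tree `𝒯`. -/
structure Generates (μ : Measure X) (𝒯 : Set (Set X)) (C : Set X → Set (Set X)) : Prop where
  meas : ∀ I ∈ 𝒯, MeasurableSet I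
  pos : ∀ I ∈ 𝒯, 0 < μ I
  sub : ∀ I ∈ 𝒯, C I ⊆ 𝒯
  countable : ∀ I ∈ 𝒯, (C I).Countable
  disj : ∀ I ∈ 𝒯, (C I).Pairwise (AEDisjoint μ)
  union : ∀ I ∈ 𝒯, I = ⋃₀ C I
  eq_levels : 𝒯 = ⋃ m : ℕ, level C m
  lim : Tendsto (fun m : ℕ => ⨆ I ∈ level C m, μ I) atTop (𝓝 0)

lemma IsTree.exists_generates {μ : Measure X} {𝒯 : Set (Set X)} (h : IsTree μ 𝒯) :
    ∃ C, Generates μ 𝒯 C := by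
  obtain ⟨_, h2, C, h3, h4, h5⟩ := h
  exact ⟨C, fun I hI => (h2 I hI).1, fun I hI => (h2 I hI).2, fun I hI => (h3 I hI).1,
    fun I hI => (h3 I hI).2.1, fun I hI => (h3 I hI).2.2.2.1, fun I hI => (h3 I hI).2.2.2.2, h4, h5⟩

namespace Generates

variable {μ : Measure X} {𝒯 : Set (Set X)} {C : Set X → Set (Set X)} (h : Generates μ 𝒯 C)
include h

lemma level_subset (m : ℕ) : level C m ⊆ 𝒯 := by
  rw [h.eq_levels]; exact subset_iUnion _ m

lemma level_countable (m : ℕ) : (level C m).Countable := by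
  induction m with
  | zero => exact countable_singleton _
  | succ m ih => exact ih.biUnion fun I hI => h.countable I (h.level_subset m hI)

lemma tree_countable : 𝒯.Countable := by
  rw [h.eq_levels]; exact countable_iUnion h.level_countable

lemma univ_mem : univ ∈ 𝒯 := h.level_subset 0 rfl

lemma child_subset {I J : Set X} (hI : I ∈ 𝒯) (hJ : J ∈ C I) : J ⊆ I := by
  rw [h.union I hI]; exact subset_sUnion_of_mem hJ

lemma exists_mem_level (m : ℕ) (x : X) : ∃ I ∈ level C m, x ∈ I := by
  induction m with
  | zero => exact ⟨univ, rfl, mem_univ x⟩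
  | succ m ih =>
    obtain ⟨I, hI, hx⟩ := ih
    rw [h.union I (h.level_subset m hI)] at hx
    obtain ⟨J, hJ, hxJ⟩ := hx
    exact ⟨J, mem_biUnion hI hJ, hxJ⟩

omit h in
lemma measure_level_le {m : ℕ} {I : Set X} (hI : I ∈ level C m) :
    μ I ≤ ⨆ I ∈ level C m, μ I := le_iSup₂_of_le I hI le_rfl

/-- A measurable real function with null fibres. -/
lemma exists_null_fibres :
    ∃ g : X → ℝ, Measurable g ∧ ∀ y, μ (g ⁻¹' {y}) = 0 := by
  classical
  obtain ⟨e, he⟩ := h.tree_countable.exists_eq_range ⟨_, h.univ_mem⟩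
  -- Record membership in all the countably many tree sets as a point of Cantor space. A fibre lies
  -- inside one set of every generation, and those measures tend to zero.
  let k : X → ℕ → Bool := fun x n => decide (x ∈ e n)
  have hk : Measurable k := by
    refine measurable_pi_lambda _ fun n => ?_
    refine measurable_to_bool ?_
    have : (fun x => k x n) ⁻¹' {true} = e n := by ext x; simp [k]
    rw [this]; exact h.meas _ (he ▸ mem_range_self n)
  refine ⟨fun x => embeddingReal (ℕ → Bool) (k x),
    (measurableEmbedding_embeddingReal _).measurable.comp hk, fun y => ?_⟩
  rcases eq_empty_or_nonempty ((fun x => embeddingReal (ℕ → Bool) (k x)) ⁻¹' {y}) with h0 | ⟨x₀, hx₀⟩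
  · rw [h0]; simp
  refine le_antisymm (ge_of_tendsto' h.lim fun m => ?_) bot_le
  obtain ⟨I, hI, hx⟩ := h.exists_mem_level m x₀
  refine (measure_mono fun x hx' => ?_).trans (measure_level_le hI)
  have : k x = k x₀ := (measurableEmbedding_embeddingReal _).injective (hx'.trans hx₀.symm)
  obtain ⟨n, hn⟩ : I ∈ range e := he ▸ h.level_subset m hI
  have h2 : k x n = k x₀ n := congrFun this n
  simp only [k, decide_eq_decide] at h2
  rw [hn] at h2
  exact h2.2 hx

/-- A set of positive measure can be mapped uniformly onto any interval. -/
lemma exists_uniform [IsFiniteMeasure μ] {S : Set X} (h0 : μ S ≠ 0)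
    {a b : ℝ} (hab : a < b) :
    ∃ U : X → ℝ, Measurable U ∧ (μ.restrict S).map U =
      (μ S / ENNReal.ofReal (b - a)) • volume.restrict (Icc a b) := by
  obtain ⟨g, hg, hg0⟩ := h.exists_null_fibres
  -- The distribution function of this law makes `g` uniform on `[0, 1]`; the affine map `T` then
  -- carries `[0, 1]` to `[a, b]`.
  let P : Measure ℝ := (ProbabilityTheory.cond μ S).map g
  have : IsProbabilityMeasure (ProbabilityTheory.cond μ S) :=
    ProbabilityTheory.cond_isProbabilityMeasure h0
  have : IsProbabilityMeasure P := Measure.isProbabilityMeasure_map hg.aemeasurable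
  have : NullSingletonClass P := ⟨fun y => by
    rw [Measure.map_apply hg (measurableSet_singleton y)]
    exact ProbabilityTheory.cond_absolutelyContinuous (hg0 y)⟩
  have hba : 0 < b - a := sub_pos.2 hab
  let T : ℝ → ℝ := fun t => (b - a) * t + a
  have hT : Measurable T := by fun_prop
  have hcdf : Measurable (ProbabilityTheory.cdf P) := (ProbabilityTheory.cdf P).mono.measurable
  refine ⟨fun x => T (ProbabilityTheory.cdf P (g x)), hT.comp (hcdf.comp hg), ?_⟩
  have e1 : μ.restrict S = μ S • ProbabilityTheory.cond μ S := by
    rw [ProbabilityTheory.cond, smul_smul, ENNReal.mul_inv_cancel h0 (measure_ne_top _ _), one_smul]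
  have e2 : (ProbabilityTheory.cond μ S).map (fun x => T (ProbabilityTheory.cdf P (g x)))
      = (volume.restrict (Icc 0 1)).map T := by
    rw [← map_cdf_eq_volume P, Measure.map_map hT hcdf, Measure.map_map (hT.comp hcdf) hg]
    rfl
  have e3 : (volume.restrict (Icc 0 1)).map T
      = (ENNReal.ofReal (b - a))⁻¹ • volume.restrict (Icc a b) := by
    have hpre : Icc (0:ℝ) 1 = T ⁻¹' Icc a b := by
      ext t; simp only [T, mem_Icc, mem_preimage]
      constructor
      · rintro ⟨h1, h2⟩; constructor <;> nlinarith
      · rintro ⟨h1, h2⟩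
        exact ⟨nonneg_of_mul_nonneg_right (by linarith) hba, by nlinarith⟩
    have hvol : volume.map T = (ENNReal.ofReal (b - a))⁻¹ • (volume : Measure ℝ) := by
      have : T = (fun t => t + a) ∘ (fun t => (b - a) * t) := rfl
      rw [this, ← Measure.map_map (by fun_prop) (by fun_prop),
        Real.map_volume_mul_left hba.ne', Measure.map_smul,
        (measurePreserving_add_right volume a).map_eq, abs_of_pos (inv_pos.2 hba),
        ENNReal.ofReal_inv_of_pos hba]
    rw [hpre, ← Measure.restrict_map hT measurableSet_Icc, hvol, Measure.restrict_smul]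
  rw [e1, Measure.map_smul, e2, e3, smul_smul, ENNReal.div_eq_inv_mul, mul_comm]

end Generates

end Tree

end DyadicBellman

namespace DyadicBellman

section Tree

variable {X : Type*} [MeasurableSpace X]

/-! ### The weak type inequality for the maximal operator -/

open Classical in
/-- The union of the members of `G` found in the first `n` generations below `I`. -/
def descend (C : Set X → Set (Set X)) (G : Set (Set X)) : ℕ → Set X → Set X
  | 0, I => if I ∈ G then I else ∅
  | n + 1, I => if I ∈ G then I else ⋃ J ∈ C I, descend C G n J

/-- The `n`-th generation below `I`. -/
def levelBelow (C : Set X → Set (Set X)) : ℕ → Set X → Set (Set X)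
  | 0, I => {I}
  | n + 1, I => ⋃ J ∈ C I, levelBelow C n J

omit [MeasurableSpace X] in
lemma levelBelow_succ (C : Set X → Set (Set X)) (n : ℕ) (I : Set X) :
    levelBelow C (n + 1) I = ⋃ J ∈ levelBelow C n I, C J := by
  induction n generalizing I with
  | zero => simp [levelBelow]
  | succ n ih =>
    have hlev : ∀ n, levelBelow C (n + 1) I = ⋃ J ∈ C I, levelBelow C n J := fun _ => rfl
    ext K
    simp only [hlev (n + 1), hlev n, ih, mem_iUnion, exists_prop]
    grind

omit [MeasurableSpace X] in
lemma level_eq_levelBelow (C : Set X → Set (Set X)) (n : ℕ) : level C n = levelBelow C n univ := by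
  induction n with
  | zero => rfl
  | succ n ih => rw [levelBelow_succ, level, ih]

namespace Generates

variable {μ : Measure X} {𝒯 : Set (Set X)} {C : Set X → Set (Set X)} (h : Generates μ 𝒯 C)
include h

lemma descend_subset (G : Set (Set X)) (n : ℕ) {I : Set X} (hI : I ∈ 𝒯) :
    descend C G n I ⊆ I := by
  induction n generalizing I with
  | zero => rw [descend]; split_ifs <;> simp
  | succ n ih =>
    rw [descend]; split_ifs
    · rfl
    · exact iUnion₂_subset fun J hJ => (ih (h.sub I hI hJ)).trans (h.child_subset hI hJ)

lemma descend_mono (G : Set (Set X)) {I : Set X} (hI : I ∈ 𝒯) :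
    Monotone fun n => descend C G n I := by
  refine monotone_nat_of_le_succ fun n => ?_
  induction n generalizing I with
  | zero =>
    show descend C G 0 I ⊆ descend C G 1 I
    rw [descend, descend]; split_ifs <;> simp
  | succ n ih =>
    show descend C G (n + 1) I ⊆ descend C G (n + 1 + 1) I
    rw [descend, descend]; split_ifs
    · rfl
    · exact iUnion₂_mono fun J hJ => ih (h.sub I hI hJ)

lemma measurableSet_descend (G : Set (Set X)) (n : ℕ) {I : Set X} (hI : I ∈ 𝒯) :
    MeasurableSet (descend C G n I) := by
  induction n generalizing I with
  | zero => rw [descend]; split_ifs; exacts [h.meas I hI, MeasurableSet.empty]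
  | succ n ih =>
    rw [descend]; split_ifs
    · exact h.meas I hI
    · exact MeasurableSet.biUnion (h.countable I hI) fun J hJ => ih (h.sub I hI hJ)

lemma subset_descend (G : Set (Set X)) (n : ℕ) {I J : Set X} (hI : I ∈ 𝒯)
    (hJ : J ∈ levelBelow C n I) (hJG : J ∈ G) : J ⊆ I ∧ J ⊆ descend C G n I := by
  induction n generalizing I with
  | zero =>
    obtain rfl : J = I := hJ
    rw [descend, if_pos hJG]; exact ⟨le_rfl, le_rfl⟩
  | succ n ih =>
    simp only [levelBelow, mem_iUnion, exists_prop] at hJ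
    obtain ⟨K, hK, hJK⟩ := hJ
    obtain ⟨h1, h2⟩ := ih (h.sub I hI hK) hJK
    have h3 := h1.trans (h.child_subset hI hK)
    refine ⟨h3, ?_⟩
    rw [descend]; split_ifs
    · exact h3
    · exact h2.trans (subset_biUnion_of_mem (u := fun J => descend C G n J) hK)

lemma iUnion_descend {G : Set (Set X)} (hG : G ⊆ 𝒯) : ⋃ n, descend C G n univ = ⋃₀ G := by
  apply subset_antisymm
  · refine iUnion_subset fun n => ?_
    suffices ∀ I, descend C G n I ⊆ ⋃₀ G from this univ
    induction n with
    | zero =>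
      intro I; rw [descend]; split_ifs with hI
      · exact subset_sUnion_of_mem hI
      · simp
    | succ n ih =>
      intro I; rw [descend]; split_ifs with hI
      · exact subset_sUnion_of_mem hI
      · exact iUnion₂_subset fun J _ => ih J
  · refine sUnion_subset fun J hJ => ?_
    have := hG hJ
    rw [h.eq_levels, mem_iUnion] at this
    obtain ⟨n, hn⟩ := this
    rw [level_eq_levelBelow] at hn
    exact (h.subset_descend G n h.univ_mem hn hJ).2.trans
      (subset_iUnion (fun n => descend C G n univ) n)

/-- Stopping at the first member of `G` met on the way down leaves almost disjoint pieces, so the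
inequality adds up over children. Subadditivity suffices for `μ`; for `ν` additivity is needed, and
almost disjointness passes to `ν` by absolute continuity. -/
lemma mul_measure_descend_le {ν : Measure X} (hν : ν ≪ μ) {G : Set (Set X)} {r : ℝ≥0∞}
    (hG : ∀ I ∈ G, r * μ I ≤ ν I) (n : ℕ) {I : Set X} (hI : I ∈ 𝒯) :
    r * μ (descend C G n I) ≤ ν (descend C G n I) := by
  induction n generalizing I with
  | zero => rw [descend]; split_ifs with h0; exacts [hG I h0, by simp]
  | succ n ih =>
    rw [descend]; split_ifs with h0
    · exact hG I h0
    · have hd : (C I).Pairwise (Function.onFun (AEDisjoint ν) fun J => descend C G n J) := by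
        intro J hJ K hK hJK
        exact hν ((h.disj I hI hJ hK hJK).mono (h.descend_subset G n (h.sub I hI hJ))
          (h.descend_subset G n (h.sub I hI hK)))
      rw [measure_biUnion₀ (h.countable I hI) hd fun J hJ =>
        (h.measurableSet_descend G n (h.sub I hI hJ)).nullMeasurableSet]
      calc r * μ (⋃ J ∈ C I, descend C G n J)
          ≤ r * ∑' J : C I, μ (descend C G n J) := by
            gcongr; exact measure_biUnion_le _ (h.countable I hI) _
        _ = ∑' J : C I, r * μ (descend C G n J) := ENNReal.tsum_mul_left.symm
        _ ≤ _ := ENNReal.tsum_le_tsum fun J => ih (h.sub I hI J.2)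

lemma mul_measure_sUnion_le {ν : Measure X} (hν : ν ≪ μ) {G : Set (Set X)} {r : ℝ≥0∞}
    (hr : r ≠ ∞) (hGT : G ⊆ 𝒯) (hG : ∀ I ∈ G, r * μ I ≤ ν I) : r * μ (⋃₀ G) ≤ ν (⋃₀ G) := by
  have hm := h.descend_mono G h.univ_mem
  rw [← h.iUnion_descend hGT]
  refine le_of_tendsto_of_tendsto'
    (ENNReal.Tendsto.const_mul (tendsto_measure_iUnion_atTop hm) (Or.inr hr))
    (tendsto_measure_iUnion_atTop hm) fun n => h.mul_measure_descend_le hν hG n h.univ_mem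

lemma lt_maximal_eq [IsFiniteMeasure μ] (φ : X → ℝ) (r : ℝ≥0∞) :
    {x | r < maximal μ 𝒯 φ x} = ⋃₀ {I ∈ 𝒯 | r * μ I < ∫⁻ y in I, ‖φ y‖ₑ ∂μ} := by
  ext x
  change r < maximal μ 𝒯 φ x ↔ _
  simp only [maximal, lt_iSup_iff, mem_sUnion]
  constructor
  · rintro ⟨I, hI, hx, hlt⟩
    refine ⟨I, ⟨hI, ?_⟩, hx⟩
    rwa [ENNReal.lt_div_iff_mul_lt (Or.inl (h.pos I hI).ne') (Or.inl (measure_ne_top _ _))] at hlt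
  · rintro ⟨I, ⟨hI, hlt⟩, hx⟩
    refine ⟨I, hI, hx, ?_⟩
    rwa [ENNReal.lt_div_iff_mul_lt (Or.inl (h.pos I hI).ne') (Or.inl (measure_ne_top _ _))]

lemma measurable_maximal [IsFiniteMeasure μ] (φ : X → ℝ) : Measurable (maximal μ 𝒯 φ) := by
  refine measurable_of_Ioi fun r => ?_
  have := h.lt_maximal_eq φ r
  change MeasurableSet {x | r < maximal μ 𝒯 φ x}
  rw [this]
  exact MeasurableSet.sUnion (h.tree_countable.mono (sep_subset _ _)) fun I hI => h.meas I hI.1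

/-- The maximal function exceeds `l` on a set over which the average is at least `l`. -/
lemma mul_measure_le_maximal [IsFiniteMeasure μ] {φ : X → ℝ} (hφ : Integrable φ μ) {l : ℝ≥0∞}
    (hl : l ≠ ∞) :
    l * μ {x | l ≤ maximal μ 𝒯 φ x} ≤ ∫⁻ x in {x | l ≤ maximal μ 𝒯 φ x}, ‖φ x‖ₑ ∂μ := by
  rcases eq_or_ne l 0 with rfl | hl0
  · simp
  let ν := μ.withDensity fun x => ‖φ x‖ₑ
  have hνf : IsFiniteMeasure ν := isFiniteMeasure_withDensity hφ.2.ne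
  -- The supremum defining the maximal function need not be attained, so the covering argument is
  -- applied to strict level sets at heights `u n` increasing to `l`.
  obtain ⟨u, hu, hul, hlim⟩ := exists_seq_strictMono_tendsto' (pos_iff_ne_zero.2 hl0)
  let E : ℕ → Set X := fun n => {x | u n < maximal μ 𝒯 φ x}
  have hE : {x | l ≤ maximal μ 𝒯 φ x} = ⋂ n, E n := by
    ext x
    simp only [E, mem_iInter]
    change l ≤ maximal μ 𝒯 φ x ↔ ∀ n, u n < maximal μ 𝒯 φ x
    exact ⟨fun hx n => (hul n).2.trans_le hx, fun hx => le_of_tendsto' hlim fun n => (hx n).le⟩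
  have hEm : ∀ n, MeasurableSet (E n) := fun n => measurableSet_lt measurable_const
    (h.measurable_maximal φ)
  have hanti : Antitone E := fun m n hmn x hx => (hu.monotone hmn).trans_lt hx
  rw [← withDensity_apply _ (measurableSet_le measurable_const (h.measurable_maximal φ))]
  have h1 : ∀ n, u n * μ (E n) ≤ ν (E n) := by
    intro n
    simp only [E]
    rw [h.lt_maximal_eq φ (u n)]
    refine h.mul_measure_sUnion_le (withDensity_absolutelyContinuous _ _)
      ((hul n).2.trans_le le_top).ne (sep_subset _ _) fun I hI => ?_
    rw [withDensity_apply _ (h.meas I hI.1)]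
    exact hI.2.le
  rw [hE]
  have hl' : Tendsto (fun n => u n * μ (⋂ n, E n)) atTop (𝓝 (l * μ (⋂ n, E n))) :=
    ENNReal.Tendsto.mul_const hlim (Or.inr (measure_ne_top μ _))
  refine le_of_tendsto_of_tendsto' hl'
    (tendsto_measure_iInter_atTop (fun n => (hEm n).nullMeasurableSet) hanti
      ⟨0, measure_ne_top ν _⟩) fun n => ?_
  exact (mul_le_mul_right (measure_mono (iInter_subset E n)) _).trans (h1 n)

/-! ### Almost disjoint subfamilies of prescribed total measure -/

/-- Collect children one at a time until their union exceeds measure `β`. The child that causes the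
excess is `J`, and the missing amount is less than `μ J`. -/
lemma exists_children_split {I : Set X} (hI : I ∈ 𝒯) {β : ℝ≥0∞} (hβ : β < μ I) :
    ∃ S ⊆ C I, ∃ J ∈ C I, J ∉ S ∧ ∃ β' < μ J, μ (⋃₀ S) + β' = β := by
  classical
  have hne : (C I).Nonempty := by
    by_contra hne
    have := h.union I hI
    rw [not_nonempty_iff_eq_empty.1 hne, sUnion_empty] at this
    exact (h.pos I hI).ne' (by rw [this]; simp)
  obtain ⟨e, he⟩ := (h.countable I hI).exists_eq_range hne
  let σ : ℕ → Set X := fun k => ⋃₀ (e '' Iio k)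
  have hσm : Monotone σ := fun m n hmn => sUnion_mono (image_mono (Iio_subset_Iio hmn))
  have hσI : ⋃ k, σ k = I := by
    conv_rhs => rw [h.union I hI, he]
    ext x; simp only [σ, mem_iUnion, mem_sUnion, mem_image, mem_range, mem_Iio]
    constructor
    · rintro ⟨k, t, ⟨i, hi, rfl⟩, hx⟩; exact ⟨e i, ⟨i, rfl⟩, hx⟩
    · rintro ⟨t, ⟨i, rfl⟩, hx⟩; exact ⟨i + 1, e i, ⟨i, Nat.lt_succ_self i, rfl⟩, hx⟩
  have hex : ∃ k, β < μ (σ k) := by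
    have := tendsto_measure_iUnion_atTop (μ := μ) hσm
    rw [hσI] at this
    exact (this.eventually_const_lt hβ).exists
  obtain ⟨n, hn⟩ : ∃ n, Nat.find hex = n + 1 := by
    refine Nat.exists_eq_succ_of_ne_zero fun h0 => ?_
    have := Nat.find_spec hex
    rw [h0] at this
    simp [σ] at this
  have h1 : β < μ (σ (n + 1)) := hn ▸ Nat.find_spec hex
  have h2 : μ (σ n) ≤ β := not_lt.1 (Nat.find_min hex (by omega))
  have h3 : σ (n + 1) = σ n ∪ e n := by
    ext x; simp only [σ, mem_sUnion, mem_image, mem_Iio, mem_union]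
    constructor
    · rintro ⟨t, ⟨i, hi, rfl⟩, hx⟩
      rcases (Nat.lt_succ_iff.1 hi).eq_or_lt with rfl | hi
      · exact Or.inr hx
      · exact Or.inl ⟨e i, ⟨i, hi, rfl⟩, hx⟩
    · rintro (⟨t, ⟨i, hi, rfl⟩, hx⟩ | hx)
      · exact ⟨e i, ⟨i, hi.trans (Nat.lt_succ_self n), rfl⟩, hx⟩
      · exact ⟨e n, ⟨n, Nat.lt_succ_self n, rfl⟩, hx⟩
  refine ⟨e '' Iio n, ?_, e n, ?_, ?_, β - μ (σ n), ?_, add_tsub_cancel_of_le h2⟩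
  · rw [he]; exact image_subset_range _ _
  · rw [he]; exact mem_range_self n
  -- The enumeration may repeat; a repeated child would not have enlarged the union.
  · intro hmem
    have : σ (n + 1) = σ n := by
      rw [h3, union_eq_left]; exact subset_sUnion_of_mem hmem
    rw [this] at h1
    exact absurd h1 (not_lt.2 h2)
  · refine ENNReal.sub_lt_of_lt_add h2 ?_
    rw [add_comm]
    exact h1.trans_le (h3 ▸ measure_union_le _ _)

/-- Greedy selection: split a tree set, keep the collected children, and carry the remaining measure
into the one child `J`, where the procedure is repeated. After `n` rounds the remainder is below the
measure of a set of generation `n`, hence it tends to zero. -/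
lemma exists_subfamily {α : ℝ≥0∞} (hα : α < μ univ) :
    ∃ 𝒮 ⊆ 𝒯, 𝒮.Pairwise (AEDisjoint μ) ∧ μ (⋃₀ 𝒮) = α := by
  let σ := {z : Set X × ℝ≥0∞ // z.1 ∈ 𝒯 ∧ z.2 < μ z.1}
  have hstep : ∀ z : σ, ∃ S ⊆ C z.1.1, ∃ J ∈ C z.1.1, J ∉ S ∧ ∃ β' < μ J, μ (⋃₀ S) + β' = z.1.2 :=
    fun z => h.exists_children_split z.2.1 z.2.2
  choose S hSC J hJC hJS b hb hsum using hstep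
  let z : ℕ → σ := fun n =>
    (fun z : σ => (⟨(J z, b z), h.sub _ z.2.1 (hJC z), hb z⟩ : σ))^[n] ⟨(univ, α), h.univ_mem, hα⟩
  have hz : ∀ n, (z (n + 1)).1 = (J (z n), b (z n)) := by
    intro n; simp only [z, Function.iterate_succ_apply']
  have hlev : ∀ n, (z n).1.1 ∈ level C n := by
    intro n
    induction n with
    | zero => rfl
    | succ n ih => rw [hz]; exact mem_biUnion ih (hJC (z n))
  have hanti : Antitone fun n => (z n).1.1 := by
    refine antitone_nat_of_succ_le fun n => ?_
    rw [hz]; exact h.child_subset (z n).2.1 (hJC (z n))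
  have hSsub : ∀ n, ⋃₀ S (z n) ⊆ (z n).1.1 := fun n => sUnion_subset fun K hK =>
    h.child_subset (z n).2.1 (hSC _ hK)
  have hSmem : ∀ n, ∀ K ∈ S (z n), K ∈ 𝒯 := fun n K hK => h.sub _ (z n).2.1 (hSC _ hK)
  have hScount : ∀ n, (S (z n)).Countable := fun n => (h.countable _ (z n).2.1).mono (hSC _)
  -- All later selections lie inside the next carrier set, so this one fact gives disjointness
  -- across rounds.
  have hSJ : ∀ n, ∀ K ∈ S (z n), AEDisjoint μ K (z (n + 1)).1.1 := by
    intro n K hK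
    rw [hz]
    exact h.disj _ (z n).2.1 (hSC _ hK) (hJC _) fun h0 => hJS _ (h0 ▸ hK)
  let E : ℕ → Set X := fun n => ⋃ k ∈ Iio n, ⋃₀ S (z k)
  have hEm : ∀ n, E (n + 1) = E n ∪ ⋃₀ S (z n) := by
    intro n
    ext x; simp only [E, mem_iUnion, mem_Iio, mem_union, exists_prop, Nat.lt_succ_iff_lt_or_eq]
    grind
  have hdisj : ∀ n, AEDisjoint μ (E n) (z n).1.1 := by
    intro n
    induction n with
    | zero => simp [E, AEDisjoint]
    | succ n ih =>
      rw [hEm, AEDisjoint.union_left_iff]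
      refine ⟨ih.mono le_rfl (hanti n.le_succ), ?_⟩
      rw [AEDisjoint, sUnion_eq_biUnion, iUnion₂_inter]
      exact (measure_biUnion_null_iff (hScount n)).2 fun K hK => hSJ n K hK
  have hmeasure : ∀ n, μ (E n) + (z n).1.2 = α := by
    intro n
    induction n with
    | zero => simp [E, z]
    | succ n ih =>
      rw [hEm, measure_union₀
        (MeasurableSet.sUnion (hScount n) fun K hK => h.meas K (hSmem n K hK)).nullMeasurableSet
        ((hdisj n).mono le_rfl (hSsub n)), hz, add_assoc, hsum, ih]
  refine ⟨⋃ n, S (z n), iUnion_subset fun n K hK => hSmem n K hK, ?_, ?_⟩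
  · have key : ∀ m n, m < n → ∀ K ∈ S (z m), ∀ L ∈ S (z n), AEDisjoint μ K L := by
      intro m n hmn K hK L hL
      exact (hSJ m K hK).mono le_rfl ((h.child_subset (z n).2.1 (hSC _ hL)).trans (hanti hmn))
    intro K hK L hL hKL
    obtain ⟨m, hm⟩ := mem_iUnion.1 hK
    obtain ⟨n, hn⟩ := mem_iUnion.1 hL
    rcases lt_trichotomy m n with h1 | rfl | h1
    · exact key m n h1 K hm L hn
    · exact h.disj _ (z m).2.1 (hSC _ hm) (hSC _ hn) hKL
    · exact (key n m h1 L hn K hm).symm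
  · have hEmono : Monotone E := monotone_nat_of_le_succ fun n => by
      rw [hEm]; exact subset_union_left
    have hU : ⋃₀ (⋃ n, S (z n)) = ⋃ n, E n := by
      ext x; simp only [E, mem_sUnion, mem_iUnion, mem_Iio, exists_prop]
      constructor
      · rintro ⟨K, ⟨n, hn⟩, hx⟩; exact ⟨n + 1, n, n.lt_succ_self, K, hn, hx⟩
      · rintro ⟨_, n, _, K, hn, hx⟩; exact ⟨K, ⟨n, hn⟩, hx⟩
    rw [hU]
    have ht := tendsto_measure_iUnion_atTop (μ := μ) hEmono
    have h0 : Tendsto (fun n => (z n).1.2) atTop (𝓝 0) :=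
      tendsto_of_tendsto_of_tendsto_of_le_of_le tendsto_const_nhds h.lim (fun _ => bot_le)
        fun n => (z n).2.2.le.trans (measure_level_le (hlev n))
    have := ht.add h0
    simp only [hmeasure, Function.comp_apply, add_zero] at this
    exact tendsto_nhds_unique this tendsto_const_nhds

end Generates

end Tree

end DyadicBellman

namespace DyadicBellman

/-! ### The extremal profile -/

/-- The decreasing function `u ↦ ((p-1)/p) u^{-1/p}`, extremal for the weak quasi-norm bound. -/
noncomputable def prof (p u : ℝ) : ℝ := (p - 1) / p * u ^ (-1 / p)

variable {p q : ℝ}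

lemma measurable_prof : Measurable (prof p) := by
  unfold prof; fun_prop

lemma kappa_pos (hp : 1 < p) : 0 < (p - 1) / p := by
  apply div_pos <;> linarith

lemma kappa_lt_one (hp : 1 < p) : (p - 1) / p < 1 := by
  rw [div_lt_one (by linarith)]; linarith

lemma one_sub_inv (hp : 1 < p) : 1 - 1 / p = (p - 1) / p := by
  field_simp

lemma prof_nonneg (hp : 1 < p) {u : ℝ} (hu : 0 ≤ u) : 0 ≤ prof p u :=
  mul_nonneg (kappa_pos hp).le (Real.rpow_nonneg hu _)

lemma prof_pos (hp : 1 < p) {u : ℝ} (hu : 0 < u) : 0 < prof p u :=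
  mul_pos (kappa_pos hp) (Real.rpow_pos_of_pos hu _)

lemma prof_anti (hp : 1 < p) {u v : ℝ} (hu : 0 < u) (huv : u ≤ v) : prof p v ≤ prof p u := by
  refine mul_le_mul_of_nonneg_left ?_ (kappa_pos hp).le
  refine Real.rpow_le_rpow_of_nonpos hu huv ?_
  rw [neg_div]; simp only [Left.neg_nonpos_iff]; positivity

lemma prof_strictAnti (hp : 1 < p) {u v : ℝ} (hu : 0 < u) (huv : u < v) :
    prof p v < prof p u := by
  refine mul_lt_mul_of_pos_left ?_ (kappa_pos hp)
  refine Real.rpow_lt_rpow_of_neg hu huv ?_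
  rw [neg_div]; simp only [Left.neg_neg_iff]; positivity

lemma prof_one : prof p 1 = (p - 1) / p := by simp [prof]

/-- The superlevel sets of the profile are intervals of length exactly the largest measure that the
weak bound `κ` allows. -/
lemma le_prof_iff (hp : 1 < p) {t u : ℝ} (ht : 0 < t) (hu : 0 < u) :
    t ≤ prof p u ↔ u ≤ ((p - 1) / p / t) ^ p := by
  have hκ := kappa_pos hp
  have hp0 : 0 < p := by linarith
  have h1 : prof p u = (p - 1) / p / u ^ (1 / p) := by
    rw [prof, neg_div, Real.rpow_neg hu.le, div_eq_mul_inv _ (u ^ (1 / p))]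
  have hup : 0 < u ^ (1 / p) := Real.rpow_pos_of_pos hu _
  rw [h1, le_div_iff₀ hup, mul_comm, ← le_div_iff₀ ht]
  rw [one_div, Real.rpow_inv_le_iff_of_pos hu.le (by positivity) hp0]

lemma prof_beta (hp : 1 < p) {t : ℝ} (ht : 0 < t) : prof p (((p - 1) / p / t) ^ p) = t := by
  have hκ := kappa_pos hp
  have hp0 : p ≠ 0 := by linarith
  rw [prof, ← Real.rpow_mul (by positivity), mul_div_cancel₀ _ hp0, Real.rpow_neg_one, inv_div, mul_div_assoc',
    mul_div_cancel_left₀ _ hκ.ne']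

/-! ### Integrals of the profile and of its truncations -/

section Integrals

lemma intervalIntegrable_prof_rpow (hp : 1 < p) {r : ℝ} (hrp : r < p) (x y : ℝ) :
    IntervalIntegrable (fun u => u ^ (-r / p)) volume x y := by
  apply intervalIntegral.intervalIntegrable_rpow'
  rw [neg_div, neg_lt_neg_iff, div_lt_one (by linarith)]; exact hrp

lemma intervalIntegrable_prof (hp : 1 < p) (x y : ℝ) :
    IntervalIntegrable (prof p) volume x y :=
  (intervalIntegrable_prof_rpow hp hp x y).const_mul _

lemma prof_rpow (hp : 1 < p) {u : ℝ} (hu : 0 ≤ u) :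
    prof p u ^ q = ((p - 1) / p) ^ q * u ^ (-q / p) := by
  rw [prof, Real.mul_rpow (kappa_pos hp).le (Real.rpow_nonneg hu _), ← Real.rpow_mul hu]
  congr 2; ring

lemma intervalIntegrable_prof_pow (hp : 1 < p) (hqp : q < p) {x y : ℝ} (hx : 0 ≤ x) (hy : 0 ≤ y) :
    IntervalIntegrable (fun u => prof p u ^ q) volume x y := by
  refine ((intervalIntegrable_prof_rpow hp hqp x y).const_mul (((p - 1) / p) ^ q)).congr ?_
  intro u hu
  simp only []
  rw [prof_rpow hp ((le_min hx hy).trans hu.1.le)]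

lemma integral_prof (hp : 1 < p) (x y : ℝ) :
    ∫ u in x..y, prof p u = y ^ (1 - 1 / p) - x ^ (1 - 1 / p) := by
  have hp0 : p ≠ 0 := by linarith
  have hp1 : p - 1 ≠ 0 := by linarith
  simp only [prof]
  rw [intervalIntegral.integral_const_mul, integral_rpow]
  · have : -1 / p + 1 = 1 - 1 / p := by ring
    rw [this, one_sub_inv hp]; field_simp
  · left; rw [neg_div, neg_lt_neg_iff, div_lt_one (by linarith)]; exact hp

lemma integral_prof_pow (hp : 1 < p) (hqp : q < p) {x y : ℝ} (hx : 0 ≤ x) (hy : 0 ≤ y) :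
    ∫ u in x..y, prof p u ^ q = Gam p q * (y ^ (1 - q / p) - x ^ (1 - q / p)) := by
  have hp0 : p ≠ 0 := by linarith
  have hp1 : p - q ≠ 0 := by linarith
  have : ∫ u in x..y, prof p u ^ q = ∫ u in x..y, ((p - 1) / p) ^ q * u ^ (-q / p) := by
    refine intervalIntegral.integral_congr fun u hu => ?_
    rw [prof_rpow hp ((le_min hx hy).trans hu.1)]
  rw [this, intervalIntegral.integral_const_mul, integral_rpow]
  · have h1 : -q / p + 1 = 1 - q / p := by ring
    have h2 : 1 - q / p = (p - q) / p := by field_simp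
    rw [h1, Gam, h2]; field_simp
  · left; rw [neg_div, neg_lt_neg_iff, div_lt_one (by linarith)]; exact hqp

/-- Integrability of functions below the profile. -/
lemma intervalIntegrable_of_le_prof (hp : 1 < p) {g : ℝ → ℝ} (hg : Measurable g) {x y : ℝ}
    (hxy : x ≤ y) (h0 : ∀ u ∈ Ioc x y, 0 ≤ g u) (h1 : ∀ u ∈ Ioc x y, g u ≤ prof p u) :
    IntervalIntegrable g volume x y := by
  rw [intervalIntegrable_iff_integrableOn_Ioc_of_le hxy]
  refine Integrable.mono' ((intervalIntegrable_iff_integrableOn_Ioc_of_le hxy).1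
    (intervalIntegrable_prof hp x y)) hg.aestronglyMeasurable ?_
  filter_upwards [ae_restrict_mem measurableSet_Ioc] with u hu
  rw [Real.norm_of_nonneg (h0 u hu)]; exact h1 u hu

lemma intervalIntegrable_pow_of_le_prof (hq : 1 < q) (hqp : q < p) {g : ℝ → ℝ} (hg : Measurable g)
    {x y : ℝ} (hx : 0 ≤ x) (hxy : x ≤ y) (h0 : ∀ u ∈ Ioc x y, 0 ≤ g u)
    (h1 : ∀ u ∈ Ioc x y, g u ≤ prof p u) :
    IntervalIntegrable (fun u => g u ^ q) volume x y := by
  rw [intervalIntegrable_iff_integrableOn_Ioc_of_le hxy]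
  refine Integrable.mono' ((intervalIntegrable_iff_integrableOn_Ioc_of_le hxy).1
    (intervalIntegrable_prof_pow (hq.trans hqp) hqp hx (hx.trans hxy)))
    (hg.pow_const q).aestronglyMeasurable ?_
  filter_upwards [ae_restrict_mem measurableSet_Ioc] with u hu
  rw [Real.norm_of_nonneg (Real.rpow_nonneg (h0 u hu) _)]
  exact Real.rpow_le_rpow (h0 u hu) (h1 u hu) (by linarith)

lemma measurable_min_prof (b : ℝ) : Measurable fun u => min b (prof p u) :=
  measurable_const.min measurable_prof

lemma min_prof_nonneg (hp : 1 < p) {b : ℝ} (hb : 0 ≤ b) {u : ℝ} (hu : 0 ≤ u) :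
    0 ≤ min b (prof p u) := le_min hb (prof_nonneg hp hu)

lemma intervalIntegrable_min_prof (hp : 1 < p) {b : ℝ} (hb : 0 ≤ b) {x y : ℝ}
    (hx : 0 ≤ x) (hxy : x ≤ y) : IntervalIntegrable (fun u => min b (prof p u)) volume x y :=
  intervalIntegrable_of_le_prof hp (measurable_min_prof b) hxy
    (fun _ hu => min_prof_nonneg hp hb (hx.trans hu.1.le)) fun _ _ => min_le_right _ _

lemma intervalIntegrable_min_prof_pow (hq : 1 < q) (hqp : q < p) {b : ℝ} (hb : 0 ≤ b) {x y : ℝ}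
    (hx : 0 ≤ x) (hxy : x ≤ y) :
    IntervalIntegrable (fun u => min b (prof p u) ^ q) volume x y :=
  intervalIntegrable_pow_of_le_prof hq hqp (measurable_min_prof b) hx hxy
    (fun _ hu => min_prof_nonneg (hq.trans hqp) hb (hx.trans hu.1.le)) fun _ _ => min_le_right _ _

lemma integral_min_prof_of_le (hp : 1 < p) {b x y : ℝ} (hx : 0 ≤ x) (hxy : x ≤ y)
    (hb : b ≤ prof p y) (r : ℝ) :
    ∫ u in x..y, min b (prof p u) ^ r = (y - x) * b ^ r := by
  rw [← smul_eq_mul, ← intervalIntegral.integral_const, intervalIntegral.integral_of_le hxy,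
    intervalIntegral.integral_of_le hxy]
  refine setIntegral_congr_fun measurableSet_Ioc fun u hu => ?_
  rw [min_eq_left (hb.trans (prof_anti hp (hx.trans_lt hu.1) hu.2))]

lemma integral_min_prof_of_ge (hp : 1 < p) {b x y : ℝ} (hx : 0 < x) (hxy : x ≤ y)
    (hb : prof p x ≤ b) (r : ℝ) :
    ∫ u in x..y, min b (prof p u) ^ r = ∫ u in x..y, prof p u ^ r := by
  rw [intervalIntegral.integral_of_le hxy, intervalIntegral.integral_of_le hxy]
  refine setIntegral_congr_fun measurableSet_Ioc fun u hu => ?_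
  rw [min_eq_right ((prof_anti hp hx hu.1.le).trans hb)]

/-- Since the profile decreases, truncation at the height `prof p c` is constant on `[x, c]` and
inactive on `[c, y]`. -/
lemma integral_min_prof (hp : 1 < p) {c x y : ℝ} (hx : 0 ≤ x) (hxc : x ≤ c) (hc : 0 < c)
    (hcy : c ≤ y) :
    ∫ u in x..y, min (prof p c) (prof p u) =
      (c - x) * prof p c + (y ^ (1 - 1 / p) - c ^ (1 - 1 / p)) := by
  have hb := (prof_pos hp hc).le
  rw [← intervalIntegral.integral_add_adjacent_intervals
    (intervalIntegrable_min_prof hp hb hx hxc) (intervalIntegrable_min_prof hp hb hc.le hcy),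
    ← integral_prof hp c y]
  have h1 := integral_min_prof_of_le hp hx hxc (le_refl (prof p c)) 1
  have h2 := integral_min_prof_of_ge hp hc hcy (le_refl (prof p c)) 1
  simp only [Real.rpow_one] at h1 h2
  rw [h1, h2]

lemma integral_min_prof_pow (hq : 1 < q) (hqp : q < p) {c x y : ℝ} (hx : 0 ≤ x) (hxc : x ≤ c)
    (hc : 0 < c) (hcy : c ≤ y) :
    ∫ u in x..y, min (prof p c) (prof p u) ^ q =
      (c - x) * prof p c ^ q + Gam p q * (y ^ (1 - q / p) - c ^ (1 - q / p)) := by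
  have hp : 1 < p := hq.trans hqp
  have hb := (prof_pos hp hc).le
  rw [← intervalIntegral.integral_add_adjacent_intervals
    (intervalIntegrable_min_prof_pow hq hqp hb hx hxc)
    (intervalIntegrable_min_prof_pow hq hqp hb hc.le hcy),
    ← integral_prof_pow hp hqp hc.le (hc.le.trans hcy)]
  rw [integral_min_prof_of_le hp hx hxc (le_refl (prof p c)) q,
    integral_min_prof_of_ge hp hc hcy (le_refl (prof p c)) q]

end Integrals

end DyadicBellman

namespace DyadicBellman

variable {X : Type*} [MeasurableSpace X] {μ : Measure X} {𝒯 : Set (Set X)}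
  {C : Set X → Set (Set X)} {p q f A l α : ℝ}

/-! ### Realizing a profile along the tree -/

/-- Each member of `𝒮` sees the whole segment `(0, α]`, so a function of `V` has the same average
over every member. `V` is glued from uniform variables on the members and one on the complement of
their union. -/
lemma Generates.exists_layout [IsProbabilityMeasure μ] (h : Generates μ 𝒯 C) (h0 : 0 < α)
    (h1 : α < 1) :
    ∃ 𝒮 ⊆ 𝒯, μ (⋃₀ 𝒮) = ENNReal.ofReal α ∧ ∃ V : X → ℝ, Measurable V ∧
      μ.map V = volume.restrict (Ioc 0 1) ∧
      ∀ J ∈ 𝒮, (μ.restrict J).map V = (μ J / ENNReal.ofReal α) • volume.restrict (Ioc 0 α) := by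
  classical
  obtain ⟨𝒮, hST, hdisj, hmeas⟩ := h.exists_subfamily (α := ENNReal.ofReal α)
    (by rw [measure_univ]; exact ENNReal.ofReal_lt_one.2 h1)
  have hcount : 𝒮.Countable := h.tree_countable.mono hST
  have hSm : ∀ J ∈ 𝒮, MeasurableSet J := fun J hJ => h.meas J (hST hJ)
  have hUm : MeasurableSet (⋃₀ 𝒮) := MeasurableSet.sUnion hcount hSm
  have hcompl : μ (⋃₀ 𝒮)ᶜ = ENNReal.ofReal (1 - α) := by
    rw [prob_compl_eq_one_sub hUm, hmeas, ENNReal.ofReal_sub _ h0.le, ENNReal.ofReal_one]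
  have hU : ∀ J : 𝒮, ∃ U : X → ℝ, Measurable U ∧ (μ.restrict J).map U =
      (μ J / ENNReal.ofReal α) • volume.restrict (Ioc 0 α) := by
    intro J
    obtain ⟨U, hU1, hU2⟩ := h.exists_uniform (S := J) (h.pos _ (hST J.2)).ne' h0
    refine ⟨U, hU1, ?_⟩
    rw [hU2, sub_zero, Measure.restrict_congr_set Ioc_ae_eq_Icc]
  choose U hUmeas hUmap using hU
  obtain ⟨W, hW, hWmap⟩ := h.exists_uniform (S := (⋃₀ 𝒮)ᶜ)
    (by rw [hcompl]; simpa using h1) h1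
  rw [hcompl, ENNReal.div_self (by simpa using h1) ENNReal.ofReal_ne_top, one_smul,
    ← Measure.restrict_congr_set (Ioc_ae_eq_Icc (μ := volume) (a := α) (b := 1))] at hWmap
  -- Gluing needs truly disjoint pieces, so the null overlaps are removed from the members; `none`
  -- stands for the complement.
  let t : Option 𝒮 → Set X := fun o => o.elim (⋃₀ 𝒮)ᶜ fun J => J \ ⋃ K ∈ 𝒮 \ {J.1}, K
  let G : Option 𝒮 → X → ℝ := fun o => o.elim W U
  have : Countable 𝒮 := hcount.to_subtype
  have ht : ∀ o, MeasurableSet (t o) := by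
    rintro (_ | J)
    · exact hUm.compl
    · exact (hSm J J.2).diff (MeasurableSet.biUnion (hcount.mono sdiff_subset)
        fun K hK => hSm K hK.1)
  have htd : ∀ o o', o ≠ o' → t o ∩ t o' = ∅ := by
    rintro (_ | J) (_ | K) hne
    · exact absurd rfl hne
    · ext x; simp only [t, Option.elim, mem_inter_iff, mem_compl_iff, mem_empty_iff_false, iff_false]
      rintro ⟨h1, h2⟩; exact h1 ⟨K, K.2, h2.1⟩
    · ext x; simp only [t, Option.elim, mem_inter_iff, mem_compl_iff, mem_empty_iff_false, iff_false]
      rintro ⟨h1, h2⟩; exact h2 ⟨J, J.2, h1.1⟩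
    · ext x; simp only [t, Option.elim, mem_inter_iff, mem_empty_iff_false, iff_false]
      rintro ⟨h1, h2⟩
      refine h1.2 (mem_biUnion (x := K.1) ⟨K.2, fun h3 => hne ?_⟩ h2.1)
      rw [Subtype.ext (h3 : K.1 = J.1)]
  have htae : ∀ J : 𝒮, (J : Set X) =ᵐ[μ] t (some J) := by
    intro J
    have e : t (some J) = J.1 \ (J.1 ∩ ⋃ K ∈ 𝒮 \ {J.1}, K) := by
      ext x; simp only [t, Option.elim, Set.mem_sdiff, mem_inter_iff]; tauto
    rw [e]
    refine (sdiff_null_ae_eq_self ?_).symm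
    rw [inter_iUnion₂]
    exact (measure_biUnion_null_iff (hcount.mono sdiff_subset)).2 fun K hK =>
      hdisj J.2 hK.1 fun h => hK.2 h.symm
  obtain ⟨V, hV, hVeq⟩ := exists_measurable_piecewise t ht G
    (by rintro (_ | J); exacts [hW, hUmeas J])
    (fun o o' hne => by simp only [htd o o' hne]; exact eqOn_empty _ _)
  have hVJ : ∀ J ∈ 𝒮, (μ.restrict J).map V =
      (μ J / ENNReal.ofReal α) • volume.restrict (Ioc 0 α) := by
    intro J hJ
    rw [← hUmap ⟨J, hJ⟩]
    refine Measure.map_congr ?_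
    rw [Measure.restrict_congr_set (htae ⟨J, hJ⟩)]
    filter_upwards [ae_restrict_mem (ht _)] with x hx using hVeq _ hx
  have hVc : (μ.restrict (⋃₀ 𝒮)ᶜ).map V = volume.restrict (Ioc α 1) := by
    rw [← hWmap]
    refine Measure.map_congr ?_
    filter_upwards [ae_restrict_mem hUm.compl] with x hx using hVeq none hx
  refine ⟨𝒮, hST, hmeas, V, hV, ?_, hVJ⟩
  have hVu : (μ.restrict (⋃₀ 𝒮)).map V = volume.restrict (Ioc 0 α) := by
    have e1 : μ.restrict (⋃₀ 𝒮) = Measure.sum fun J : 𝒮 => μ.restrict J := by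
      rw [sUnion_eq_iUnion]
      exact Measure.restrict_iUnion_ae
        (fun J K hJK => hdisj J.2 K.2 fun h => hJK (Subtype.ext h))
        fun J => (hSm J J.2).nullMeasurableSet
    have e2 : ∑' J : 𝒮, μ J = ENNReal.ofReal α := by
      rw [← hmeas, sUnion_eq_iUnion]
      exact (measure_iUnion₀ (fun J K hJK => hdisj J.2 K.2 fun h => hJK (Subtype.ext h))
        fun J => (hSm J J.2).nullMeasurableSet).symm
    rw [e1]
    ext s hs
    rw [Measure.map_apply hV hs, Measure.sum_apply _ (hV hs)]
    have e3 : ∀ J : 𝒮, μ.restrict J (V ⁻¹' s)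
        = μ J * ((ENNReal.ofReal α)⁻¹ * volume.restrict (Ioc 0 α) s) := by
      intro J
      rw [← Measure.map_apply hV hs, hVJ J J.2, Measure.smul_apply, smul_eq_mul, div_eq_mul_inv,
        mul_assoc]
    simp_rw [e3]
    rw [ENNReal.tsum_mul_right, e2, ← mul_assoc, ENNReal.mul_inv_cancel (by simpa using h0)
      ENNReal.ofReal_ne_top, one_mul]
  rw [← Measure.restrict_add_restrict_compl (μ := μ) hUm, Measure.map_add _ _ hV, hVu, hVc,
    ← Measure.restrict_union (Ioc_disjoint_Ioc_of_le le_rfl) measurableSet_Ioc,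
    Ioc_union_Ioc_eq_Ioc h0.le h1.le]

lemma weakNorm_le_of_measure_le (hp : 1 < p) {φ : X → ℝ}
    (hφ : ∀ t : ℝ, 0 < t → μ {x | t ≤ |φ x|} ≤ ENNReal.ofReal (((p - 1) / p / t) ^ p)) :
    weakNorm μ p φ ≤ ENNReal.ofReal ((p - 1) / p) := by
  have hκ := kappa_pos hp
  refine iSup₂_le fun t ht => ?_
  calc ENNReal.ofReal t * μ {x | t ≤ |φ x|} ^ (1 / p)
      ≤ ENNReal.ofReal t * ENNReal.ofReal (((p - 1) / p / t) ^ p) ^ (1 / p) := by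
        gcongr; exact hφ t ht
    _ = ENNReal.ofReal ((p - 1) / p) := by
        rw [ENNReal.ofReal_rpow_of_nonneg (by positivity) (by positivity),
          ← Real.rpow_mul (by positivity), mul_one_div_cancel (by linarith), Real.rpow_one,
          ← ENNReal.ofReal_mul ht.le, mul_div_cancel₀ _ ht.ne']

lemma measure_le_of_weakNorm_le (hp : 1 < p) {φ : X → ℝ}
    (hφ : weakNorm μ p φ ≤ ENNReal.ofReal ((p - 1) / p)) {t : ℝ} (ht : 0 < t) :
    μ {x | t ≤ |φ x|} ≤ ENNReal.ofReal (((p - 1) / p / t) ^ p) := by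
  have hκ := kappa_pos hp
  have hp0 : 0 < p := by linarith
  have h1 : ENNReal.ofReal t * μ {x | t ≤ |φ x|} ^ (1 / p) ≤ ENNReal.ofReal ((p - 1) / p) :=
    (le_iSup₂_of_le (f := fun (t : ℝ) (_ : 0 < t) => ENNReal.ofReal t * μ {x | t ≤ |φ x|} ^ (1 / p))
      t ht le_rfl).trans hφ
  rw [mul_comm, ← ENNReal.le_div_iff_mul_le (Or.inl (by simpa using ht))
    (Or.inl ENNReal.ofReal_ne_top), ← ENNReal.ofReal_div_of_pos ht, one_div,
    ENNReal.rpow_inv_le_iff hp0, ENNReal.ofReal_rpow_of_nonneg (by positivity) hp0.le] at h1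
  exact h1

/-- A profile below the extremal one, with large enough integral over `[0, α]`, bounds the Bellman
function from below. -/
lemma Generates.le_B₁_of_profile [IsProbabilityMeasure μ] (h : Generates μ 𝒯 C) (hq : 1 < q)
    (hqp : q < p) (h0 : 0 < α) (h1 : α < 1) {g : ℝ → ℝ} (hg : Measurable g) (hg0 : ∀ u, 0 ≤ g u)
    (hgw : ∀ u ∈ Ioc (0 : ℝ) 1, g u ≤ prof p u) (hgl : l * α ≤ ∫ u in (0 : ℝ)..α, g u)
    (hgf : ∫ u in (0 : ℝ)..1, g u = f) (hgA : ∫ u in (0 : ℝ)..1, g u ^ q = A) :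
    ENNReal.ofReal α ≤ B₁ μ 𝒯 p q f A l := by
  have hp : 1 < p := hq.trans hqp
  obtain ⟨𝒮, hST, hmeas, V, hV, hVmap, hVJ⟩ := h.exists_layout h0 h1
  have hgi : IntegrableOn g (Ioc 0 1) volume :=
    (intervalIntegrable_iff_integrableOn_Ioc_of_le zero_le_one).1
      (intervalIntegrable_of_le_prof hp hg zero_le_one (fun u _ => hg0 u) hgw)
  have hgqi : IntegrableOn (fun u => g u ^ q) (Ioc 0 1) volume :=
    (intervalIntegrable_iff_integrableOn_Ioc_of_le zero_le_one).1
      (intervalIntegrable_pow_of_le_prof hq hqp hg le_rfl zero_le_one (fun u _ => hg0 u) hgw)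
  rw [intervalIntegral.integral_of_le zero_le_one] at hgf hgA
  rw [intervalIntegral.integral_of_le h0.le] at hgl
  let φ : X → ℝ := fun x => g (V x)
  have hφc : φ ∈ competitors μ p q f A := by
    refine ⟨hg.comp hV, fun x => hg0 _, ?_, ?_, ?_, ?_, ?_⟩
    · have := hgi
      rw [IntegrableOn, ← hVmap] at this
      exact this.comp_measurable hV
    · rw [← hgf, ← hVmap]
      exact (integral_map hV.aemeasurable hg.aestronglyMeasurable).symm
    · have := hgqi
      rw [IntegrableOn, ← hVmap] at this
      exact this.comp_measurable hV
    · rw [← hgA, ← hVmap]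
      exact (integral_map hV.aemeasurable (hg.pow_const q).aestronglyMeasurable).symm
    · refine weakNorm_le_of_measure_le hp fun t ht => ?_
      have e : {x | t ≤ |φ x|} = V ⁻¹' {u | t ≤ g u} := by
        ext x
        change t ≤ |φ x| ↔ t ≤ g (V x)
        rw [abs_of_nonneg (hg0 _)]
      have hms : MeasurableSet {u | t ≤ g u} := measurableSet_le measurable_const hg
      rw [e, ← Measure.map_apply hV hms, hVmap, Measure.restrict_apply hms]
      calc volume ({u | t ≤ g u} ∩ Ioc 0 1) ≤ volume (Ioc 0 (((p - 1) / p / t) ^ p)) := by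
            refine measure_mono fun u hu => ⟨hu.2.1, ?_⟩
            have hu1 : t ≤ g u := hu.1
            exact (le_prof_iff hp ht hu.2.1).1 (hu1.trans (hgw u hu.2))
        _ = _ := by rw [Real.volume_Ioc, sub_zero]
  refine le_trans ?_ (le_iSup₂ (f := fun φ (_ : φ ∈ competitors μ p q f A) =>
    μ {x | ENNReal.ofReal l ≤ maximal μ 𝒯 φ x}) φ hφc)
  rw [← hmeas]
  refine measure_mono ?_
  rintro x ⟨J, hJ, hx⟩
  change ENNReal.ofReal l ≤ maximal μ 𝒯 φ x
  refine le_trans ?_ (le_iSup₂_of_le J (hST hJ) (le_iSup_of_le hx le_rfl))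
  have hμJ := (h.pos J (hST hJ)).ne'
  rw [ENNReal.le_div_iff_mul_le (Or.inl hμJ) (Or.inl (measure_ne_top _ _))]
  -- The average of `φ` over `J` equals that of `g` over `(0, α]`, which is at least `l`.
  have e1 : ∫⁻ y in J, ‖φ y‖ₑ ∂μ = μ J / ENNReal.ofReal α * ∫⁻ u in Ioc 0 α, ‖g u‖ₑ := by
    rw [← smul_eq_mul, ← lintegral_smul_measure, ← hVJ J hJ, lintegral_map hg.enorm hV]
  have e2 : ∫⁻ u in Ioc 0 α, ‖g u‖ₑ = ENNReal.ofReal (∫ u in Ioc 0 α, g u) := by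
    rw [ofReal_integral_eq_lintegral_ofReal (hgi.mono_set (Ioc_subset_Ioc_right h1.le))
      (Eventually.of_forall hg0)]
    refine lintegral_congr fun u => ?_
    exact Real.enorm_of_nonneg (hg0 u)
  rw [e1, e2]
  calc ENNReal.ofReal l * μ J
      = μ J / ENNReal.ofReal α * (ENNReal.ofReal l * ENNReal.ofReal α) := by
        rw [mul_comm (ENNReal.ofReal l) (ENNReal.ofReal α), ← mul_assoc,
          ENNReal.div_mul_cancel (by simpa using h0) ENNReal.ofReal_ne_top, mul_comm]
    _ ≤ _ := by
        rw [← ENNReal.ofReal_mul' h0.le]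
        gcongr

end DyadicBellman

namespace DyadicBellman

variable {X : Type*} [MeasurableSpace X] {μ : Measure X} {p q f A l α a b : ℝ}

/-! ### Comparison with the extremal profile -/

lemma volume_prof_lt (hp : 1 < p) {t : ℝ} (ht : 0 < t) :
    volume.restrict (Ioc 0 α) {u | prof p u < t} = ENNReal.ofReal (α - ((p - 1) / p / t) ^ p) := by
  have hκ := kappa_pos hp
  have hms : MeasurableSet {u | prof p u < t} := measurableSet_lt measurable_prof measurable_const
  rw [Measure.restrict_apply hms, ← Real.volume_Ioc]
  congr 1
  have hβ : 0 < ((p - 1) / p / t) ^ p := by positivity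
  ext u
  change prof p u < t ∧ (0 < u ∧ u ≤ α) ↔ _ < u ∧ u ≤ α
  constructor
  · rintro ⟨h1, h2, h3⟩
    exact ⟨not_le.1 fun h => not_le.2 h1 ((le_prof_iff hp ht h2).2 h), h3⟩
  · rintro ⟨h1, h2⟩
    have h3 := hβ.trans h1
    exact ⟨not_le.1 fun h => not_le.2 h1 ((le_prof_iff hp ht h3).1 h), h3, h2⟩

lemma volume_prof_ge (hp : 1 < p) {t : ℝ} (ht : 0 < t) :
    volume.restrict (Ioc 0 α) {u | t ≤ prof p u} =
      ENNReal.ofReal (min α (((p - 1) / p / t) ^ p)) := by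
  have hms : MeasurableSet {u | t ≤ prof p u} := measurableSet_le measurable_const measurable_prof
  rw [Measure.restrict_apply hms]
  trans volume (Ioc 0 (min α (((p - 1) / p / t) ^ p)))
  · congr 1
    ext u
    change t ≤ prof p u ∧ (0 < u ∧ u ≤ α) ↔ 0 < u ∧ u ≤ min _ _
    rw [le_min_iff]
    constructor
    · rintro ⟨h1, h2, h3⟩; exact ⟨h2, h3, (le_prof_iff hp ht h2).1 h1⟩
    · rintro ⟨h2, h3, h1⟩; exact ⟨(le_prof_iff hp ht h2).2 h1, h2, h3⟩
  · rw [Real.volume_Ioc, sub_zero]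

lemma eq_empty_or_eq_Ici_of_isClosed_of_upper {S : Set ℝ} (hc : IsClosed S) (h0 : S ⊆ Ici 0)
    (hup : ∀ x ∈ S, ∀ y, x ≤ y → y ∈ S) : S = ∅ ∨ ∃ t, 0 ≤ t ∧ S = Ici t := by
  rcases eq_empty_or_nonempty S with h | h
  · exact Or.inl h
  · have hb : BddBelow S := ⟨0, fun x hx => h0 hx⟩
    have hm := hc.csInf_mem h hb
    refine Or.inr ⟨sInf S, h0 hm, subset_antisymm (fun x hx => csInf_le hb hx) fun x hx => hup _ hm _ hx⟩

/-- An antitone function integrates to at least as much along `φ` as along the profile. -/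
lemma integral_prof_le_of_antitoneOn [IsFiniteMeasure μ] (hp : 1 < p) {φ : X → ℝ}
    (hφ : Measurable φ) (hφ0 : ∀ x, 0 ≤ φ x)
    (hw : ∀ t : ℝ, 0 < t → μ {x | t ≤ φ x} ≤ ENNReal.ofReal (((p - 1) / p / t) ^ p))
    {E : Set X} (hα : 0 ≤ α) (hμE : μ E = ENNReal.ofReal α)
    {k : ℝ → ℝ} (hk : Continuous k) (hanti : AntitoneOn k (Ici 0)) {L : ℝ}
    (hL : ∀ x, 0 ≤ x → L ≤ k x) :
    ∫ u in (0 : ℝ)..α, k (prof p u) ≤ ∫ x in E, k (φ x) ∂μ := by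
  rw [intervalIntegral.integral_of_le hα]
  have hup : ∀ x, 0 ≤ x → k x ≤ k 0 := fun x hx => hanti self_mem_Ici hx hx
  have hi1 : Integrable (fun u => k (prof p u)) (volume.restrict (Ioc 0 α)) := by
    refine Integrable.of_mem_Icc L (k 0) (hk.measurable.comp measurable_prof).aemeasurable ?_
    filter_upwards [ae_restrict_mem measurableSet_Ioc] with u hu
    have := prof_nonneg hp hu.1.le
    exact ⟨hL _ this, hup _ this⟩
  have hi2 : Integrable (fun x => k (φ x)) (μ.restrict E) :=
    Integrable.of_mem_Icc L (k 0) (hk.measurable.comp hφ).aemeasurable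
      (Eventually.of_forall fun x => ⟨hL _ (hφ0 x), hup _ (hφ0 x)⟩)
  have e1 : ∫ u in Ioc 0 α, (k (prof p u) - L) = (∫ u in Ioc 0 α, k (prof p u)) - α * L := by
    rw [integral_sub hi1 (integrable_const _), setIntegral_const, Measure.real, Real.volume_Ioc,
      sub_zero, ENNReal.toReal_ofReal hα, smul_eq_mul]
  have e2 : ∫ x in E, (k (φ x) - L) ∂μ = (∫ x in E, k (φ x) ∂μ) - α * L := by
    rw [integral_sub hi2 (integrable_const _), setIntegral_const, Measure.real, hμE,
      ENNReal.toReal_ofReal hα, smul_eq_mul]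
  suffices ∫ u in Ioc 0 α, (k (prof p u) - L) ≤ ∫ x in E, (k (φ x) - L) ∂μ by linarith
  have hn1 : 0 ≤ᵐ[volume.restrict (Ioc 0 α)] fun u => k (prof p u) - L := by
    filter_upwards [ae_restrict_mem measurableSet_Ioc] with u hu
    exact sub_nonneg.2 (hL _ (prof_nonneg hp hu.1.le))
  have hn2 : 0 ≤ᵐ[μ.restrict E] fun x => k (φ x) - L :=
    Eventually.of_forall fun x => sub_nonneg.2 (hL _ (hφ0 x))
  have hi1' : Integrable (fun u => k (prof p u) - L) (volume.restrict (Ioc 0 α)) :=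
    hi1.sub (integrable_const L)
  have hi2' : Integrable (fun x => k (φ x) - L) (μ.restrict E) := hi2.sub (integrable_const L)
  rw [← ENNReal.ofReal_le_ofReal_iff (integral_nonneg_of_ae hn2),
    ofReal_integral_eq_lintegral_ofReal hi1' hn1, ofReal_integral_eq_lintegral_ofReal hi2' hn2,
    lintegral_eq_lintegral_meas_lt _ hn1 hi1'.aemeasurable,
    lintegral_eq_lintegral_meas_lt _ hn2 hi2'.aemeasurable]
  -- Layer-cake comparison: superlevel sets of an antitone function are sublevel sets `{φ < t}`. The
  -- weak bound gives these measure at least `α - (κ/t)^p` within `E`, with equality (up to the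
  -- positive part) for the profile. Subtracting `L` has made both integrands nonnegative.
  refine lintegral_mono fun s => ?_
  have hS : IsClosed {x : ℝ | 0 ≤ x ∧ k x - L ≤ s} :=
    (isClosed_le continuous_const continuous_id).inter
      (isClosed_le (hk.sub continuous_const) continuous_const)
  have hmem : ∀ x, 0 ≤ x → (s < k x - L ↔ x ∉ {x : ℝ | 0 ≤ x ∧ k x - L ≤ s}) := fun x hx =>
    ⟨fun h h' => not_le.2 h h'.2, fun h => not_le.1 fun h' => h ⟨hx, h'⟩⟩
  rcases eq_empty_or_eq_Ici_of_isClosed_of_upper hS (fun x hx => hx.1) (fun x hx y hxy =>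
    ⟨hx.1.trans hxy, (sub_le_sub_right (hanti hx.1 (hx.1.trans hxy) hxy) L).trans hx.2⟩) with h | ⟨t, ht, h⟩
  · have : {x | s < k (φ x) - L} = univ := by
      refine eq_univ_of_forall fun x => (hmem _ (hφ0 x)).2 ?_
      rw [h]; exact notMem_empty _
    change _ ≤ μ.restrict E {x | s < k (φ x) - L}
    rw [this, Measure.restrict_apply_univ, hμE]
    refine (measure_mono (subset_univ _)).trans ?_
    rw [Measure.restrict_apply_univ, Real.volume_Ioc, sub_zero]
  · have h1 : volume.restrict (Ioc 0 α) {u | s < k (prof p u) - L} =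
        volume.restrict (Ioc 0 α) {u | prof p u < t} := by
      refine measure_congr ?_
      filter_upwards [ae_restrict_mem measurableSet_Ioc] with u hu
      refine propext ?_
      change s < k (prof p u) - L ↔ prof p u < t
      rw [hmem _ (prof_nonneg hp hu.1.le), h, mem_Ici, not_le]
    have h2 : {x | s < k (φ x) - L} = {x | φ x < t} := by
      ext x
      change s < k (φ x) - L ↔ φ x < t
      rw [hmem _ (hφ0 x), h, mem_Ici, not_le]
    change volume.restrict (Ioc 0 α) {u | s < k (prof p u) - L} ≤
      μ.restrict E {x | s < k (φ x) - L}
    rw [h1, h2]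
    rcases ht.eq_or_lt with rfl | ht
    · have : volume.restrict (Ioc 0 α) {u | prof p u < 0} = 0 := by
        rw [Measure.restrict_apply (measurableSet_lt measurable_prof measurable_const)]
        convert measure_empty (μ := (volume : Measure ℝ))
        ext u
        simp only [mem_inter_iff, mem_empty_iff_false, iff_false, not_and]
        intro h h'
        exact not_le.2 h (prof_nonneg hp h'.1.le)
      rw [this]; exact bot_le
    · rw [volume_prof_lt hp ht]
      have hms : MeasurableSet {x | φ x < t} := measurableSet_lt hφ measurable_const
      rw [Measure.restrict_apply hms, ENNReal.ofReal_sub _ (by have := kappa_pos hp; positivity),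
        tsub_le_iff_right, ← hμE]
      calc μ E ≤ μ (({x | φ x < t} ∩ E) ∪ {x | t ≤ φ x}) := by
            refine measure_mono fun x hx => ?_
            rcases lt_or_ge (φ x) t with h | h
            · exact Or.inl ⟨h, hx⟩
            · exact Or.inr h
        _ ≤ _ := measure_union_le _ _
        _ ≤ _ := by gcongr; exact hw t ht

/-- Layer cake: `μ(E ∩ {φ ≥ t}) ≤ min α ((κ/t)^p)`, with equality for the profile on `(0, α]`. -/
lemma setIntegral_le_of_weak [IsFiniteMeasure μ] (hp : 1 < p) {φ : X → ℝ}
    (hφ : Measurable φ) (hφ0 : ∀ x, 0 ≤ φ x) (hi : Integrable φ μ)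
    (hw : ∀ t : ℝ, 0 < t → μ {x | t ≤ φ x} ≤ ENNReal.ofReal (((p - 1) / p / t) ^ p))
    {E : Set X} (hα : 0 ≤ α) (hμE : μ E = ENNReal.ofReal α) :
    ∫ x in E, φ x ∂μ ≤ α ^ (1 - 1 / p) := by
  have h0 : (0 : ℝ) ^ (1 - 1 / p) = 0 :=
    Real.zero_rpow (by rw [one_sub_inv hp]; exact (kappa_pos hp).ne')
  have h1 := integral_prof hp 0 α
  rw [h0, sub_zero] at h1
  rw [← h1, intervalIntegral.integral_of_le hα]
  have hi1 := (intervalIntegrable_iff_integrableOn_Ioc_of_le hα).1 (intervalIntegrable_prof hp 0 α)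
  have hn1 : 0 ≤ᵐ[volume.restrict (Ioc 0 α)] prof p := by
    filter_upwards [ae_restrict_mem measurableSet_Ioc] with u hu
    exact prof_nonneg hp hu.1.le
  have hn2 : 0 ≤ᵐ[μ.restrict E] φ := Eventually.of_forall hφ0
  rw [← ENNReal.ofReal_le_ofReal_iff (integral_nonneg_of_ae hn1),
    ofReal_integral_eq_lintegral_ofReal hi1 hn1,
    ofReal_integral_eq_lintegral_ofReal hi.integrableOn hn2,
    lintegral_eq_lintegral_meas_le _ hn1 hi1.aemeasurable,
    lintegral_eq_lintegral_meas_le _ hn2 hφ.aemeasurable]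
  refine setLIntegral_mono' measurableSet_Ioi fun t ht => ?_
  rw [volume_prof_ge hp ht, ENNReal.ofReal_min]
  refine le_min ?_ ((Measure.restrict_apply_le E _).trans (hw t ht))
  rw [← hμE, ← Measure.restrict_apply_univ (s := E)]
  exact measure_mono (subset_univ _)

/-! ### Convexity -/

/-- Bernoulli's inequality for `x / y`. -/
lemma pow_tangent (hq : 1 < q) {x y : ℝ} (hx : 0 ≤ x) (hy : 0 ≤ y) :
    y ^ q + q * y ^ (q - 1) * (x - y) ≤ x ^ q := by
  rcases hy.eq_or_lt with rfl | hy
  · rw [Real.zero_rpow (by linarith), Real.zero_rpow (by linarith)]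
    simpa using Real.rpow_nonneg hx q
  have h := one_add_mul_self_le_rpow_one_add (s := x / y - 1) (p := q)
    (by have := div_nonneg hx hy.le; linarith) hq.le
  rw [show 1 + (x / y - 1) = x / y by ring, Real.div_rpow hx hy.le, le_div_iff₀ (by positivity)] at h
  refine le_trans (le_of_eq ?_) h
  rw [Real.rpow_sub_one hy.ne']
  field_simp

lemma pow_tangent_strict (hq : 1 < q) {x y : ℝ} (hx : 0 ≤ x) (hy : 0 ≤ y) (hxy : x ≠ y) :
    y ^ q + q * y ^ (q - 1) * (x - y) < x ^ q := by
  rcases hy.eq_or_lt with rfl | hy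
  · rw [Real.zero_rpow (by linarith), Real.zero_rpow (by linarith)]
    simpa using Real.rpow_pos_of_pos (lt_of_le_of_ne hx hxy.symm) q
  have h := one_add_mul_self_lt_rpow_one_add (s := x / y - 1) (p := q)
    (by have := div_nonneg hx hy.le; linarith)
    (by rw [Ne, sub_eq_zero, div_eq_one_iff_eq hy.ne']; exact hxy) hq
  rw [show 1 + (x / y - 1) = x / y by ring, Real.div_rpow hx hy.le, lt_div_iff₀ (by positivity)] at h
  refine lt_of_le_of_lt (le_of_eq ?_) h
  rw [Real.rpow_sub_one hy.ne']
  field_simp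

/-- The tangent inequality for the constrained minimizer `min b w` among values `x ≤ w`. -/
lemma pow_tangent_min (hq : 1 < q) {x w b : ℝ} (hx : 0 ≤ x) (hxw : x ≤ w) (hb : 0 ≤ b) :
    min b w ^ q + q * b ^ (q - 1) * (x - min b w) ≤ x ^ q := by
  rcases le_total b w with h | h
  · rw [min_eq_left h]; exact pow_tangent hq hx hb
  · rw [min_eq_right h]
    have hw := hx.trans hxw
    refine le_trans ?_ (pow_tangent hq hx hw)
    have : w ^ (q - 1) ≤ b ^ (q - 1) := Real.rpow_le_rpow hw h (by linarith)
    nlinarith [mul_nonneg (sub_nonneg.2 this) (sub_nonneg.2 hxw)]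

lemma pow_tangent_min_strict (hq : 1 < q) {x w b : ℝ} (hx : 0 ≤ x) (hxw : x ≤ w) (hb : 0 ≤ b)
    (hne : x ≠ min b w) :
    min b w ^ q + q * b ^ (q - 1) * (x - min b w) < x ^ q := by
  rcases le_total b w with h | h
  · rw [min_eq_left h] at hne ⊢; exact pow_tangent_strict hq hx hb hne
  · rw [min_eq_right h] at hne ⊢
    have hw := hx.trans hxw
    refine lt_of_le_of_lt ?_ (pow_tangent_strict hq hx hw hne)
    have : w ^ (q - 1) ≤ b ^ (q - 1) := Real.rpow_le_rpow hw h (by linarith)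
    nlinarith [mul_nonneg (sub_nonneg.2 this) (sub_nonneg.2 hxw)]

/-- The function `x ↦ x^q - q b^{q-1} x`, stopped at its minimum point `b`. -/
noncomputable def stopped (q b x : ℝ) : ℝ := min x b ^ q - q * b ^ (q - 1) * min x b

lemma continuous_stopped (hq : 1 < q) : Continuous (stopped q b) := by
  unfold stopped
  exact ((continuous_id.min continuous_const).rpow_const fun _ => Or.inr (by linarith)).sub
    (continuous_const.mul (continuous_id.min continuous_const))

lemma stopped_le (hq : 1 < q) (hb : 0 ≤ b) {x : ℝ} (hx : 0 ≤ x) :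
    stopped q b x + q * b ^ (q - 1) * x ≤ x ^ q := by
  have := pow_tangent_min hq hx le_rfl hb
  rw [stopped, min_comm]; linarith

lemma antitoneOn_stopped (hq : 1 < q) (hb : 0 ≤ b) : AntitoneOn (stopped q b) (Ici 0) := by
  intro x hx y hy hxy
  have hx : 0 ≤ x := hx
  have hx' : 0 ≤ min x b := le_min hx hb
  have := pow_tangent_min hq hx' (min_le_min_right b hxy) hb
  have h2 : min b (min y b) = min y b := min_eq_right (min_le_right _ _)
  rw [h2] at this
  rw [stopped, stopped]; linarith

lemma le_stopped (hq : 1 < q) (hb : 0 ≤ b) {x : ℝ} (hx : 0 ≤ x) :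
    stopped q b b ≤ stopped q b x := by
  rcases le_total x b with h | h
  · exact antitoneOn_stopped hq hb hx hb h
  · simp [stopped, min_eq_right h]

/-- Below `b` the powers cancel and a linear function of slope `-q (a^{q-1} - b^{q-1}) ≤ 0` remains;
above `b` the second term is constant and the first is antitone. -/
lemma antitoneOn_stopped_sub (hq : 1 < q) (hb : 0 ≤ b) (hba : b ≤ a) :
    AntitoneOn (fun x => stopped q a x - stopped q b x) (Ici 0) := by
  have h1 : b ^ (q - 1) ≤ a ^ (q - 1) := Real.rpow_le_rpow hb hba (by linarith)
  have low : ∀ x ≤ b, stopped q a x - stopped q b x = -(q * (a ^ (q - 1) - b ^ (q - 1)) * x) := by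
    intro x hx
    rw [stopped, stopped, min_eq_left hx, min_eq_left (hx.trans hba)]; ring
  have high : ∀ x, b ≤ x → stopped q b x = stopped q b b := by
    intro x hx; simp [stopped, min_eq_right hx]
  have hq1 : 0 ≤ q * (a ^ (q - 1) - b ^ (q - 1)) := mul_nonneg (by linarith) (sub_nonneg.2 h1)
  have A1 : AntitoneOn (fun x => stopped q a x - stopped q b x) (Icc 0 b) := by
    intro x hx y hy hxy
    simp only []
    rw [low x hx.2, low y hy.2]
    nlinarith
  have A2 : AntitoneOn (fun x => stopped q a x - stopped q b x) (Ici b) := by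
    intro x hx y hy hxy
    simp only []
    rw [high x hx, high y hy]
    have := antitoneOn_stopped hq (hb.trans hba) (hb.trans hx) (hb.trans hy) hxy
    linarith
  have : Ici (0 : ℝ) = Icc 0 b ∪ Ici b := (Icc_union_Ici_eq_Ici hb).symm
  rw [this]
  exact A1.union_right A2 (isGreatest_Icc hb) isLeast_Ici

/-- The lower bound for `∫ φ^q` by Lagrange duality, with multipliers attached to the levels
`a` on `E` and `b` off `E`. -/
lemma lagrangian_le [IsProbabilityMeasure μ] (hq : 1 < q) (hqp : q < p) {φ : X → ℝ}
    (hφ : φ ∈ competitors μ p q f A) {E : Set X} (hE : MeasurableSet E) (hα : 0 ≤ α) (hα1 : α ≤ 1)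
    (hμE : μ E = ENNReal.ofReal α) (hlα : l * α ≤ ∫ x in E, φ x ∂μ) (hb : 0 ≤ b) (hba : b ≤ a) :
    (∫ u in (0 : ℝ)..α, min a (prof p u) ^ q) +
      q * a ^ (q - 1) * (l * α - ∫ u in (0 : ℝ)..α, min a (prof p u)) +
      ((∫ u in α..1, min b (prof p u) ^ q) +
      q * b ^ (q - 1) * (f - l * α - ∫ u in α..1, min b (prof p u))) ≤ A := by
  have hp : 1 < p := hq.trans hqp
  obtain ⟨hm, h0, hi, hf, hqi, hA, hweak⟩ := hφ
  have ha : 0 ≤ a := hb.trans hba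
  have hw : ∀ t : ℝ, 0 < t → μ {x | t ≤ φ x} ≤ ENNReal.ofReal (((p - 1) / p / t) ^ p) := by
    intro t ht
    have := measure_le_of_weakNorm_le hp hweak ht
    simpa only [abs_of_nonneg (h0 _)] using this
  have hab : b ^ (q - 1) ≤ a ^ (q - 1) := Real.rpow_le_rpow hb hba (by linarith)
  have hint : ∀ c, 0 ≤ c → Integrable (fun x => stopped q c (φ x)) μ := fun c hc =>
    Integrable.of_mem_Icc (stopped q c c) (stopped q c 0)
      ((continuous_stopped hq).measurable.comp hm).aemeasurable
      (Eventually.of_forall fun x => ⟨le_stopped hq hc (h0 x),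
        antitoneOn_stopped hq hc self_mem_Ici (h0 x) (h0 x)⟩)
  have hintv : ∀ c, 0 ≤ c → ∀ x y, 0 ≤ x → x ≤ y →
      IntervalIntegrable (fun u => stopped q c (prof p u)) volume x y := by
    intro c hc x y hx hxy
    have := (intervalIntegrable_min_prof_pow hq hqp hc hx hxy).sub
      ((intervalIntegrable_min_prof hp hc hx hxy).const_mul (q * c ^ (q - 1)))
    refine this.congr fun u _ => ?_
    simp only [stopped, min_comm (prof p u)]
  have hval : ∀ c, 0 ≤ c → ∀ x y, 0 ≤ x → x ≤ y → ∫ u in x..y, stopped q c (prof p u) =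
      (∫ u in x..y, min c (prof p u) ^ q) - q * c ^ (q - 1) * ∫ u in x..y, min c (prof p u) := by
    intro c hc x y hx hxy
    rw [← intervalIntegral.integral_const_mul, ← intervalIntegral.integral_sub
      (intervalIntegrable_min_prof_pow hq hqp hc hx hxy)
      ((intervalIntegrable_min_prof hp hc hx hxy).const_mul (q * c ^ (q - 1)))]
    refine intervalIntegral.integral_congr fun u _ => ?_
    simp only [stopped, min_comm (prof p u)]
  -- integrate the pointwise tangent inequality over `S`
  have hpt : ∀ c, 0 ≤ c → ∀ S : Set X, (∫ x in S, stopped q c (φ x) ∂μ) +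
      q * c ^ (q - 1) * ∫ x in S, φ x ∂μ ≤ ∫ x in S, φ x ^ q ∂μ := by
    intro c hc S
    rw [← integral_const_mul, ← integral_add (hint c hc).integrableOn
      (hi.integrableOn.const_mul _)]
    exact integral_mono ((hint c hc).integrableOn.add (hi.integrableOn.const_mul _))
      hqi.integrableOn fun x => stopped_le hq hc (h0 x)
  have hE1 := hpt a ha E
  have hE2 := hpt b hb Eᶜ
  have s1 := integral_add_compl hE hqi
  have s2 := integral_add_compl hE hi
  have s3 := integral_add_compl hE (hint b hb)
  have s4 : ∫ x in E, (stopped q a (φ x) - stopped q b (φ x)) ∂μ =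
      (∫ x in E, stopped q a (φ x) ∂μ) - ∫ x in E, stopped q b (φ x) ∂μ :=
    integral_sub (hint a ha).integrableOn (hint b hb).integrableOn
  -- The set `E` need not carry the large values of `φ`, so the two sides of `E` cannot be compared
  -- with `[0, α]` and `[α, 1]` separately. Instead the `b`-function is compared on all of `X` and
  -- the antitone difference of the `a`- and `b`-functions on `E`.
  have d1 := integral_prof_le_of_antitoneOn (μ := μ) (α := 1) hp hm h0 hw (E := univ) zero_le_one
    (by simp) (continuous_stopped hq) (antitoneOn_stopped hq hb) (fun x hx => le_stopped hq hb hx)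
  have d2 := integral_prof_le_of_antitoneOn hp hm h0 hw hα hμE
    ((continuous_stopped hq).sub (continuous_stopped hq)) (antitoneOn_stopped_sub hq hb hba)
    (L := stopped q a a - stopped q b 0)
    (fun x hx => sub_le_sub (le_stopped hq ha hx) (antitoneOn_stopped hq hb self_mem_Ici hx hx))
  rw [setIntegral_univ] at d1
  have v1 := intervalIntegral.integral_add_adjacent_intervals (hintv b hb 0 α le_rfl hα)
    (hintv b hb α 1 hα hα1)
  have v2 : ∫ u in (0:ℝ)..α, (stopped q a (prof p u) - stopped q b (prof p u)) =
      (∫ u in (0:ℝ)..α, stopped q a (prof p u)) - ∫ u in (0:ℝ)..α, stopped q b (prof p u) :=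
    intervalIntegral.integral_sub (hintv a ha 0 α le_rfl hα) (hintv b hb 0 α le_rfl hα)
  have w1 := hval a ha 0 α le_rfl hα
  have w2 := hval b hb α 1 hα hα1
  rw [hf] at s2
  rw [hA] at s1
  set F₁ := ∫ x in E, φ x ∂μ
  have hF2 : ∫ x in Eᶜ, φ x ∂μ = f - F₁ := by linarith
  rw [hF2] at hE2
  have hq1 : 0 ≤ q * (a ^ (q - 1) - b ^ (q - 1)) := mul_nonneg (by linarith) (sub_nonneg.2 hab)
  -- Excess mass on `E` moves from the multiplier of `b` to that of `a`; this only helps because `b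
  -- ≤ a`.
  have key := mul_le_mul_of_nonneg_left hlα hq1
  simp only [Pi.sub_apply] at d2
  rw [s4, v2] at d2
  linarith

end DyadicBellman

namespace DyadicBellman

variable {X : Type*} [MeasurableSpace X] {μ : Measure X} {𝒯 : Set (Set X)}
  {C : Set X → Set (Set X)} {p q f A l α a b : ℝ}

/-! ### The truncated profile is the strict minimizer -/

/-- Integrate the tangent inequality at `min b (prof p)`: the linear term vanishes because the
integrals agree, and the inequality is strict on an interval of positive length. -/
lemma integral_min_prof_pow_lt (hq : 1 < q) (hqp : q < p) {g : ℝ → ℝ} (hg : Measurable g)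
    {x y : ℝ} (hx : 0 ≤ x) (hxy : x ≤ y) (h0 : ∀ u ∈ Ioc x y, 0 ≤ g u)
    (h1 : ∀ u ∈ Ioc x y, g u ≤ prof p u) (hb : 0 ≤ b)
    (heq : ∫ u in x..y, g u = ∫ u in x..y, min b (prof p u))
    {s t : ℝ} (hst : s < t) (hsub : Ioc s t ⊆ Ioc x y)
    (hne : ∀ u ∈ Ioc s t, g u ≠ min b (prof p u)) :
    ∫ u in x..y, min b (prof p u) ^ q < ∫ u in x..y, g u ^ q := by
  have hp : 1 < p := hq.trans hqp
  have i1 := intervalIntegrable_pow_of_le_prof hq hqp hg hx hxy h0 h1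
  have i2 := intervalIntegrable_of_le_prof hp hg hxy h0 h1
  have i3 := intervalIntegrable_min_prof_pow hq hqp hb hx hxy
  have i4 := intervalIntegrable_min_prof hp hb hx hxy
  have i5 := (i2.sub i4).const_mul (q * b ^ (q - 1))
  have i6 := (i1.sub i3).sub i5
  have e : ∫ u in x..y, (g u ^ q - min b (prof p u) ^ q -
      q * b ^ (q - 1) * (g u - min b (prof p u))) =
      (∫ u in x..y, g u ^ q) - ∫ u in x..y, min b (prof p u) ^ q := by
    rw [intervalIntegral.integral_sub (i1.sub i3) i5, intervalIntegral.integral_const_mul,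
      intervalIntegral.integral_sub i1 i3, intervalIntegral.integral_sub i2 i4, heq]
    ring
  have hpos : 0 < ∫ u in x..y, (g u ^ q - min b (prof p u) ^ q -
      q * b ^ (q - 1) * (g u - min b (prof p u))) := by
    rw [intervalIntegral.integral_of_le hxy]
    rw [integral_pos_iff_support_of_nonneg_ae]
    · refine lt_of_lt_of_le ?_ (measure_mono (s := Ioc s t) ?_)
      · rw [Measure.restrict_apply measurableSet_Ioc, inter_eq_left.2 hsub, Real.volume_Ioc]
        simpa using hst
      · intro u hu
        have hu' := hsub hu
        have := pow_tangent_min_strict hq (h0 u hu') (h1 u hu') hb (hne u hu)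
        rw [Function.mem_support]; linarith
    · filter_upwards [ae_restrict_mem measurableSet_Ioc] with u hu
      have := pow_tangent_min hq (h0 u hu) (h1 u hu) hb
      simp only [Pi.zero_apply]; linarith
    · exact (intervalIntegrable_iff_integrableOn_Ioc_of_le hxy).1 i6
  linarith

/-! ### Interpolation with the maximal profile -/

lemma zero_rpow_one_sub (hp : 1 < p) : (0 : ℝ) ^ (1 - 1 / p) = 0 :=
  Real.zero_rpow (by rw [one_sub_inv hp]; exact (kappa_pos hp).ne')

lemma one_sub_q_div (hp : 0 < p) : 1 - q / p = (p - q) / p := by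
  field_simp

lemma one_sub_div_pos (hqp : q < p) (hp : 0 < p) : 0 < 1 - q / p := by
  rw [one_sub_q_div hp]; exact div_pos (by linarith) hp

lemma intervalIntegral_indicator_Ioc {g : ℝ → ℝ} {x y c : ℝ} (hxc : x ≤ c) (hcy : c ≤ y) :
    ∫ u in x..y, (Ioc x c).indicator g u = ∫ u in x..c, g u := by
  rw [intervalIntegral.integral_of_le (hxc.trans hcy), intervalIntegral.integral_of_le hxc,
    setIntegral_indicator measurableSet_Ioc, inter_eq_right.2 (Ioc_subset_Ioc_right hcy)]

/-- Any profile whose `q`-norm is at most the prescribed one can be moved towards the profile of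
maximal `q`-norm until the prescribed value is reached. -/
lemma exists_profile_interpolation (hq : 1 < q) (hqp : q < p) (h0 : 0 < α) (h1 : α < 1)
    (hf0 : 0 < f) (hf1 : f ≤ 1) (hA : A ≤ Gam p q * f ^ ((p - q) / (p - 1)))
    (hlf : l * α ≤ f) (hlα : l * α ≤ α ^ (1 - 1 / p))
    {g : ℝ → ℝ} (hg : Measurable g) (hg0 : ∀ u, 0 ≤ g u)
    (hgw : ∀ u ∈ Ioc (0 : ℝ) 1, g u ≤ prof p u) (hgl : l * α ≤ ∫ u in (0 : ℝ)..α, g u)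
    (hgf : ∫ u in (0 : ℝ)..1, g u = f) (hgA : ∫ u in (0 : ℝ)..1, g u ^ q ≤ A) :
    ∃ g : ℝ → ℝ, Measurable g ∧ (∀ u, 0 ≤ g u) ∧ (∀ u ∈ Ioc (0 : ℝ) 1, g u ≤ prof p u) ∧
      l * α ≤ (∫ u in (0 : ℝ)..α, g u) ∧ ∫ u in (0 : ℝ)..1, g u = f ∧
      ∫ u in (0 : ℝ)..1, g u ^ q = A := by
  have hp : 1 < p := hq.trans hqp
  have hp0 : 0 < p := by linarith
  have hp1 : 0 < p - 1 := by linarith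
  -- The profile cut off after `c = f^{p/(p-1)}` has integral `f`, and its `q`-norm is the upper
  -- limit for `A` in `D`.
  obtain ⟨c, hc0, hc1, hcf, hcq⟩ : ∃ c : ℝ, 0 < c ∧ c ≤ 1 ∧ c ^ (1 - 1 / p) = f ∧
      c ^ (1 - q / p) = f ^ ((p - q) / (p - 1)) := by
    refine ⟨f ^ (p / (p - 1)), by positivity, Real.rpow_le_one hf0.le hf1 (by positivity), ?_, ?_⟩
    · rw [← Real.rpow_mul hf0.le, one_sub_inv hp]
      have : p / (p - 1) * ((p - 1) / p) = 1 := by field_simp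
      rw [this, Real.rpow_one]
    · rw [← Real.rpow_mul hf0.le, one_sub_q_div hp0]
      congr 1; field_simp
  let w : ℝ → ℝ := (Ioc 0 c).indicator (prof p)
  have hw : Measurable w := measurable_prof.indicator measurableSet_Ioc
  have hw0 : ∀ u, 0 ≤ w u := fun u => indicator_nonneg (fun u hu => prof_nonneg hp hu.1.le) u
  have hww : ∀ u ∈ Ioc (0 : ℝ) 1, w u ≤ prof p u := fun u hu => by
    simp only [w, indicator]; split_ifs
    · rfl
    · exact prof_nonneg hp hu.1.le
  have hwf : ∫ u in (0 : ℝ)..1, w u = f := by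
    rw [intervalIntegral_indicator_Ioc hc0.le hc1, integral_prof hp, zero_rpow_one_sub hp, hcf,
      sub_zero]
  have hwl : l * α ≤ ∫ u in (0 : ℝ)..α, w u := by
    rcases le_total c α with h | h
    · rw [intervalIntegral_indicator_Ioc hc0.le h, integral_prof hp, zero_rpow_one_sub hp, hcf,
        sub_zero]
      exact hlf
    · have : ∫ u in (0 : ℝ)..α, w u = ∫ u in (0 : ℝ)..α, prof p u := by
        rw [intervalIntegral.integral_of_le h0.le, intervalIntegral.integral_of_le h0.le]
        refine setIntegral_congr_fun measurableSet_Ioc fun u hu => ?_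
        have hu' : u ∈ Ioc 0 c := ⟨hu.1, hu.2.trans h⟩
        exact indicator_of_mem hu' _
      rw [this, integral_prof hp, zero_rpow_one_sub hp, sub_zero]
      exact hlα
  have hwA : ∫ u in (0 : ℝ)..1, w u ^ q = Gam p q * f ^ ((p - q) / (p - 1)) := by
    have : ∀ u, w u ^ q = (Ioc 0 c).indicator (fun u => prof p u ^ q) u := by
      intro u; simp only [w, indicator]; split_ifs
      · rfl
      · exact Real.zero_rpow (by linarith)
    simp_rw [this]
    rw [intervalIntegral_indicator_Ioc hc0.le hc1, integral_prof_pow hp hqp le_rfl hc0.le,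
      Real.zero_rpow (one_sub_div_pos hqp hp0).ne', hcq, sub_zero]
  -- Convex combinations keep the linear constraints and the bound by the profile, while their
  -- `q`-norm varies continuously.
  let G : ℝ → ℝ → ℝ := fun θ u => (1 - θ) * g u + θ * w u
  have hGm : ∀ θ, Measurable (G θ) := fun θ => (hg.const_mul _).add (hw.const_mul _)
  have hG0 : ∀ θ ∈ Icc (0 : ℝ) 1, ∀ u, 0 ≤ G θ u := fun θ hθ u =>
    add_nonneg (mul_nonneg (by linarith [hθ.2]) (hg0 u)) (mul_nonneg hθ.1 (hw0 u))
  have hGw : ∀ θ ∈ Icc (0 : ℝ) 1, ∀ u ∈ Ioc (0 : ℝ) 1, G θ u ≤ prof p u := by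
    intro θ hθ u hu
    have h2 := mul_le_mul_of_nonneg_left (hgw u hu) (sub_nonneg.2 hθ.2)
    have h3 := mul_le_mul_of_nonneg_left (hww u hu) hθ.1
    simp only [G]; linarith
  have hcont : ContinuousOn (fun θ => ∫ u in Ioc (0 : ℝ) 1, G θ u ^ q) (Icc 0 1) := by
    refine continuousOn_of_dominated (bound := fun u => prof p u ^ q)
      (fun θ _ => ((hGm θ).pow_const q).aestronglyMeasurable) ?_ ?_ ?_
    · intro θ hθ
      filter_upwards [ae_restrict_mem measurableSet_Ioc] with u hu
      rw [Real.norm_of_nonneg (Real.rpow_nonneg (hG0 θ hθ u) _)]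
      exact Real.rpow_le_rpow (hG0 θ hθ u) (hGw θ hθ u hu) (by linarith)
    · exact (intervalIntegrable_iff_integrableOn_Ioc_of_le zero_le_one).1
        (intervalIntegrable_prof_pow hp hqp le_rfl zero_le_one)
    · refine Eventually.of_forall fun u => Continuous.continuousOn ?_
      have : Continuous fun θ : ℝ => (1 - θ) * g u + θ * w u := by fun_prop
      exact this.rpow_const fun _ => Or.inr (by linarith)
  have hends : A ∈ Icc (∫ u in Ioc (0 : ℝ) 1, G 0 u ^ q) (∫ u in Ioc (0 : ℝ) 1, G 1 u ^ q) := by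
    simp only [G, sub_zero, one_mul, zero_mul, add_zero, sub_self, zero_add]
    rw [← intervalIntegral.integral_of_le zero_le_one, ← intervalIntegral.integral_of_le zero_le_one,
      hwA]
    exact ⟨hgA, hA⟩
  obtain ⟨θ, hθ, hθA⟩ := intermediate_value_Icc zero_le_one hcont hends
  have hint : ∀ y, 0 ≤ y → y ≤ 1 → ∫ u in (0 : ℝ)..y, G θ u =
      (1 - θ) * (∫ u in (0 : ℝ)..y, g u) + θ * ∫ u in (0 : ℝ)..y, w u := by
    intro y hy hy1
    rw [← intervalIntegral.integral_const_mul, ← intervalIntegral.integral_const_mul,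
      ← intervalIntegral.integral_add]
    · exact (intervalIntegrable_of_le_prof hp hg hy (fun u _ => hg0 u)
        fun u hu => hgw u ⟨hu.1, hu.2.trans hy1⟩).const_mul _
    · exact (intervalIntegrable_of_le_prof hp hw hy (fun u _ => hw0 u)
        fun u hu => hww u ⟨hu.1, hu.2.trans hy1⟩).const_mul _
  refine ⟨G θ, hGm θ, hG0 θ hθ, hGw θ hθ, ?_, ?_, ?_⟩
  · rw [hint α h0.le h1.le]
    have h2 := mul_le_mul_of_nonneg_left hgl (sub_nonneg.2 hθ.2)
    have h3 := mul_le_mul_of_nonneg_left hwl hθ.1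
    linarith
  · rw [hint 1 zero_le_one le_rfl, hgf, hwf]; ring
  · rw [intervalIntegral.integral_of_le zero_le_one]; exact hθA

/-- Lower bound for the Bellman function from profiles on `[0, α]` and `[α, 1]`. -/
lemma Generates.le_B₁_of_split [IsProbabilityMeasure μ] (h : Generates μ 𝒯 C) (hq : 1 < q)
    (hqp : q < p) (h0 : 0 < α) (h1 : α < 1) (hf0 : 0 < f) (hf1 : f ≤ 1)
    (hA : A ≤ Gam p q * f ^ ((p - q) / (p - 1)))
    (hlf : l * α ≤ f) (hlα : l * α ≤ α ^ (1 - 1 / p)) {g k : ℝ → ℝ}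
    (hg : Measurable g) (hg0 : ∀ u ∈ Ioc 0 α, 0 ≤ g u) (hgw : ∀ u ∈ Ioc 0 α, g u ≤ prof p u)
    (hk : Measurable k) (hk0 : ∀ u ∈ Ioc α 1, 0 ≤ k u) (hkw : ∀ u ∈ Ioc α 1, k u ≤ prof p u)
    (hgl : ∫ u in (0 : ℝ)..α, g u = l * α) (hkf : ∫ u in α..1, k u = f - l * α)
    (hgA : (∫ u in (0 : ℝ)..α, g u ^ q) + ∫ u in α..1, k u ^ q ≤ A) :
    ENNReal.ofReal α ≤ B₁ μ 𝒯 p q f A l := by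
  classical
  have hp : 1 < p := hq.trans hqp
  let G : ℝ → ℝ := fun u => if u ∈ Ioc 0 α then g u else if u ∈ Ioc α 1 then k u else 0
  have hG : Measurable G := Measurable.ite measurableSet_Ioc hg
    (Measurable.ite measurableSet_Ioc hk measurable_const)
  have hG0 : ∀ u, 0 ≤ G u := by
    intro u; simp only [G]; split_ifs with h h'
    exacts [hg0 u h, hk0 u h', le_rfl]
  have hGw : ∀ u ∈ Ioc (0 : ℝ) 1, G u ≤ prof p u := by
    intro u hu; simp only [G]; split_ifs with h h'
    exacts [hgw u h, hkw u h', prof_nonneg hp hu.1.le]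
  have e1 : ∀ u ∈ Ioc 0 α, G u = g u := fun u hu => if_pos hu
  have e2 : ∀ u ∈ Ioc α 1, G u = k u := fun u hu => by
    simp only [G]; rw [if_neg, if_pos hu]; exact fun h => not_lt.2 h.2 hu.1
  have c1 : ∀ F : ℝ → ℝ, ∫ u in (0 : ℝ)..α, F (G u) = ∫ u in (0 : ℝ)..α, F (g u) := fun F => by
    rw [intervalIntegral.integral_of_le h0.le, intervalIntegral.integral_of_le h0.le]
    exact setIntegral_congr_fun measurableSet_Ioc fun u hu => by simp only [e1 u hu]
  have c2 : ∀ F : ℝ → ℝ, ∫ u in α..1, F (G u) = ∫ u in α..1, F (k u) := fun F => by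
    rw [intervalIntegral.integral_of_le h1.le, intervalIntegral.integral_of_le h1.le]
    exact setIntegral_congr_fun measurableSet_Ioc fun u hu => by simp only [e2 u hu]
  have hG0α : ∀ u ∈ Ioc 0 α, G u ≤ prof p u := fun u hu => hGw u ⟨hu.1, hu.2.trans h1.le⟩
  have hGα1 : ∀ u ∈ Ioc α 1, G u ≤ prof p u := fun u hu => hGw u ⟨h0.trans hu.1, hu.2⟩
  have s1 := intervalIntegral.integral_add_adjacent_intervals
    (intervalIntegrable_of_le_prof hp hG h0.le (fun u _ => hG0 u) hG0α)
    (intervalIntegrable_of_le_prof hp hG h1.le (fun u _ => hG0 u) hGα1)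
  have s2 := intervalIntegral.integral_add_adjacent_intervals
    (intervalIntegrable_pow_of_le_prof hq hqp hG le_rfl h0.le (fun u _ => hG0 u) hG0α)
    (intervalIntegrable_pow_of_le_prof hq hqp hG h0.le h1.le (fun u _ => hG0 u) hGα1)
  have t1 := c1 id
  have t2 := c2 id
  have t3 := c1 (fun x => x ^ q)
  have t4 := c2 (fun x => x ^ q)
  simp only [id] at t1 t2 t3 t4
  obtain ⟨k', k1, k2, k3, k4, k5, k6⟩ := exists_profile_interpolation hq hqp h0 h1 hf0 hf1 hA
    hlf hlα hG hG0 hGw (by rw [t1, hgl]) (by rw [← s1, t1, t2, hgl, hkf]; ring)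
    (by rw [← s2, t3, t4]; exact hgA)
  exact h.le_B₁_of_profile hq hqp h0 h1 k1 k2 k3 k4 k5 k6

/-! ### A priori bounds for the level set -/

/-- Both bounds on `α` come from `l * α ≤ ∫_E φ`, whose right side is at most `f` and at most
`α^{1-1/p}`. -/
lemma Generates.level_set_bounds [IsProbabilityMeasure μ] (h : Generates μ 𝒯 C) (hq : 1 < q)
    (hqp : q < p) (hl : 0 < l) {φ : X → ℝ} (hφ : φ ∈ competitors μ p q f A) :
    ∃ E : Set X, ∃ α : ℝ, E = {x | ENNReal.ofReal l ≤ maximal μ 𝒯 φ x} ∧ MeasurableSet E ∧ 0 ≤ α ∧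
      α ≤ 1 ∧ μ E = ENNReal.ofReal α ∧ l * α ≤ ∫ x in E, φ x ∂μ ∧ α ≤ f / l ∧ α ≤ 1 / l ^ p := by
  have hp : 1 < p := hq.trans hqp
  obtain ⟨hm, h0, hi, hf, hqi, hA, hweak⟩ := hφ
  let E := {x | ENNReal.ofReal l ≤ maximal μ 𝒯 φ x}
  have hE : MeasurableSet E := measurableSet_le measurable_const (h.measurable_maximal φ)
  have hμE : μ E = ENNReal.ofReal (μ E).toReal := (ENNReal.ofReal_toReal (measure_ne_top _ _)).symm
  have hα0 : 0 ≤ (μ E).toReal := ENNReal.toReal_nonneg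
  have h1 := h.mul_measure_le_maximal hi (l := ENNReal.ofReal l) ENNReal.ofReal_ne_top
  have e2 : ∫⁻ x in E, ‖φ x‖ₑ ∂μ = ENNReal.ofReal (∫ x in E, φ x ∂μ) := by
    rw [ofReal_integral_eq_lintegral_ofReal hi.integrableOn (Eventually.of_forall h0)]
    exact lintegral_congr fun u => Real.enorm_of_nonneg (h0 u)
  change ENNReal.ofReal l * μ E ≤ ∫⁻ x in E, ‖φ x‖ₑ ∂μ at h1
  rw [e2, hμE, ← ENNReal.ofReal_mul hl.le,
    ENNReal.ofReal_le_ofReal_iff (integral_nonneg h0)] at h1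
  have hw : ∀ t : ℝ, 0 < t → μ {x | t ≤ φ x} ≤ ENNReal.ofReal (((p - 1) / p / t) ^ p) := by
    intro t ht
    have := measure_le_of_weakNorm_le hp hweak ht
    simpa only [abs_of_nonneg (h0 _)] using this
  refine ⟨E, (μ E).toReal, rfl, hE, hα0, ?_, hμE, h1, ?_, ?_⟩
  · exact ENNReal.toReal_le_of_le_ofReal zero_le_one (by simpa using prob_le_one)
  · rw [le_div_iff₀ hl, mul_comm]
    refine h1.trans ?_
    rw [← hf]
    exact setIntegral_le_integral hi (Eventually.of_forall h0)
  · rcases hα0.eq_or_lt with h2 | h2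
    · rw [← h2]; positivity
    have h3 := h1.trans (setIntegral_le_of_weak hp hm h0 hi hw hα0 hμE)
    rw [sub_eq_add_neg, Real.rpow_add h2, Real.rpow_one, mul_comm,
      mul_le_mul_iff_right₀ h2, Real.rpow_neg h2.le, ← one_div,
      le_one_div hl (by positivity), one_div, Real.rpow_inv_le_iff_of_pos h2.le (by positivity)
        (by linarith), one_div, Real.inv_rpow hl.le] at h3
    rw [one_div]; exact h3

end DyadicBellman

namespace DyadicBellman

/-! ### Gluing of continuity, and identities between exponents -/

variable {p q f A l α a b : ℝ}

/-- Away from a closed piece, continuity within that piece is vacuous. This serves the piecewise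
definitions of `T` and `offMin`. -/
lemma ContinuousOn.of_isClosed_cover {Y Z : Type*} [TopologicalSpace Y] [TopologicalSpace Z]
    {F : Y → Z} {S U V : Set Y} (hU : IsClosed U) (hV : IsClosed V) (hS : S ⊆ U ∪ V)
    (h1 : ContinuousOn F (S ∩ U)) (h2 : ContinuousOn F (S ∩ V)) : ContinuousOn F S := by
  have key : ∀ W : Set Y, IsClosed W → ContinuousOn F (S ∩ W) → ∀ x,  x ∈ S →
      ContinuousWithinAt F (S ∩ W) x := by
    intro W hW h x hx
    by_cases hxW : x ∈ W
    · exact h x ⟨hx, hxW⟩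
    · refine continuousWithinAt_of_notMem_closure fun hc => hxW ?_
      exact hW.closure_subset (closure_mono inter_subset_right hc)
  intro x hx
  have := (key U hU h1 x hx).union (key V hV h2 x hx)
  rwa [← inter_union_distrib_left, inter_eq_left.2 hS] at this

lemma rpow_one_sub_inv (hu : 0 ≤ α) (hp : 1 < p) : α ^ (1 - 1 / p) = α * α ^ (-1 / p) := by
  rcases hu.eq_or_lt with rfl | hu
  · rw [zero_rpow_one_sub hp, zero_mul]
  · rw [sub_eq_add_neg, Real.rpow_add hu, Real.rpow_one, neg_div]

lemma rpow_one_sub_q_div (hu : 0 ≤ α) (hp : 1 < p) (hqp : q < p) :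
    α ^ (1 - q / p) = α * α ^ (-q / p) := by
  rcases hu.eq_or_lt with rfl | hu
  · rw [Real.zero_rpow (one_sub_div_pos hqp (by linarith)).ne', zero_mul]
  · rw [sub_eq_add_neg, Real.rpow_add hu, Real.rpow_one, neg_div]

lemma mul_prof_eq (hp : 1 < p) (hu : 0 ≤ α) : α * prof p α = (p - 1) / p * α ^ (1 - 1 / p) := by
  rw [rpow_one_sub_inv hu hp, prof]; ring

/-- Passing from the exponent `1 - 1/p` to `1 - q/p`. -/
lemma rpow_conjugate (hp : 1 < p) (hu : 0 ≤ α) :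
    (α ^ (1 - 1 / p)) ^ ((p - q) / (p - 1)) = α ^ (1 - q / p) := by
  have hp1 : p - 1 ≠ 0 := by linarith
  have hp0 : p ≠ 0 := by linarith
  rw [← Real.rpow_mul hu, one_sub_inv hp, one_sub_q_div (by linarith)]
  congr 1; field_simp

lemma le_beta_iff (hp : 1 < p) (hl : 0 < l) (hα : 0 ≤ α) :
    α ≤ ((p - 1) / p / l) ^ p ↔ l * α ≤ (p - 1) / p * α ^ (1 - 1 / p) := by
  have hκ := kappa_pos hp
  rcases hα.eq_or_lt with rfl | hα
  · rw [zero_rpow_one_sub hp]; simp; positivity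
  · rw [← le_prof_iff hp hl hα, ← mul_prof_eq hp hα.le, mul_comm l, mul_le_mul_iff_right₀ hα]

/-! ### The function `T` -/

lemma T_of_le (hp : 1 < p) (hl : 0 < l) (hα : 0 ≤ α)
    (h : l * α ≤ (p - 1) / p * α ^ (1 - 1 / p)) : T p q l α = l ^ q * α := by
  rw [T, if_pos ((le_beta_iff hp hl hα).2 h)]

/-- At the boundary point the truncation height equals `l = prof p α`, so the two formulas agree
there; continuity of `T` rests on this. -/
lemma T_of_ge (hp : 1 < p) (hqp : q < p) (hl : 0 < l) (hα : 0 ≤ α)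
    (h : (p - 1) / p * α ^ (1 - 1 / p) ≤ l * α) : T p q l α = DeltaFun p q (l * α) α := by
  rw [T]
  split_ifs with h1
  · have h2 := le_antisymm h ((le_beta_iff hp hl hα).1 h1)
    have hp0 : p ≠ 0 := by linarith
    have hpq : p - q ≠ 0 := by linarith
    have hκ := kappa_pos hp
    have e : p * (α ^ (1 - 1 / p) - l * α) = α ^ (1 - 1 / p) := by
      rw [← h2]; field_simp; ring
    rw [DeltaFun, e, rpow_conjugate hp hα]
    have e2 : l ^ q * α = ((p - 1) / p) ^ q * α ^ (1 - q / p) := by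
      rcases hα.eq_or_lt with rfl | hα
      · rw [Real.zero_rpow (one_sub_div_pos hqp (by linarith)).ne']; simp
      · have : l = prof p α := by
          rw [← mul_prof_eq hp hα.le, mul_comm l] at h2
          exact (mul_left_cancel₀ hα.ne' h2).symm
        rw [this, prof_rpow hp hα.le, rpow_one_sub_q_div hα.le hp hqp]; ring
    rw [e2]; field_simp
  · rfl

/-- The right side is the `q`-norm on `[0, α]` of the profile truncated at `c` when `0 < c ≤ α`; the
hypothesis says that its integral is `b`, because `c * prof p c = κ c^{1-1/p}`. -/
lemma DeltaFun_eq (hp : 1 < p) (hqp : q < p) {c : ℝ} (hc : 0 ≤ c)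
    (h : c ^ (1 - 1 / p) = p * (α ^ (1 - 1 / p) - b)) :
    DeltaFun p q b α = c * (((p - 1) / p) ^ q * c ^ (-q / p)) +
      Gam p q * (α ^ (1 - q / p) - c ^ (1 - q / p)) := by
  have hpq : p - q ≠ 0 := by linarith
  rw [DeltaFun, ← h, rpow_conjugate hp hc, Gam]
  have : c * (((p - 1) / p) ^ q * c ^ (-q / p)) = ((p - 1) / p) ^ q * c ^ (1 - q / p) := by
    rw [rpow_one_sub_q_div hc hp hqp]; ring
  rw [this]; field_simp; ring

lemma exists_truncation (hp : 1 < p) (h : b ≤ α ^ (1 - 1 / p)) :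
    ∃ c, 0 ≤ c ∧ c ^ (1 - 1 / p) = p * (α ^ (1 - 1 / p) - b) := by
  have h0 : 0 ≤ p * (α ^ (1 - 1 / p) - b) := mul_nonneg (by linarith) (by linarith)
  have hp1 : p - 1 ≠ 0 := by linarith
  refine ⟨(p * (α ^ (1 - 1 / p) - b)) ^ (p / (p - 1)), Real.rpow_nonneg h0 _, ?_⟩
  rw [← Real.rpow_mul h0, one_sub_inv hp]
  have : p / (p - 1) * ((p - 1) / p) = 1 := by field_simp
  rw [this, Real.rpow_one]

/-- `T` at the right end of its domain. -/
lemma T_full (hp : 1 < p) (hqp : q < p) (hl : 0 < l) (hα : 0 ≤ α)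
    (h : l * α = α ^ (1 - 1 / p)) : T p q l α = Gam p q * α ^ (1 - q / p) := by
  have hα' := Real.rpow_nonneg hα (1 - 1 / p)
  rw [T_of_ge hp hqp hl hα, DeltaFun_eq hp hqp le_rfl, zero_mul,
    Real.zero_rpow (one_sub_div_pos hqp (by linarith)).ne']
  · ring
  · rw [zero_rpow_one_sub hp, h]; ring
  · rw [h]; nlinarith [kappa_lt_one hp]

/-- `T` as the `q`-norm of a truncated profile. -/
lemma T_truncation (hq : 1 < q) (hqp : q < p) (hl : 0 < l) (hα : 0 < α)
    (h : l * α < α ^ (1 - 1 / p)) :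
    ∃ a, 0 < a ∧ (∫ u in (0 : ℝ)..α, min a (prof p u) = l * α) ∧
      (∫ u in (0 : ℝ)..α, min a (prof p u) ^ q = T p q l α) ∧
      (l * α ≤ (p - 1) / p * α ^ (1 - 1 / p) ∧ a = l ∨ prof p α ≤ a) := by
  have hp : 1 < p := hq.trans hqp
  have hp0 : 0 < p := by linarith
  -- The cases are whether or not the constant `l` fits below the profile on all of `(0, α]`.
  rcases le_total (l * α) ((p - 1) / p * α ^ (1 - 1 / p)) with h1 | h1
  · have h2 : l ≤ prof p α := by
      rw [← mul_prof_eq hp hα.le, mul_comm l] at h1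
      exact (mul_le_mul_iff_right₀ hα).1 h1
    have e1 := integral_min_prof_of_le hp le_rfl hα.le h2 1
    have e2 := integral_min_prof_of_le hp le_rfl hα.le h2 q
    simp only [Real.rpow_one, sub_zero] at e1
    refine ⟨l, hl, by rw [e1]; ring, ?_, Or.inl ⟨h1, rfl⟩⟩
    rw [e2, T_of_le hp hl hα.le h1]; ring
  · obtain ⟨c, hc, hceq⟩ := exists_truncation hp h.le
    -- Strictness of `h` keeps `c` away from `0`, where the truncation height would be infinite.
    have hc0 : 0 < c := by
      rcases hc.eq_or_lt with rfl | hc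
      · rw [zero_rpow_one_sub hp] at hceq
        have := mul_pos hp0 (sub_pos.2 h)
        linarith
      · exact hc
    have hcα : c ≤ α := by
      rw [← Real.rpow_le_rpow_iff hc hα.le (z := 1 - 1 / p)
        (by rw [one_sub_inv hp]; exact kappa_pos hp), hceq]
      have := mul_le_mul_of_nonneg_left h1 hp0.le
      have e : p * ((p - 1) / p * α ^ (1 - 1 / p)) = (p - 1) * α ^ (1 - 1 / p) := by field_simp
      rw [e] at this; linarith
    refine ⟨prof p c, prof_pos hp hc0, ?_, ?_, Or.inr (prof_anti hp hc0 hcα)⟩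
    · rw [integral_min_prof hp le_rfl hc hc0 hcα, sub_zero, mul_prof_eq hp hc, hceq]
      field_simp; ring
    · rw [integral_min_prof_pow hq hqp le_rfl hc hc0 hcα, T_of_ge hp hqp hl hα.le h1,
        DeltaFun_eq hp hqp hc hceq, prof_rpow hp hc, sub_zero]

lemma exists_T_profile (hq : 1 < q) (hqp : q < p) (hl : 0 < l) (hα : 0 < α)
    (h : l * α ≤ α ^ (1 - 1 / p)) :
    ∃ g : ℝ → ℝ, Measurable g ∧ (∀ u ∈ Ioc 0 α, 0 ≤ g u) ∧ (∀ u ∈ Ioc 0 α, g u ≤ prof p u) ∧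
      (∫ u in (0 : ℝ)..α, g u = l * α) ∧ (∫ u in (0 : ℝ)..α, g u ^ q = T p q l α) := by
  have hp : 1 < p := hq.trans hqp
  rcases h.lt_or_eq with h | h
  · obtain ⟨a, ha, h1, h2, _⟩ := T_truncation hq hqp hl hα h
    exact ⟨_, measurable_min_prof a, fun u hu => min_prof_nonneg hp ha.le hu.1.le,
      fun u _ => min_le_right _ _, h1, h2⟩
  · refine ⟨prof p, measurable_prof, fun u hu => prof_nonneg hp hu.1.le, fun u _ => le_rfl, ?_, ?_⟩
    · rw [integral_prof hp, zero_rpow_one_sub hp, sub_zero, h]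
    · rw [T_full hp hqp hl hα.le h, integral_prof_pow hp hqp le_rfl hα.le,
        Real.zero_rpow (one_sub_div_pos hqp (by linarith)).ne', sub_zero]

lemma continuousOn_T (hq : 1 < q) (hqp : q < p) :
    ContinuousOn (fun z : ℝ × ℝ => T p q z.1 z.2) {z | 0 < z.1 ∧ 0 ≤ z.2} := by
  have hp : 1 < p := hq.trans hqp
  have hp0 : 0 < p := by linarith
  have r1 : 0 < 1 - 1 / p := by rw [one_sub_inv hp]; exact kappa_pos hp
  have r2 := one_sub_div_pos hqp hp0
  have r3 : 0 < (p - q) / (p - 1) := div_pos (by linarith) (by linarith)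
  have c1 : Continuous fun z : ℝ × ℝ => z.2 ^ (1 - 1 / p) :=
    continuous_snd.rpow_const fun _ => Or.inr r1.le
  have c2 : Continuous fun z : ℝ × ℝ => z.1 * z.2 := continuous_fst.mul continuous_snd
  refine ContinuousOn.of_isClosed_cover
    (U := {z | z.1 * z.2 ≤ (p - 1) / p * z.2 ^ (1 - 1 / p)})
    (V := {z | (p - 1) / p * z.2 ^ (1 - 1 / p) ≤ z.1 * z.2})
    (isClosed_le c2 (c1.const_mul _)) (isClosed_le (c1.const_mul _) c2)
    (fun z _ => le_total (z.1 * z.2) ((p - 1) / p * z.2 ^ (1 - 1 / p))) ?_ ?_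
  · have : ContinuousOn (fun z : ℝ × ℝ => z.1 ^ q * z.2)
        ({z | 0 < z.1 ∧ 0 ≤ z.2} ∩ {z | z.1 * z.2 ≤ (p - 1) / p * z.2 ^ (1 - 1 / p)}) :=
      ((continuous_fst.rpow_const fun _ => Or.inr (by linarith)).mul continuous_snd).continuousOn
    exact this.congr fun z hz => T_of_le hp hz.1.1 hz.1.2 hz.2
  · have : Continuous (fun z : ℝ × ℝ => DeltaFun p q (z.1 * z.2) z.2) := by
      unfold DeltaFun
      refine continuous_const.mul (Continuous.sub ?_ ?_)
      · exact (continuous_snd.rpow_const fun _ => Or.inr r2.le).const_mul _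
      · exact (((c1.sub c2).const_mul p).rpow_const fun _ => Or.inr r3.le).const_mul _
    exact this.continuousOn.congr fun z hz => T_of_ge hp hqp hz.1.1 hz.1.2 hz.2

/-! ### The function `F` -/

/-- The least `q`-norm off a set of measure `a`, as a function of the integral `f₂` there. -/
noncomputable def offMin (p q a f₂ : ℝ) : ℝ :=
  if f₂ ≤ (p - 1) / p * (1 - a) then f₂ ^ q / (1 - a) ^ (q - 1) else GamFun p q f₂ a

/-- Both alternatives in the definition of `F` say that the constant `(f - l a) / (1 - a)` is at
most `κ = prof p 1`, that is, fits below the profile on `[a, 1]`. -/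
lemma F_eq_offMin (hfl : f < l) (ha : 0 ≤ a) (ha1 : a ≤ 1) : F p q f l a = offMin p q a (f - l * a) := by
  rw [F, offMin]
  by_cases h1 : f ≤ (p - 1) / p
  · have : f - l * a ≤ (p - 1) / p * (1 - a) := by
      nlinarith [mul_le_mul_of_nonneg_right h1 (sub_nonneg.2 ha1), mul_le_mul_of_nonneg_right hfl.le ha]
    rw [if_pos h1, if_pos this]
  · rw [if_neg h1]
    have hl : 0 < l - (p - 1) / p := by linarith [not_le.1 h1]
    congr 1
    rw [div_le_iff₀ hl]
    exact propext ⟨fun h => by linarith, fun h => by linarith⟩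

/-- The set of admissible pairs for `offMin`. -/
def offDom (p : ℝ) : Set (ℝ × ℝ) :=
  {z | 0 ≤ z.1 ∧ z.1 < 1 ∧ 0 ≤ z.2 ∧ z.2 ≤ 1 - z.1 ^ (1 - 1 / p) ∧ z.2 < 1}

/-- The left side of the equation is `a^{1-1/p}` at `c = a` and `1/p + κ a` at `c = 1`, which
enclose `1 - f₂`. The solution set is compact, so its supremum is a solution; `f₂ < 1` excludes the
root `0`. -/
lemma cRoot_spec (hp : 1 < p) {f₂ : ℝ} (h : (a, f₂) ∈ offDom p)
    (h2 : (p - 1) / p * (1 - a) ≤ f₂) :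
    cRoot p a f₂ ∈ Icc a 1 ∧ 0 < cRoot p a f₂ ∧
    1 / p * cRoot p a f₂ ^ (1 - 1 / p) + (1 - 1 / p) * a * cRoot p a f₂ ^ (-1 / p) = 1 - f₂ := by
  obtain ⟨ha0, ha1, hf0, hf2, hf1⟩ := h
  simp only at ha0 ha1 hf0 hf2 hf1
  have hp0 : 0 < p := by linarith
  have r1 : 0 < 1 - 1 / p := by rw [one_sub_inv hp]; exact kappa_pos hp
  have hcont : ContinuousOn (fun c : ℝ => 1 / p * c ^ (1 - 1 / p) + (1 - 1 / p) * a * c ^ (-1 / p))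
      (Icc a 1) := by
    refine ContinuousOn.add ((continuous_id.rpow_const fun _ => Or.inr r1.le).const_mul
      (1 / p)).continuousOn ?_
    -- For `a = 0` the interval contains `0`, but the factor `a` removes the singular term.
    rcases ha0.eq_or_lt with rfl | ha0
    · simp only [mul_zero, zero_mul]; exact continuousOn_const
    · exact (continuousOn_id.rpow_const fun c hc => Or.inl (ha0.trans_le hc.1).ne').const_mul _
  have hleft : 1 / p * a ^ (1 - 1 / p) + (1 - 1 / p) * a * a ^ (-1 / p) = a ^ (1 - 1 / p) := by
    rw [rpow_one_sub_inv ha0 hp]; ring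
  have hright : 1 / p * (1 : ℝ) ^ (1 - 1 / p) + (1 - 1 / p) * a * 1 ^ (-1 / p)
      = 1 / p + (1 - 1 / p) * a := by
    rw [Real.one_rpow, Real.one_rpow]; ring
  rw [← one_sub_inv hp] at h2
  obtain ⟨c, hc, hceq⟩ := intermediate_value_Icc ha1.le hcont
    (show 1 - f₂ ∈ Icc _ _ from ⟨by simp only [hleft]; linarith, by simp only [hright]; linarith⟩)
  let S : Set ℝ := {c : ℝ | c ∈ Icc a 1 ∧
    1 / p * c ^ (1 - 1 / p) + (1 - 1 / p) * a * c ^ (-1 / p) = 1 - f₂}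
  have hS : IsCompact S :=
    isCompact_Icc.of_isClosed_subset (hcont.preimage_isClosed_of_isClosed isClosed_Icc
      (isClosed_singleton (x := 1 - f₂))) fun c hc => hc.1
  have hmem : cRoot p a f₂ ∈ S := hS.sSup_mem ⟨c, hc, hceq⟩
  refine ⟨hmem.1, ?_, hmem.2⟩
  rcases (ha0.trans hmem.1.1).eq_or_lt with h0 | h0
  · have h3 := hmem.2
    have h4 : a = 0 := le_antisymm (h0 ▸ hmem.1.1) ha0
    rw [← h0, h4, zero_rpow_one_sub hp] at h3
    simp at h3; linarith
  · exact h0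

/-- By `integral_min_prof`, the equation of `cRoot` is the mass constraint for the profile truncated
at `c`. -/
lemma integral_min_prof_root (hp : 1 < p) {c f₂ : ℝ} (ha : 0 ≤ a) (hac : a ≤ c) (hc : 0 < c)
    (hc1 : c ≤ 1) : 1 / p * c ^ (1 - 1 / p) + (1 - 1 / p) * a * c ^ (-1 / p) = 1 - f₂ ↔
    ∫ u in a..1, min (prof p c) (prof p u) = f₂ := by
  rw [integral_min_prof hp ha hac hc hc1, sub_mul c a (prof p c), mul_prof_eq hp hc.le, prof, Real.one_rpow,
    ← one_sub_inv hp]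
  constructor <;> intro h <;> linarith

/-- `offMin` as the `q`-norm of a truncated profile. -/
lemma offMin_truncation (hq : 1 < q) (hqp : q < p) {f₂ : ℝ} (h : (a, f₂) ∈ offDom p) :
    ∃ b, 0 ≤ b ∧ (∫ u in a..1, min b (prof p u) = f₂) ∧
      (∫ u in a..1, min b (prof p u) ^ q = offMin p q a f₂) ∧
      (f₂ ≤ (p - 1) / p * (1 - a) ∧ b = f₂ / (1 - a) ∧ b ≤ (p - 1) / p ∨
        (p - 1) / p * (1 - a) < f₂ ∧ ∃ c, a ≤ c ∧ 0 < c ∧ b = prof p c) := by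
  have hp : 1 < p := hq.trans hqp
  have h' := h
  obtain ⟨ha0, ha1, hf0, hf2, hf1⟩ := h
  simp only at ha0 ha1 hf0 hf2 hf1
  have ha : 0 < 1 - a := by linarith
  rcases le_or_gt f₂ ((p - 1) / p * (1 - a)) with h1 | h1
  · have hb : f₂ / (1 - a) ≤ (p - 1) / p := by rwa [div_le_iff₀ ha]
    have e1 := integral_min_prof_of_le hp ha0 ha1.le (hb.trans_eq prof_one.symm) 1
    have e2 := integral_min_prof_of_le hp ha0 ha1.le (hb.trans_eq prof_one.symm) q
    simp only [Real.rpow_one] at e1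
    refine ⟨f₂ / (1 - a), by positivity, ?_, ?_, Or.inl ⟨h1, rfl, hb⟩⟩
    · rw [e1]; field_simp
    · rw [e2, offMin, if_pos h1, Real.div_rpow hf0 ha.le, Real.rpow_sub_one ha.ne']
      field_simp
  · obtain ⟨hc, hc0, hceq⟩ := cRoot_spec hp h' h1.le
    refine ⟨prof p (cRoot p a f₂), (prof_pos hp hc0).le,
      (integral_min_prof_root hp ha0 hc.1 hc0 hc.2).1 hceq, ?_, Or.inr ⟨h1, _, hc.1, hc0, rfl⟩⟩
    rw [integral_min_prof_pow hq hqp ha0 hc.1 hc0 hc.2, offMin, if_neg (not_le.2 h1), GamFun,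
      prof_rpow hp hc0.le, Real.one_rpow]
    ring

/-- `prof p` is the derivative of the concave function `x^{1-1/p}`. -/
lemma rpow_le_tangent (hp : 1 < p) {x y : ℝ} (hx : 0 ≤ x) (hy : 0 < y) :
    x ^ (1 - 1 / p) ≤ y ^ (1 - 1 / p) + prof p y * (x - y) := by
  have hκ := kappa_pos hp
  have hκ1 := kappa_lt_one hp
  have h := rpow_one_add_le_one_add_mul_self (s := x / y - 1) (p := 1 - 1 / p)
    (by have := div_nonneg hx hy.le; linarith) (by rw [one_sub_inv hp]; exact hκ.le)
    (by rw [one_sub_inv hp]; exact hκ1.le)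
  rw [show 1 + (x / y - 1) = x / y by ring, Real.div_rpow hx hy.le,
    div_le_iff₀ (by positivity)] at h
  refine h.trans_eq ?_
  rw [prof, rpow_one_sub_inv hy.le hp, one_sub_inv hp]
  field_simp

lemma rpow_lt_tangent (hp : 1 < p) {x y : ℝ} (hx : 0 ≤ x) (hy : 0 < y) (hxy : x ≠ y) :
    x ^ (1 - 1 / p) < y ^ (1 - 1 / p) + prof p y * (x - y) := by
  have hκ := kappa_pos hp
  have hκ1 := kappa_lt_one hp
  have h := rpow_one_add_lt_one_add_mul_self (s := x / y - 1) (p := 1 - 1 / p)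
    (by have := div_nonneg hx hy.le; linarith)
    (by rw [Ne, sub_eq_zero, div_eq_one_iff_eq hy.ne']; exact hxy)
    (by rw [one_sub_inv hp]; exact hκ) (by rw [one_sub_inv hp]; exact hκ1)
  rw [show 1 + (x / y - 1) = x / y by ring, Real.div_rpow hx hy.le,
    div_lt_iff₀ (by positivity)] at h
  refine h.trans_eq ?_
  rw [prof, rpow_one_sub_inv hy.le hp, one_sub_inv hp]
  field_simp

/-- The derivative is a positive multiple of `1 - a/c`. The argument uses the tangent line of
`x^{1-1/p}` at `y` and `a ≤ x` instead of differentiating. -/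
lemma root_strictMonoOn (hp : 1 < p) :
    StrictMonoOn (fun c : ℝ => 1 / p * c ^ (1 - 1 / p) + (1 - 1 / p) * a * c ^ (-1 / p))
      (Ici a ∩ Ioi 0) := by
  intro x hx y hy hxy
  have hx0 : 0 < x := hx.2
  have hy0 : 0 < y := hy.2
  have hax : a ≤ x := hx.1
  have h1 := rpow_lt_tangent hp hx0.le hy0 hxy.ne
  have h2 := prof_strictAnti hp hx0 hxy
  have h3 := mul_le_mul_of_nonneg_right hax (sub_pos.2 h2).le
  have ex := mul_prof_eq hp hx0.le
  have ey := mul_prof_eq hp hy0.le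
  simp only []
  have e : ∀ c : ℝ, (1 - 1 / p) * a * c ^ (-1 / p) = a * prof p c := by
    intro c; rw [prof, one_sub_inv hp]; ring
  rw [e, e]
  rw [← one_sub_inv hp] at ex ey
  linarith

/-- The roots stay in `[0, 1]`, so it suffices that every cluster point solves the limiting
equation, whose root is unique. -/
lemma continuousOn_cRoot (hp : 1 < p) :
    ContinuousOn (fun z : ℝ × ℝ => cRoot p z.1 z.2)
      (offDom p ∩ {z | (p - 1) / p * (1 - z.1) ≤ z.2}) := by
  have hp0 : 0 < p := by linarith
  have r1 : 0 < 1 - 1 / p := by rw [one_sub_inv hp]; exact kappa_pos hp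
  rintro ⟨a, f₂⟩ ⟨hz, hz2⟩
  obtain ⟨hc, hc0, hceq⟩ := cRoot_spec hp hz hz2
  have ha0 : 0 ≤ a := hz.1
  have hf1 : f₂ < 1 := hz.2.2.2.2
  refine isCompact_Icc (a := (0 : ℝ)) (b := 1) |>.tendsto_nhds_of_unique_mapClusterPt ?_ ?_
  · filter_upwards [self_mem_nhdsWithin] with z hz
    have := (cRoot_spec hp hz.1 hz.2).1
    exact ⟨hz.1.1.trans this.1, this.2⟩
  · intro c' hc' hclust
    obtain ⟨U, hU, hUc⟩ := mapClusterPt_iff_ultrafilter.1 hclust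
    have hmem : ∀ᶠ z in (U : Filter (ℝ × ℝ)),
        z ∈ offDom p ∩ {z | (p - 1) / p * (1 - z.1) ≤ z.2} := hU self_mem_nhdsWithin
    have hid : Tendsto id (U : Filter (ℝ × ℝ)) (𝓝 (a, f₂)) := hU.trans nhdsWithin_le_nhds
    have t1 : Tendsto Prod.fst (U : Filter (ℝ × ℝ)) (𝓝 a) :=
      (continuous_fst.tendsto (a, f₂)).comp hid
    have t2 : Tendsto Prod.snd (U : Filter (ℝ × ℝ)) (𝓝 f₂) :=
      (continuous_snd.tendsto (a, f₂)).comp hid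
    have t3 : Tendsto (fun z : ℝ × ℝ => cRoot p z.1 z.2 ^ (1 - 1 / p)) U (𝓝 (c' ^ (1 - 1 / p))) :=
      hUc.rpow_const (Or.inr r1.le)
    have hac : a ≤ c' := le_of_tendsto_of_tendsto t1 hUc
      (hmem.mono fun z hz => (cRoot_spec hp hz.1 hz.2).1.1)
    -- This keeps cluster points away from `0`, where `c^{-1/p}` is discontinuous.
    have hlow : 1 - f₂ ≤ c' ^ (1 - 1 / p) := by
      refine le_of_tendsto_of_tendsto (t2.const_sub 1) t3 (hmem.mono fun z hz => ?_)
      obtain ⟨h1, h2, h3⟩ := cRoot_spec hp hz.1 hz.2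
      have e := rpow_one_sub_inv h2.le hp
      have hr : 0 ≤ (1 - 1 / p) * cRoot p z.1 z.2 ^ (-1 / p) :=
        mul_nonneg r1.le (Real.rpow_nonneg h2.le _)
      have := mul_le_mul_of_nonneg_left h1.1 hr
      simp only []
      rw [← h3]
      calc _ = 1 / p * cRoot p z.1 z.2 ^ (1 - 1 / p) +
              (1 - 1 / p) * cRoot p z.1 z.2 ^ (-1 / p) * z.1 := by ring
        _ ≤ 1 / p * cRoot p z.1 z.2 ^ (1 - 1 / p) +
              (1 - 1 / p) * cRoot p z.1 z.2 ^ (-1 / p) * cRoot p z.1 z.2 := by linarith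
        _ = cRoot p z.1 z.2 ^ (1 - 1 / p) := by rw [e]; ring
    have hc'0 : 0 < c' := by
      rcases hc'.1.eq_or_lt with h0 | h0
      · rw [← h0, zero_rpow_one_sub hp] at hlow; linarith
      · exact h0
    have t4 : Tendsto (fun z : ℝ × ℝ => 1 / p * cRoot p z.1 z.2 ^ (1 - 1 / p) +
        (1 - 1 / p) * z.1 * cRoot p z.1 z.2 ^ (-1 / p)) U
        (𝓝 (1 / p * c' ^ (1 - 1 / p) + (1 - 1 / p) * a * c' ^ (-1 / p))) :=
      (t3.const_mul _).add ((t1.const_mul _).mul (hUc.rpow_const (Or.inl hc'0.ne')))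
    have heq := tendsto_nhds_unique (t4.congr' (hmem.mono fun z hz =>
      (cRoot_spec hp hz.1 hz.2).2.2)) (t2.const_sub 1)
    exact (root_strictMonoOn hp).injOn ⟨hac, hc'0⟩ ⟨hc.1, hc0⟩ (heq.trans hceq.symm)

lemma continuousOn_offMin (hq : 1 < q) (hqp : q < p) :
    ContinuousOn (fun z : ℝ × ℝ => offMin p q z.1 z.2) (offDom p) := by
  have hp : 1 < p := hq.trans hqp
  have hp0 : 0 < p := by linarith
  have c1 : Continuous fun z : ℝ × ℝ => (p - 1) / p * (1 - z.1) := by fun_prop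
  refine ContinuousOn.of_isClosed_cover
    (U := {z | z.2 ≤ (p - 1) / p * (1 - z.1)}) (V := {z | (p - 1) / p * (1 - z.1) ≤ z.2})
    (isClosed_le continuous_snd c1) (isClosed_le c1 continuous_snd)
    (fun z _ => le_total z.2 ((p - 1) / p * (1 - z.1))) ?_ ?_
  · have : ContinuousOn (fun z : ℝ × ℝ => z.2 ^ q / (1 - z.1) ^ (q - 1))
        (offDom p ∩ {z | z.2 ≤ (p - 1) / p * (1 - z.1)}) := by
      refine (continuous_snd.rpow_const fun _ => Or.inr (by linarith)).continuousOn.div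
        (((continuous_const.sub continuous_fst).rpow_const fun _ =>
          Or.inr (by linarith)).continuousOn) fun z hz => ?_
      have : z.1 < 1 := hz.1.2.1
      exact (Real.rpow_pos_of_pos (by linarith) _).ne'
    exact this.congr fun z hz => if_pos hz.2
  · have hc := continuousOn_cRoot hp
    have hne : ∀ z ∈ offDom p ∩ {z | (p - 1) / p * (1 - z.1) ≤ z.2}, cRoot p z.1 z.2 ≠ 0 :=
      fun z hz => (cRoot_spec hp hz.1 hz.2).2.1.ne'
    have : ContinuousOn (fun z : ℝ × ℝ => GamFun p q z.2 z.1)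
        (offDom p ∩ {z | (p - 1) / p * (1 - z.1) ≤ z.2}) := by
      unfold GamFun
      refine ContinuousOn.add (ContinuousOn.mul (ContinuousOn.mul continuousOn_const ?_) ?_)
        (ContinuousOn.mul continuousOn_const (continuousOn_const.sub ?_))
      · exact hc.rpow_const fun z hz => Or.inl (hne z hz)
      · exact hc.sub continuous_fst.continuousOn
      · exact hc.rpow_const fun z hz => Or.inl (hne z hz)
    refine this.congr fun z hz => ?_
    simp only [offMin]
    split_ifs with h
    · have h' : z.2 = (p - 1) / p * (1 - z.1) := le_antisymm h hz.2
      obtain ⟨h1, h2, h3⟩ := cRoot_spec hp hz.1 hz.2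
      have hz1 : 0 < 1 - z.1 := by have : z.1 < 1 := hz.1.2.1; linarith
      -- On the common boundary the truncation is constant up to the point `1`, and the two formulas
      -- agree.
      have hone : cRoot p z.1 z.2 = 1 := by
        refine (root_strictMonoOn hp (a := z.1)).injOn ⟨h1.1, h2⟩ ⟨hz.1.2.1.le, mem_Ioi.2 one_pos⟩ ?_
        rw [h3, Real.one_rpow, Real.one_rpow, h', ← one_sub_inv hp]; ring
      rw [GamFun, hone, Real.one_rpow, Real.one_rpow, h',
        Real.mul_rpow (kappa_pos hp).le hz1.le, Real.rpow_sub_one hz1.ne']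
      field_simp; ring
    · rfl

end DyadicBellman

namespace DyadicBellman

variable {p q f A l α a b : ℝ}

/-! ### The equations for `λ₁` and `λ₃` -/

lemma one_sub_inv_pos (hp : 1 < p) : 0 < 1 - 1 / p := by
  rw [one_sub_inv hp]; exact kappa_pos hp

lemma inv_pow_rpow (hp : 1 < p) (hl : 0 < l) : (1 / l ^ p) ^ (1 - 1 / p) = l * (1 / l ^ p) := by
  have hp0 : p ≠ 0 := by linarith
  have h : 1 / l ^ p = l ^ (-p) := by rw [Real.rpow_neg hl.le, one_div]
  rw [h, ← Real.rpow_mul hl.le]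
  have : -p * (1 - 1 / p) = 1 + -p := by field_simp; ring
  rw [this, Real.rpow_add hl, Real.rpow_one]

lemma inv_pow_rpow_q (hp : 1 < p) (hl : 0 < l) :
    (1 / l ^ p) ^ (1 - q / p) = 1 / l ^ (p - q) := by
  have hp0 : p ≠ 0 := by linarith
  rw [one_div, one_div, ← Real.rpow_neg hl.le, ← Real.rpow_neg hl.le, ← Real.rpow_mul hl.le]
  congr 1; field_simp

lemma mul_le_rpow_iff (hp : 1 < p) (hl : 0 < l) (hα : 0 < α) :
    l * α ≤ α ^ (1 - 1 / p) ↔ α ≤ 1 / l ^ p := by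
  rw [sub_eq_add_neg, Real.rpow_add hα, Real.rpow_one, mul_comm l,
    mul_le_mul_iff_right₀ hα, Real.rpow_neg hα.le, ← one_div (α ^ (1 / p)),
    le_one_div hl (by positivity), one_div p, Real.rpow_inv_le_iff_of_pos hα.le (by positivity)
      (by linarith), one_div l, Real.inv_rpow hl.le, one_div]

lemma mul_lt_rpow_iff (hp : 1 < p) (hl : 0 < l) (hα : 0 < α) :
    l * α < α ^ (1 - 1 / p) ↔ α < 1 / l ^ p := by
  rw [sub_eq_add_neg, Real.rpow_add hα, Real.rpow_one, mul_comm l,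
    mul_lt_mul_iff_right₀ hα, Real.rpow_neg hα.le, ← one_div (α ^ (1 / p)),
    lt_one_div hl (by positivity), one_div p, Real.rpow_inv_lt_iff_of_pos hα.le (by positivity)
      (by linarith), one_div l, Real.inv_rpow hl.le, one_div]

/-- The two a priori bounds `f/l` and `l^{-p}` cross at `l = (1/f)^{1/(p-1)}`. -/
lemma div_le_inv_pow_iff (hp : 1 < p) (hf0 : 0 < f) (hl : 0 < l) :
    f / l ≤ 1 / l ^ p ↔ l ≤ (1 / f) ^ (1 / (p - 1)) := by
  rw [one_div (p - 1), Real.le_rpow_inv_iff_of_pos hl.le (by positivity) (by linarith),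
    div_le_div_iff₀ hl (by positivity), le_div_iff₀ hf0]
  have : l ^ p = l ^ (p - 1) * l := by
    rw [Real.rpow_sub_one hl.ne']; field_simp
  rw [this, ← mul_assoc, mul_le_mul_iff_left₀ hl, mul_comm]

lemma div_lt_inv_pow_iff (hp : 1 < p) (hf0 : 0 < f) (hl : 0 < l) :
    f / l < 1 / l ^ p ↔ l < (1 / f) ^ (1 / (p - 1)) := by
  rw [one_div (p - 1), Real.lt_rpow_inv_iff_of_pos hl.le (by positivity) (by linarith),
    div_lt_div_iff₀ hl (by positivity), lt_div_iff₀ hf0]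
  have : l ^ p = l ^ (p - 1) * l := by
    rw [Real.rpow_sub_one hl.ne']; field_simp
  rw [this, ← mul_assoc, mul_lt_mul_iff_left₀ hl, mul_comm]

lemma one_le_threshold (hp : 1 < p) (hf0 : 0 < f) (hf1 : f ≤ 1) :
    1 ≤ (1 / f) ^ (1 / (p - 1)) :=
  Real.one_le_rpow (by rw [le_div_iff₀ hf0]; linarith) (by have : 0 < p - 1 := by linarith
                                                           positivity)

/-- `T_l(f/l)` is the least `q`-norm of a profile with integral `f` on `[0, f/l]`. A profile
realizing it for `l'`, extended by zero, competes on the longer interval of `l` and vanishes on part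
of it, where the minimizer is positive. -/
lemma T_div_lt (hq : 1 < q) (hqp : q < p) (hf0 : 0 < f) {l l' : ℝ} (hl : 0 < l) (hll : l < l')
    (hl' : l' ≤ (1 / f) ^ (1 / (p - 1))) : T p q l (f / l) < T p q l' (f / l') := by
  have hp : 1 < p := hq.trans hqp
  have hl0 : 0 < l' := hl.trans hll
  have hα : 0 < f / l := by positivity
  have hα' : 0 < f / l' := by positivity
  have hlt : f / l' < f / l := div_lt_div_of_pos_left hf0 hl hll
  have h1 := (mul_lt_rpow_iff hp hl hα).2 ((div_lt_inv_pow_iff hp hf0 hl).2 (hll.trans_le hl'))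
  have h2 := (mul_le_rpow_iff hp hl0 hα').2 ((div_le_inv_pow_iff hp hf0 hl0).2 hl')
  obtain ⟨a, ha, e1, e2, -⟩ := T_truncation hq hqp hl hα h1
  obtain ⟨g, hg, hg0, hgw, e3, e4⟩ := exists_T_profile hq hqp hl0 hα' h2
  rw [mul_div_cancel₀ _ hl.ne'] at e1
  rw [mul_div_cancel₀ _ hl0.ne'] at e3
  have hind : ∀ u, (Ioc 0 (f / l')).indicator g u ^ q =
      (Ioc 0 (f / l')).indicator (fun u => g u ^ q) u := by
    intro u; simp only [indicator]; split_ifs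
    · rfl
    · exact Real.zero_rpow (by linarith)
  have := integral_min_prof_pow_lt hq hqp (g := (Ioc 0 (f / l')).indicator g)
    (hg.indicator measurableSet_Ioc) le_rfl hα.le
    (fun u _ => indicator_nonneg hg0 u)
    (fun u hu => by
      simp only [indicator]; split_ifs with h
      exacts [hgw u h, prof_nonneg hp hu.1.le]) ha.le
    (by rw [intervalIntegral_indicator_Ioc hα'.le hlt.le, e1, e3]) hlt
    (Ioc_subset_Ioc_left hα'.le) (fun u hu => by
      rw [indicator_of_notMem (fun h => not_lt.2 h.2 hu.1)]
      exact (lt_min ha (prof_pos hp (hα'.trans hu.1))).ne)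
  simp_rw [hind] at this
  rw [intervalIntegral_indicator_Ioc hα'.le hlt.le, e2, e4] at this
  exact this

lemma T_self (hp : 1 < p) (hf0 : 0 < f) : T p q f (f / f) = Amin p q f := by
  have hp0 : 0 < p := by linarith
  have hκ := kappa_pos hp
  rw [div_self hf0.ne', T, Amin]
  simp only [← le_prof_iff hp hf0 one_pos, prof_one]
  split_ifs
  · rw [mul_one]
  · rw [DeltaFun, mul_one, Real.one_rpow, Real.one_rpow, mul_one]

lemma T_threshold (hq : 1 < q) (hqp : q < p) (hf0 : 0 < f) :
    T p q ((1 / f) ^ (1 / (p - 1))) (f / (1 / f) ^ (1 / (p - 1))) =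
      Gam p q * f ^ ((p - q) / (p - 1)) := by
  have hp : 1 < p := hq.trans hqp
  have hl : 0 < (1 / f) ^ (1 / (p - 1)) := by positivity
  set l := (1 / f) ^ (1 / (p - 1)) with hl_def
  have hα : 0 < f / l := by positivity
  have e : l * (f / l) = (f / l) ^ (1 - 1 / p) := by
    refine le_antisymm ((mul_le_rpow_iff hp hl hα).2 ((div_le_inv_pow_iff hp hf0 hl).2 le_rfl)) ?_
    refine not_lt.1 fun h => ?_
    exact lt_irrefl _ ((div_lt_inv_pow_iff hp hf0 hl).1 ((mul_lt_rpow_iff hp hl hα).1 h))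
  rw [T_full hp hqp hl hα.le e, ← rpow_conjugate hp hα.le, ← e, mul_div_cancel₀ _ hl.ne']

lemma existsUnique_lam₃ (hq : 1 < q) (hqp : q < p) (hf0 : 0 < f) (hf1 : f < 1)
    (hA : Amin p q f < A) (hA' : A ≤ Gam p q * f ^ ((p - q) / (p - 1))) :
    ∃! l, IsLam₃ p q f A l := by
  have hp : 1 < p := hq.trans hqp
  have hfl : f ≤ (1 / f) ^ (1 / (p - 1)) := hf1.le.trans (one_le_threshold hp hf0 hf1.le)
  have hcont : ContinuousOn (fun l => T p q l (f / l)) (Icc f ((1 / f) ^ (1 / (p - 1)))) := by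
    refine (continuousOn_T hq hqp).comp (f := fun l => (l, f / l)) ?_ ?_
    · exact continuousOn_id.prodMk (continuousOn_const.div continuousOn_id
        fun l hl => (hf0.trans_le hl.1).ne')
    · intro l hl
      have : 0 < l := hf0.trans_le hl.1
      exact ⟨this, by positivity⟩
  obtain ⟨l, hl, hlA⟩ := intermediate_value_Icc hfl hcont
    (show A ∈ Icc _ _ from ⟨by simp only [T_self hp hf0]; exact hA.le,
      by simp only [T_threshold hq hqp hf0]; exact hA'⟩)
  refine ⟨l, ⟨hl, hlA⟩, fun l' ⟨hl', hlA'⟩ => ?_⟩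
  rcases lt_trichotomy l' l with h | h | h
  · exact absurd (hlA'.trans hlA.symm) (T_div_lt hq hqp hf0 (hf0.trans_le hl'.1) h hl.2).ne
  · exact h
  · exact absurd (hlA.trans hlA'.symm) (T_div_lt hq hqp hf0 (hf0.trans_le hl.1) h hl'.2).ne

/-- The least `q`-norm of a profile that coincides with the extremal one on `[0, s]`. -/
noncomputable def saturatedMin (p q f s : ℝ) : ℝ :=
  offMin p q s (f - s ^ (1 - 1 / p)) + Gam p q * s ^ (1 - q / p)

lemma saturated_mem_offDom (hp : 1 < p) (hf1 : f < 1) {s : ℝ} (hs : 0 ≤ s)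
    (hsf : s ^ (1 - 1 / p) ≤ f) : (s, f - s ^ (1 - 1 / p)) ∈ offDom p := by
  have h0 := Real.rpow_nonneg hs (1 - 1 / p)
  refine ⟨hs, ?_, ?_, ?_, ?_⟩ <;> simp only
  · by_contra h
    have := Real.one_le_rpow (not_lt.1 h) (one_sub_inv_pos hp).le
    linarith
  all_goals linarith

/-- A minimizer that is forced to equal `prof p` up to `s'` also competes for `s`, but just to the
right of `s` it lies strictly above the truncation. -/
lemma saturatedMin_lt (hq : 1 < q) (hqp : q < p) (hf1 : f < 1) {s s' : ℝ} (hs : 0 ≤ s)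
    (hss : s < s') (hsf : s' ^ (1 - 1 / p) ≤ f) :
    saturatedMin p q f s < saturatedMin p q f s' := by
  classical
  have hp : 1 < p := hq.trans hqp
  have hs0 : 0 < s' := hs.trans_lt hss
  have hsf' : s ^ (1 - 1 / p) ≤ f :=
    (Real.rpow_le_rpow hs hss.le (one_sub_inv_pos hp).le).trans hsf
  have hd := saturated_mem_offDom hp hf1 hs hsf'
  have hd' := saturated_mem_offDom hp hf1 hs0.le hsf
  have hs1 : s < 1 := hd.2.1
  have hs1' : s' < 1 := hd'.2.1
  obtain ⟨b, hb, e1, e2, -⟩ := offMin_truncation hq hqp hd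
  obtain ⟨b', hb', e3, e4, -⟩ := offMin_truncation hq hqp hd'
  -- The truncation is active somewhere: otherwise its integral would be `1 - s^{1-1/p}`, that is,
  -- `f = 1`.
  obtain ⟨v, hv, hbv⟩ : ∃ v ∈ Ioc s 1, b < prof p v := by
    by_contra! hcon
    have : ∫ u in s..1, min b (prof p u) = ∫ u in s..1, prof p u := by
      rw [intervalIntegral.integral_of_le hs1.le, intervalIntegral.integral_of_le hs1.le]
      exact setIntegral_congr_fun measurableSet_Ioc fun u hu => min_eq_right (hcon u hu)
    rw [e1, integral_prof hp, Real.one_rpow] at this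
    linarith
  let g : ℝ → ℝ := fun u => if u ∈ Ioc s s' then prof p u else min b' (prof p u)
  have hg : Measurable g := Measurable.ite measurableSet_Ioc measurable_prof (measurable_min_prof b')
  have hg1 : ∀ u ∈ Ioc s s', g u = prof p u := fun u hu => if_pos hu
  have hg2 : ∀ u ∈ Ioc s' 1, g u = min b' (prof p u) := fun u hu =>
    if_neg fun h => not_lt.2 h.2 hu.1
  have hg0 : ∀ u ∈ Ioc s 1, 0 ≤ g u := fun u hu => by
    have := prof_nonneg hp (hs.trans hu.1.le)
    simp only [g]; split_ifs
    exacts [this, le_min hb' this]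
  have hgw : ∀ u ∈ Ioc s 1, g u ≤ prof p u := fun u hu => by
    simp only [g]; split_ifs
    exacts [le_rfl, min_le_right _ _]
  have c1 : ∀ r : ℝ, ∫ u in s..s', g u ^ r = ∫ u in s..s', prof p u ^ r := fun r => by
    rw [intervalIntegral.integral_of_le hss.le, intervalIntegral.integral_of_le hss.le]
    exact setIntegral_congr_fun measurableSet_Ioc fun u hu => by simp only [hg1 u hu]
  have c2 : ∀ r : ℝ, ∫ u in s'..1, g u ^ r = ∫ u in s'..1, min b' (prof p u) ^ r := fun r => by
    rw [intervalIntegral.integral_of_le hs1'.le, intervalIntegral.integral_of_le hs1'.le]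
    exact setIntegral_congr_fun measurableSet_Ioc fun u hu => by simp only [hg2 u hu]
  have sub1 : Ioc s s' ⊆ Ioc s 1 := Ioc_subset_Ioc_right hs1'.le
  have sub2 : Ioc s' 1 ⊆ Ioc s 1 := Ioc_subset_Ioc_left hss.le
  have a1 := intervalIntegral.integral_add_adjacent_intervals
    (intervalIntegrable_of_le_prof hp hg hss.le (fun u hu => hg0 u (sub1 hu))
      fun u hu => hgw u (sub1 hu))
    (intervalIntegrable_of_le_prof hp hg hs1'.le (fun u hu => hg0 u (sub2 hu))
      fun u hu => hgw u (sub2 hu))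
  have a2 := intervalIntegral.integral_add_adjacent_intervals
    (intervalIntegrable_pow_of_le_prof hq hqp hg hs hss.le (fun u hu => hg0 u (sub1 hu))
      fun u hu => hgw u (sub1 hu))
    (intervalIntegrable_pow_of_le_prof hq hqp hg hs0.le hs1'.le (fun u hu => hg0 u (sub2 hu))
      fun u hu => hgw u (sub2 hu))
  have d1 := c1 1
  have d2 := c2 1
  simp only [Real.rpow_one] at d1 d2
  rw [d1, d2, integral_prof hp, e3] at a1
  rw [c1 q, c2 q, integral_prof_pow hp hqp hs hs0.le, e4] at a2
  have key := integral_min_prof_pow_lt hq hqp hg hs hs1.le hg0 hgw hb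
    (by rw [← a1, e1]; ring) (s := s) (t := min v s') (lt_min hv.1 hss)
    (Ioc_subset_Ioc_right ((min_le_right _ _).trans hs1'.le)) (fun u hu => by
      have hu0 : 0 < u := hs.trans_lt hu.1
      rw [hg1 u ⟨hu.1, hu.2.trans (min_le_right _ _)⟩]
      have := hbv.trans_le (prof_anti hp hu0 (hu.2.trans (min_le_left _ _)))
      rw [min_eq_left this.le]; exact this.ne')
  rw [e2, ← a2] at key
  rw [saturatedMin, saturatedMin]; linarith

lemma offMin_zero (hq : 1 < q) (hqp : q < p) (hf0 : 0 < f) (hf1 : f < 1) :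
    offMin p q 0 f = Amin p q f := by
  have hp : 1 < p := hq.trans hqp
  have hp0 : p ≠ 0 := by linarith
  have hpq : p - q ≠ 0 := by linarith
  rw [offMin, Amin, sub_zero, mul_one, Real.one_rpow, div_one]
  split_ifs with h
  · rfl
  · have hd : (0, f) ∈ offDom p := by
      refine ⟨le_rfl, zero_lt_one, hf0.le, ?_, hf1⟩
      simp only; rw [zero_rpow_one_sub hp]; linarith
    obtain ⟨h1, h2, h3⟩ := cRoot_spec hp hd (by linarith)
    have h4 : p * (1 - f) = cRoot p 0 f ^ (1 - 1 / p) := by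
      rw [← h3]; field_simp; ring
    rw [h4, rpow_conjugate hp h2.le, GamFun, sub_zero, Gam, rpow_one_sub_q_div h2.le hp hqp]
    field_simp; ring

lemma saturatedMin_zero (hq : 1 < q) (hqp : q < p) (hf0 : 0 < f) (hf1 : f < 1) :
    saturatedMin p q f 0 = Amin p q f := by
  have hp : 1 < p := hq.trans hqp
  rw [saturatedMin, zero_rpow_one_sub hp, sub_zero, offMin_zero hq hqp hf0 hf1,
    Real.zero_rpow (one_sub_div_pos hqp (by linarith)).ne']
  ring

lemma offMin_right_zero (hq : 1 < q) (hp : 1 < p) (ha : a ≤ 1) : offMin p q a 0 = 0 := by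
  rw [offMin, if_pos (mul_nonneg (kappa_pos hp).le (by linarith)), Real.zero_rpow (by linarith),
    zero_div]

lemma continuousOn_saturatedMin (hq : 1 < q) (hqp : q < p) (hf1 : f < 1) {S : ℝ}
    (hS : S ^ (1 - 1 / p) ≤ f) : ContinuousOn (saturatedMin p q f) (Icc 0 S) := by
  have hp : 1 < p := hq.trans hqp
  have r1 := one_sub_inv_pos hp
  have r2 := one_sub_div_pos hqp (by linarith : 0 < p)
  refine ContinuousOn.add ?_ (continuousOn_const.mul
    (continuous_id.rpow_const fun _ => Or.inr r2.le).continuousOn)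
  refine (continuousOn_offMin hq hqp).comp (f := fun s => (s, f - s ^ (1 - 1 / p))) ?_ ?_
  · exact (continuous_id.prodMk (continuous_const.sub
      (continuous_id.rpow_const fun _ => Or.inr r1.le))).continuousOn
  · intro s hs
    exact saturated_mem_offDom hp hf1 hs.1 ((Real.rpow_le_rpow hs.1 hs.2 r1.le).trans hS)

lemma inv_pow_rpow_le (hp : 1 < p) (hf0 : 0 < f) (hl : (1 / f) ^ (1 / (p - 1)) ≤ l) (hl0 : 0 < l) :
    (1 / l ^ p) ^ (1 - 1 / p) ≤ f := by
  rw [inv_pow_rpow hp hl0]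
  have := not_lt.1 fun h => not_le.2 ((div_lt_inv_pow_iff hp hf0 hl0).1 h) hl
  have := mul_le_mul_of_nonneg_left this hl0.le
  rwa [mul_div_cancel₀ _ hl0.ne'] at this

/-- At `α = l^{-p}` one has `l * α = α^{1-1/p}`, so the profile on `[0, α]` is saturated. -/
lemma F_add_eq_saturatedMin (hp : 1 < p) (hf0 : 0 < f) (hf1 : f < 1)
    (hl : (1 / f) ^ (1 / (p - 1)) ≤ l) :
    F p q f l (1 / l ^ p) + Gam p q / l ^ (p - q) = saturatedMin p q f (1 / l ^ p) := by
  have hl1 : 1 ≤ l := (one_le_threshold hp hf0 hf1.le).trans hl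
  have hl0 : 0 < l := by linarith
  have h1 : 1 / l ^ p ≤ 1 := by
    rw [div_le_one (by positivity)]; exact Real.one_le_rpow hl1 (by linarith)
  rw [saturatedMin, F_eq_offMin (hf1.trans_le hl1) (by positivity) h1, inv_pow_rpow hp hl0,
    inv_pow_rpow_q hp hl0]
  ring

lemma saturatedMin_inv_pow_lt (hq : 1 < q) (hqp : q < p) (hf0 : 0 < f) (hf1 : f < 1) {l l' : ℝ}
    (hl : (1 / f) ^ (1 / (p - 1)) ≤ l) (hll : l < l') :
    saturatedMin p q f (1 / l' ^ p) < saturatedMin p q f (1 / l ^ p) := by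
  have hp : 1 < p := hq.trans hqp
  have hl0 : 0 < l := by linarith [one_le_threshold hp hf0 hf1.le]
  have hl0' := hl0.trans hll
  refine saturatedMin_lt hq hqp hf1 (by positivity) ?_ (inv_pow_rpow_le hp hf0 hl hl0)
  exact one_div_lt_one_div_of_lt (by positivity) (Real.rpow_lt_rpow hl0.le hll (by linarith))

lemma existsUnique_lam₁ (hq : 1 < q) (hqp : q < p) (hf0 : 0 < f) (hf1 : f < 1)
    (hA : Amin p q f < A) (hA' : A ≤ Gam p q * f ^ ((p - q) / (p - 1))) :
    ∃! l, IsLam₁ p q f A l := by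
  have hp : 1 < p := hq.trans hqp
  have hp0 : 0 < p := by linarith
  have hp1 : 0 < p - 1 := by linarith
  -- `S` is the longest stretch that can be saturated with mass `f`; there `saturatedMin` is the
  -- upper limit for `A`.
  obtain ⟨S, hS0, hSf⟩ : ∃ S : ℝ, 0 < S ∧ S ^ (1 - 1 / p) = f := by
    refine ⟨f ^ (p / (p - 1)), by positivity, ?_⟩
    rw [← Real.rpow_mul hf0.le, one_sub_inv hp]
    have : p / (p - 1) * ((p - 1) / p) = 1 := by field_simp
    rw [this, Real.rpow_one]
  have hSval : saturatedMin p q f S = Gam p q * f ^ ((p - q) / (p - 1)) := by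
    have hS1 : S < 1 := (saturated_mem_offDom hp hf1 hS0.le hSf.le).2.1
    rw [saturatedMin, hSf, sub_self, offMin_right_zero hq hp hS1.le, ← rpow_conjugate hp hS0.le,
      hSf, zero_add]
  obtain ⟨s, hs, hsA⟩ := intermediate_value_Icc hS0.le
    (continuousOn_saturatedMin hq hqp hf1 hSf.le)
    (show A ∈ Icc _ _ from ⟨by rw [saturatedMin_zero hq hqp hf0 hf1]; exact hA.le,
      by rw [hSval]; exact hA'⟩)
  have hs0 : 0 < s := by
    rcases hs.1.eq_or_lt with h | h
    · rw [← h, saturatedMin_zero hq hqp hf0 hf1] at hsA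
      exact absurd hsA hA.ne
    · exact h
  have hl0 : 0 < s ^ (-1 / p) := by positivity
  have hls : 1 / (s ^ (-1 / p)) ^ p = s := by
    rw [← Real.rpow_mul hs0.le, div_mul_cancel₀ _ hp0.ne', Real.rpow_neg_one, one_div, inv_inv]
  have hL : (1 / f) ^ (1 / (p - 1)) ≤ s ^ (-1 / p) := by
    refine not_lt.1 fun h => ?_
    have h1 := (div_lt_inv_pow_iff hp hf0 hl0).2 h
    rw [hls, div_lt_iff₀ hl0, ← rpow_one_sub_inv hs0.le hp] at h1
    have := Real.rpow_le_rpow hs.1 hs.2 (one_sub_inv_pos hp).le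
    linarith
  refine ⟨s ^ (-1 / p), ⟨hL, ?_⟩, fun l' ⟨hl', hlA'⟩ => ?_⟩
  · rw [F_add_eq_saturatedMin hp hf0 hf1 hL, hls, hsA]
  · rw [F_add_eq_saturatedMin hp hf0 hf1 hl'] at hlA'
    rcases lt_trichotomy l' (s ^ (-1 / p)) with h | h | h
    · have := saturatedMin_inv_pow_lt hq hqp hf0 hf1 hl' h
      rw [hls, hsA, hlA'] at this
      exact absurd this (lt_irrefl _)
    · exact h
    · have := saturatedMin_inv_pow_lt hq hqp hf0 hf1 hL h
      rw [hls, hsA, hlA'] at this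
      exact absurd this (lt_irrefl _)

end DyadicBellman

namespace DyadicBellman

variable {p q f A l α a b : ℝ}

/-! ### The interval `Δ` -/

lemma beta_le_iff (hp : 1 < p) (hl : 0 < l) (hα : 0 < α) :
    ((p - 1) / p / l) ^ p ≤ α ↔ prof p α ≤ l := by
  constructor
  · intro h
    have hβ : 0 < ((p - 1) / p / l) ^ p := by have := kappa_pos hp; positivity
    exact (prof_anti hp hβ h).trans_eq (prof_beta hp hl)
  · intro h
    by_contra hlt
    have := prof_strictAnti hp hα (not_le.1 hlt)
    rw [prof_beta hp hl] at this
    linarith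

lemma continuous_K (hp : 1 < p) : Continuous (K p f l) := by
  unfold K
  exact (continuous_const.add (continuous_id.rpow_const fun _ =>
    Or.inr (one_sub_inv_pos hp).le)).sub (continuous_const.mul continuous_id)

lemma K_inv_pow (hp : 1 < p) (hl : 0 < l) : K p f l (1 / l ^ p) = f - 1 := by
  rw [K, inv_pow_rpow hp hl]; ring

/-- `K ≤ 0` says that the mass `f - l α` fits below the profile on `[α, 1]`. -/
lemma mem_offDom_of_K (hl : 0 < l) (hfl : f < l) (hf1 : f < 1) (h0 : 0 ≤ α)
    (h1 : α ≤ f / l) (hK : K p f l α ≤ 0) : (α, f - l * α) ∈ offDom p := by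
  rw [le_div_iff₀ hl] at h1
  refine ⟨h0, ?_, ?_, ?_, ?_⟩ <;> simp only
  · nlinarith
  · linarith
  · rw [K] at hK; linarith
  · nlinarith

/-- The interval `Δ`, the value at its left end, and its admissibility. -/
lemma deltaSet_spec (hq : 1 < q) (hqp : q < p) (hf0 : 0 < f) (hf1 : f < 1) (hfl : f < l) :
    ∃ β, 0 ≤ β ∧ β ≤ min (f / l) (1 / l ^ p) ∧
      DeltaSet p f l = Icc β (min (f / l) (1 / l ^ p)) ∧
      F p q f l β + T p q l β ≤ Amin p q f ∧
      ∀ α ∈ Icc β (min (f / l) (1 / l ^ p)), (α, f - l * α) ∈ offDom p ∧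
        ((p - 1) / p < f → l * α < (p - 1) / p * α ^ (1 - 1 / p) → K p f l (b₀ p l) < 0) := by
  have hp : 1 < p := hq.trans hqp
  have hp0 : 0 < p := by linarith
  have hl : 0 < l := hf0.trans hfl
  have hκ := kappa_pos hp
  have hβ₀ : 0 < b₀ p l := by unfold b₀; positivity
  by_cases hcase : (p - 1) / p < f ∧ 0 ≤ K p f l (b₀ p l)
  · obtain ⟨hκf, hK⟩ := hcase
    have hb1 : b₀ p l ≤ 1 / l ^ p := by
      rw [b₀, Real.div_rpow hκ.le hl.le]
      gcongr
      exact Real.rpow_le_one hκ.le (kappa_lt_one hp).le hp0.le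
    have hend : K p f l (1 / l ^ p) < 0 := by rw [K_inv_pow hp hl]; linarith
    let S : Set ℝ := {b : ℝ | b ∈ Icc 0 (1 / l ^ p) ∧ K p f l b = 0}
    have hS : IsCompact S := isCompact_Icc.inter_right
      (isClosed_singleton.preimage (continuous_K hp) : IsClosed (K p f l ⁻¹' {0}))
    obtain ⟨z, hz, hzK⟩ := intermediate_value_Icc' hb1 (continuous_K hp).continuousOn
      (show (0 : ℝ) ∈ Icc _ _ from ⟨hend.le, hK⟩)
    have hzS : z ∈ S := ⟨⟨hβ₀.le.trans hz.1, hz.2⟩, hzK⟩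
    have hmem : b₂ p f l ∈ S := hS.sSup_mem ⟨z, hzS⟩
    have hmax : ∀ x ∈ S, x ≤ b₂ p f l := fun x hx => le_csSup hS.bddAbove hx
    have hb₀₂ : b₀ p l ≤ b₂ p f l := hz.1.trans (hmax z hzS)
    have hb₂0 : 0 < b₂ p f l := hβ₀.trans_le hb₀₂
    have hK2 : f - 1 + b₂ p f l ^ (1 - 1 / p) - l * b₂ p f l = 0 := hmem.2
    have hb₂1 : b₂ p f l ≤ 1 := by
      by_contra hlt
      have hlt := not_le.1 hlt
      have := rpow_le_tangent hp hb₂0.le one_pos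
      rw [prof_one, Real.one_rpow] at this
      nlinarith
    have hb₂f : b₂ p f l ≤ f / l := by
      rw [le_div_iff₀ hl]
      have := Real.rpow_le_one hb₂0.le hb₂1 (one_sub_inv_pos hp).le
      linarith
    have hdom : ∀ α ∈ Icc (b₂ p f l) (min (f / l) (1 / l ^ p)), (α, f - l * α) ∈ offDom p := by
      intro α hα
      refine mem_offDom_of_K hl hfl hf1 (hb₂0.le.trans hα.1) (hα.2.trans (min_le_left _ _)) ?_
      -- `K` is negative at `l^{-p}`, so a positive value at `α` would give a zero to the right of
      -- the largest one.
      by_contra hpos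
      have hαl : α ≤ 1 / l ^ p := hα.2.trans (min_le_right _ _)
      obtain ⟨y, hy, hyK⟩ := intermediate_value_Icc' hαl (continuous_K (f := f) (l := l) hp).continuousOn
        (show (0 : ℝ) ∈ Icc _ _ from ⟨hend.le, (not_le.1 hpos).le⟩)
      have hy2 := hmax y ⟨⟨hb₂0.le.trans (hα.1.trans hy.1), hy.2⟩, hyK⟩
      have : α = b₂ p f l := le_antisymm (hy.1.trans hy2) hα.1
      rw [this, hmem.2] at hpos
      exact hpos le_rfl
    have hprof : ∀ α, b₂ p f l ≤ α → (p - 1) / p * α ^ (1 - 1 / p) ≤ l * α := by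
      intro α hα
      have hα0 := hb₂0.trans_le hα
      rw [← mul_prof_eq hp hα0.le, mul_comm l]
      exact mul_le_mul_of_nonneg_left ((beta_le_iff hp hl hα0).1 (hb₀₂.trans hα)) hα0.le
    refine ⟨b₂ p f l, hb₂0.le, le_min hb₂f hmem.1.2, ?_, ?_, fun α hα => ⟨hdom α hα, fun _ h => ?_⟩⟩
    · rw [DeltaSet, if_pos ⟨hκf, hK⟩]
    · have hd := hdom (b₂ p f l) ⟨le_rfl, le_min hb₂f hmem.1.2⟩
      have hlt1 : b₂ p f l < 1 := hd.2.1
      obtain ⟨b, hb, _, e2, -⟩ := offMin_truncation hq hqp hd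
      have hle : offMin p q (b₂ p f l) (f - l * b₂ p f l) ≤
          Gam p q * (1 - b₂ p f l ^ (1 - q / p)) := by
        have := integral_prof_pow hp hqp hb₂0.le zero_le_one
        rw [Real.one_rpow] at this
        rw [← e2, ← this]
        refine intervalIntegral.integral_mono_on_of_le_Ioo hb₂1
          (intervalIntegrable_min_prof_pow hq hqp hb hb₂0.le hb₂1)
          (intervalIntegrable_prof_pow hp hqp hb₂0.le zero_le_one) fun u hu => ?_
        have hu0 := (hb₂0.trans hu.1).le
        exact Real.rpow_le_rpow (min_prof_nonneg hp hb hu0) (min_le_right _ _) (by linarith)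
      rw [F_eq_offMin hfl hb₂0.le hb₂1, T_of_ge hp hqp hl hb₂0.le (hprof _ le_rfl), DeltaFun, Amin,
        if_neg (not_le.2 hκf)]
      -- At a zero of `K` this quantity is the one in `A_f`, and the terms in `b₂^{1-q/p}` cancel
      -- between `T` and the bound for `F`.
      have e : p * (b₂ p f l ^ (1 - 1 / p) - l * b₂ p f l) = p * (1 - f) := by
        congr 1; linarith
      have hpq : p - q ≠ 0 := by linarith
      have eG : Gam p q * (1 - b₂ p f l ^ (1 - q / p)) =
          ((p - 1) / p) ^ q * (1 / (p - q)) * (p - p * b₂ p f l ^ (1 - q / p)) := by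
        rw [Gam]; field_simp
      rw [e]
      rw [eG] at hle
      linarith
    · exact absurd h (not_lt.2 (hprof α hα.1))
  · have hm : 0 ≤ min (f / l) (1 / l ^ p) := le_min (by positivity) (by positivity)
    refine ⟨0, le_rfl, hm, ?_, ?_, fun α hα => ⟨?_, fun h _ => ?_⟩⟩
    · rw [DeltaSet, if_neg hcase]
    · rw [F_eq_offMin hfl le_rfl zero_le_one, mul_zero, sub_zero, offMin_zero hq hqp hf0 hf1,
        T_of_le hp hl le_rfl (by rw [zero_rpow_one_sub hp]; simp), mul_zero, add_zero]
    · have hαf : α ≤ f / l := hα.2.trans (min_le_left _ _)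
      refine mem_offDom_of_K hl hfl hf1 hα.1 hαf ?_
      by_cases hκf : (p - 1) / p < f
      · have hK : K p f l (b₀ p l) < 0 := not_le.1 fun h => hcase ⟨hκf, h⟩
        -- The tangent at `b₀` has slope `l`, so `b₀` maximizes `K`.
        have := rpow_le_tangent hp hα.1 hβ₀
        have hb : prof p (b₀ p l) = l := prof_beta hp hl
        rw [hb] at this
        rw [K] at hK ⊢
        linarith
      · have := rpow_le_tangent hp hα.1 one_pos
        rw [prof_one, Real.one_rpow] at this
        have hα1 : α ≤ 1 := hαf.trans ((div_le_one hl).2 hfl.le)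
        rw [K]
        nlinarith [mul_le_mul_of_nonneg_right (not_lt.1 hκf) (sub_nonneg.2 hα1),
          mul_le_mul_of_nonneg_right hfl.le hα.1]
    · exact not_le.1 fun h' => hcase ⟨h, h'⟩

lemma continuousOn_F_add_T (hq : 1 < q) (hqp : q < p) (hl : 0 < l) (hfl : f < l) {S : Set ℝ}
    (hS : ∀ α ∈ S, (α, f - l * α) ∈ offDom p) :
    ContinuousOn (fun α => F p q f l α + T p q l α) S := by
  refine ContinuousOn.add ?_ ?_
  · have : ContinuousOn (fun α => offMin p q α (f - l * α)) S :=
      (continuousOn_offMin hq hqp).comp (f := fun α => (α, f - l * α)) (by fun_prop) hS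
    exact this.congr fun α hα => F_eq_offMin hfl (hS α hα).1 (hS α hα).2.1.le
  · exact (continuousOn_T hq hqp).comp (f := fun α => (l, α)) (by fun_prop)
      fun α hα => ⟨hl, (hS α hα).1⟩

/-! ### The optimal truncation levels are ordered -/

/-- Only the case `a = l` with a nonconstant truncation at `b` is critical. If `b > l`, then the
profile truncated at `l` has integral at most `f - l α` on `[α, 1]`; evaluating that integral, whose
truncation point is `b₀`, gives `K(b₀) ≥ 0`, which is excluded by `hK`. -/
lemma level_le_level (hp : 1 < p) (hl : 0 < l) (hfl : f < l) (hα : 0 < α)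
    (hd : (α, f - l * α) ∈ offDom p)
    (hK : (p - 1) / p < f → l * α < (p - 1) / p * α ^ (1 - 1 / p) → K p f l (b₀ p l) < 0)
    (ha : l * α ≤ (p - 1) / p * α ^ (1 - 1 / p) ∧ a = l ∨ prof p α ≤ a) (hb : 0 ≤ b)
    (hint : ∫ u in α..1, min b (prof p u) = f - l * α)
    (hb' : f - l * α ≤ (p - 1) / p * (1 - α) ∧ b = (f - l * α) / (1 - α) ∧ b ≤ (p - 1) / p ∨
        (p - 1) / p * (1 - α) < f - l * α ∧ ∃ c, α ≤ c ∧ 0 < c ∧ b = prof p c) : b ≤ a := by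
  have hα1 : α < 1 := hd.2.1
  have hbα : b ≤ prof p α := by
    rcases hb' with ⟨_, _, h⟩ | ⟨_, c, hc, hc0, rfl⟩
    · exact h.trans (prof_one.symm.trans_le (prof_anti hp hα hα1.le))
    · exact prof_anti hp hα hc
  rcases ha with ⟨ha, rfl⟩ | ha
  swap
  · exact hbα.trans ha
  rcases hb' with ⟨_, rfl, _⟩ | ⟨hlt, c, hc, hc0, rfl⟩
  · rw [div_le_iff₀ (by linarith)]; linarith
  · have hκf : (p - 1) / p < f := by
      by_contra h
      nlinarith [mul_le_mul_of_nonneg_right (not_lt.1 h) (sub_nonneg.2 hα1.le),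
        mul_le_mul_of_nonneg_right hfl.le hα.le]
    rcases ha.eq_or_lt with h | h
    · rw [← mul_prof_eq hp hα.le, mul_comm a] at h
      rw [mul_left_cancel₀ hα.ne' h]; exact hbα
    · by_contra hcl
      have hcl := not_le.1 hcl
      have hKneg := hK hκf h
      have hβ : 0 < b₀ p a := by unfold b₀; have := kappa_pos hp; positivity
      have hpb : prof p (b₀ p a) = a := prof_beta hp hl
      have hαβ : α ≤ b₀ p a := (le_beta_iff hp hl hα.le).2 ha
      have hβ1 : b₀ p a ≤ 1 := (beta_le_iff hp hl one_pos).2 (by rw [prof_one]; linarith)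
      have h1 : ∫ u in α..1, min a (prof p u) ≤ ∫ u in α..1, min (prof p c) (prof p u) :=
        intervalIntegral.integral_mono_on_of_le_Ioo hα1.le
          (intervalIntegrable_min_prof hp hl.le hα.le hα1.le)
          (intervalIntegrable_min_prof hp hb hα.le hα1.le)
          fun u _ => min_le_min_right _ hcl.le
      have h2 := integral_min_prof hp hα.le hαβ hβ hβ1
      rw [hpb, Real.one_rpow] at h2
      rw [hint, h2] at h1
      rw [K] at hKneg
      linarith

/-! ### Two-sided bounds for the Bellman function -/

section Bellman

variable {X : Type*} [MeasurableSpace X] {μ : Measure X} {𝒯 : Set (Set X)}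
  {C : Set X → Set (Set X)}

/-- Admissible measures of level sets satisfy the dual inequality. -/
lemma F_add_T_le [IsProbabilityMeasure μ] (hq : 1 < q) (hqp : q < p) (hl : 0 < l) (hfl : f < l)
    (hα : 0 < α) (hαl : α ≤ 1 / l ^ p) (hd : (α, f - l * α) ∈ offDom p)
    (hK : (p - 1) / p < f → l * α < (p - 1) / p * α ^ (1 - 1 / p) → K p f l (b₀ p l) < 0)
    {φ : X → ℝ} (hφ : φ ∈ competitors μ p q f A) {E : Set X} (hE : MeasurableSet E)
    (hμE : μ E = ENNReal.ofReal α) (hlα : l * α ≤ ∫ x in E, φ x ∂μ) :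
    F p q f l α + T p q l α ≤ A := by
  have hp : 1 < p := hq.trans hqp
  have hp0 : 0 < p := by linarith
  have hα1 : α < 1 := hd.2.1
  rw [F_eq_offMin hfl hα.le hα1.le]
  obtain ⟨b, hb, e1, e2, hb'⟩ := offMin_truncation hq hqp hd
  rcases ((mul_le_rpow_iff hp hl hα).2 hαl).lt_or_eq with h | h
  · obtain ⟨a, ha, e3, e4, ha'⟩ := T_truncation hq hqp hl hα h
    have hba := level_le_level hp hl hfl hα hd hK ha' hb e1 hb'
    have := lagrangian_le hq hqp hφ hE hα.le hα1.le hμE hlα hb hba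
    rw [e1, e2, e3, e4] at this
    simp only [sub_self, mul_zero, add_zero] at this
    linarith
  -- Here the minimizer on `[0, α]` is the profile itself, of infinite height: truncate at `prof p
  -- c` and let `c` tend to `0`. The multiplier term is nonnegative and is dropped.
  · have r2 := one_sub_div_pos hqp hp0
    have key : ∀ c ∈ Ioo 0 α, c * prof p c ^ q + Gam p q * (α ^ (1 - q / p) - c ^ (1 - q / p)) +
        offMin p q α (f - l * α) ≤ A := by
      intro c hc
      have hba := level_le_level hp hl hfl hα hd hK (a := prof p c)
        (Or.inr (prof_anti hp hc.1 hc.2.le)) hb e1 hb'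
      have := lagrangian_le hq hqp hφ hE hα.le hα1.le hμE hlα hb hba
      rw [e1, e2, integral_min_prof_pow hq hqp le_rfl hc.1.le hc.1 hc.2.le] at this
      have h3 : ∫ u in (0 : ℝ)..α, min (prof p c) (prof p u) ≤ l * α := by
        have h4 := integral_prof hp 0 α
        rw [zero_rpow_one_sub hp, sub_zero, ← h] at h4
        rw [← h4]
        exact intervalIntegral.integral_mono_on_of_le_Ioo hα.le
          (intervalIntegrable_min_prof hp (prof_pos hp hc.1).le le_rfl hα.le)
          (intervalIntegrable_prof hp 0 α) fun u _ => min_le_right _ _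
      have h5 : 0 ≤ q * prof p c ^ (q - 1) *
          (l * α - ∫ u in (0 : ℝ)..α, min (prof p c) (prof p u)) :=
        mul_nonneg (mul_nonneg (by linarith) (Real.rpow_nonneg (prof_pos hp hc.1).le _))
          (sub_nonneg.2 h3)
      simp only [sub_zero, sub_self, mul_zero, add_zero] at this
      linarith
    have hcont : Continuous fun c : ℝ => ((p - 1) / p) ^ q * c ^ (1 - q / p) +
        Gam p q * (α ^ (1 - q / p) - c ^ (1 - q / p)) + offMin p q α (f - l * α) := by
      have : Continuous fun c : ℝ => c ^ (1 - q / p) :=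
        continuous_id.rpow_const fun _ => Or.inr r2.le
      fun_prop
    have hlim := (hcont.tendsto 0).mono_left (nhdsWithin_le_nhds (s := Ioi 0))
    rw [Real.zero_rpow r2.ne'] at hlim
    have := le_of_tendsto hlim (b := A) (by
      filter_upwards [Ioo_mem_nhdsGT hα] with c hc
      have h6 := key c hc
      rw [prof_rpow hp hc.1.le] at h6
      rw [rpow_one_sub_q_div hc.1.le hp hqp] at h6 ⊢
      linarith)
    rw [T_full hp hqp hl hα.le h]
    linarith

/-- Admissible measures with small enough least `q`-norm are attained. -/
lemma Generates.le_B₁ [IsProbabilityMeasure μ] (h : Generates μ 𝒯 C) (hq : 1 < q) (hqp : q < p)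
    (hf0 : 0 < f) (hf1 : f < 1) (hA : A ≤ Gam p q * f ^ ((p - q) / (p - 1)))
    (hl : 0 < l) (hα : 0 < α) (hαl : α ≤ 1 / l ^ p) (hd : (α, f - l * α) ∈ offDom p)
    (hle : offMin p q α (f - l * α) + T p q l α ≤ A) :
    ENNReal.ofReal α ≤ B₁ μ 𝒯 p q f A l := by
  have hp : 1 < p := hq.trans hqp
  have hlα := (mul_le_rpow_iff hp hl hα).2 hαl
  obtain ⟨g, hg, hg0, hgw, e3, e4⟩ := exists_T_profile hq hqp hl hα hlα
  obtain ⟨b, hb, e1, e2, -⟩ := offMin_truncation hq hqp hd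
  have hff : 0 ≤ f - l * α := hd.2.2.1
  refine h.le_B₁_of_split hq hqp hα hd.2.1 hf0 hf1.le hA (by linarith) hlα hg hg0 hgw
    (measurable_min_prof b) (fun u hu => min_prof_nonneg hp hb (hα.trans hu.1).le)
    (fun u _ => min_le_right _ _) e3 e1 ?_
  rw [e2, e4]; linarith

lemma B₁_le_of_forall {r : ℝ≥0∞} (h : ∀ φ ∈ competitors μ p q f A,
    μ {x | ENNReal.ofReal l ≤ maximal μ 𝒯 φ x} ≤ r) : B₁ μ 𝒯 p q f A l ≤ r :=
  iSup₂_le h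

lemma Generates.B₁_le_div [IsProbabilityMeasure μ] (h : Generates μ 𝒯 C) (hq : 1 < q)
    (hqp : q < p) (hl : 0 < l) : B₁ μ 𝒯 p q f A l ≤ ENNReal.ofReal (f / l) := by
  refine B₁_le_of_forall fun φ hφ => ?_
  obtain ⟨E, α, rfl, -, -, -, hμE, -, h1, -⟩ := h.level_set_bounds hq hqp hl hφ
  rw [hμE]; exact ENNReal.ofReal_le_ofReal h1

lemma Generates.B₁_le_inv_pow [IsProbabilityMeasure μ] (h : Generates μ 𝒯 C) (hq : 1 < q)
    (hqp : q < p) (hl : 0 < l) : B₁ μ 𝒯 p q f A l ≤ ENNReal.ofReal (1 / l ^ p) := by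
  refine B₁_le_of_forall fun φ hφ => ?_
  obtain ⟨E, α, rfl, -, -, -, hμE, -, -, h1⟩ := h.level_set_bounds hq hqp hl hφ
  rw [hμE]; exact ENNReal.ofReal_le_ofReal h1

lemma competitors_nonempty_of_B₁_pos (h : B₁ μ 𝒯 p q f A l ≠ 0) :
    (competitors μ p q f A).Nonempty := by
  by_contra hne
  rw [not_nonempty_iff_eq_empty] at hne
  exact h (by simp [B₁, hne])

/-- The whole space belongs to the tree and has average `f ≥ l`. A competitor must exist, since the
supremum over none would be `0`. -/
lemma Generates.B₁_eq_one [IsProbabilityMeasure μ] (h : Generates μ 𝒯 C) (hlf : l ≤ f)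
    (hne : (competitors μ p q f A).Nonempty) : B₁ μ 𝒯 p q f A l = 1 := by
  refine le_antisymm (B₁_le_of_forall fun φ _ => prob_le_one) ?_
  obtain ⟨φ, hφ⟩ := hne
  refine le_trans ?_ (le_iSup₂ (f := fun φ (_ : φ ∈ competitors μ p q f A) =>
    μ {x | ENNReal.ofReal l ≤ maximal μ 𝒯 φ x}) φ hφ)
  obtain ⟨hm, h0, hi, hf, -⟩ := hφ
  have : {x | ENNReal.ofReal l ≤ maximal μ 𝒯 φ x} = univ := by
    refine eq_univ_of_forall fun x => ?_
    have hx : (∫⁻ y in univ, ‖φ y‖ₑ ∂μ) / μ univ ≤ maximal μ 𝒯 φ x :=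
      le_iSup₂_of_le (f := fun I (_ : I ∈ 𝒯) => ⨆ _ : x ∈ I, (∫⁻ y in I, ‖φ y‖ₑ ∂μ) / μ I)
        univ h.univ_mem (le_iSup_of_le (mem_univ x) le_rfl)
    refine le_trans ?_ hx
    rw [measure_univ, div_one, Measure.restrict_univ]
    have e2 : ∫⁻ x, ‖φ x‖ₑ ∂μ = ENNReal.ofReal f := by
      rw [← hf, ofReal_integral_eq_lintegral_ofReal hi (Eventually.of_forall h0)]
      exact lintegral_congr fun u => Real.enorm_of_nonneg (h0 u)
    rw [e2]; exact ENNReal.ofReal_le_ofReal hlf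
  rw [this, measure_univ]

/-- The value at the right end of `Δ` in the intermediate range of levels. -/
lemma le_F_add_T_right (hq : 1 < q) (hqp : q < p) (hf0 : 0 < f) (hf1 : f < 1)
    (hfl : f < l) {l₁ l₃ : ℝ} (h1 : IsLam₁ p q f A l₁) (h3 : IsLam₃ p q f A l₃)
    (hl3 : l₃ < l) (hl1 : l ≤ l₁) :
    A ≤ F p q f l (min (f / l) (1 / l ^ p)) + T p q l (min (f / l) (1 / l ^ p)) := by
  have hp : 1 < p := hq.trans hqp
  have hl : 0 < l := hf0.trans hfl
  have hα1 : f / l ≤ 1 := (div_le_one hl).2 hfl.le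
  rcases le_or_gt l ((1 / f) ^ (1 / (p - 1))) with h | h
  · rw [min_eq_left ((div_le_inv_pow_iff hp hf0 hl).2 h),
      F_eq_offMin hfl (by positivity) hα1, mul_div_cancel₀ _ hl.ne', sub_self,
      offMin_right_zero hq hp hα1, zero_add, ← h3.2]
    exact (T_div_lt hq hqp hf0 (hf0.trans_le h3.1.1) hl3 h).le
  · have hα : 0 < 1 / l ^ p := by positivity
    have hmin : 1 / l ^ p ≤ f / l :=
      not_lt.1 fun h' => not_le.2 h ((div_lt_inv_pow_iff hp hf0 hl).1 h').le
    rw [min_eq_right hmin, T_full hp hqp hl hα.le (inv_pow_rpow hp hl).symm,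
      inv_pow_rpow_q hp hl, mul_one_div, F_add_eq_saturatedMin hp hf0 hf1 h.le, ← h1.2,
      F_add_eq_saturatedMin hp hf0 hf1 h1.1]
    rcases hl1.eq_or_lt with rfl | hlt
    · exact le_rfl
    · exact (saturatedMin_inv_pow_lt hq hqp hf0 hf1 h.le hlt).le

/-- A level set of measure `α > δ` would lie in `Δ` with `F + T ≤ A` at `α`; since `F + T ≥ A` at
the right end, a solution beyond `δ` would follow. -/
lemma Generates.exists_isGreatest_B₁_eq [IsProbabilityMeasure μ] (h : Generates μ 𝒯 C)
    (hq : 1 < q) (hqp : q < p) (hf0 : 0 < f) (hf1 : f < 1) (hA : Amin p q f < A)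
    (hA' : A ≤ Gam p q * f ^ ((p - q) / (p - 1))) (hfl : f < l)
    (hright : A ≤ F p q f l (min (f / l) (1 / l ^ p)) + T p q l (min (f / l) (1 / l ^ p))) :
    ∃ δ : ℝ, IsGreatest {γ : ℝ | γ ∈ DeltaSet p f l ∧ F p q f l γ + T p q l γ = A} δ ∧
      B₁ μ 𝒯 p q f A l = ENNReal.ofReal δ := by
  have hl : 0 < l := hf0.trans hfl
  obtain ⟨β, hβ0, hβm, hΔ, hβA, hdom⟩ := deltaSet_spec hq hqp hf0 hf1 hfl
  set m := min (f / l) (1 / l ^ p) with hm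
  have hcont : ContinuousOn (fun α => F p q f l α + T p q l α) (Icc β m) :=
    continuousOn_F_add_T hq hqp hl hfl fun α hα => (hdom α hα).1
  obtain ⟨γ, hγ, hγA⟩ := intermediate_value_Icc hβm hcont
    (show A ∈ Icc _ _ from ⟨hβA.trans hA.le, hright⟩)
  have hcomp : IsCompact {γ : ℝ | γ ∈ Icc β m ∧ F p q f l γ + T p q l γ = A} :=
    isCompact_Icc.of_isClosed_subset (hcont.preimage_isClosed_of_isClosed isClosed_Icc
      (isClosed_singleton (x := A))) fun c hc => hc.1
  obtain ⟨δ, hδ⟩ := hcomp.exists_isGreatest ⟨γ, hγ, hγA⟩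
  rw [hΔ]
  refine ⟨δ, hδ, le_antisymm (B₁_le_of_forall fun φ hφ => ?_) ?_⟩
  · obtain ⟨E, α, hEeq, hE, hα0, -, hμE, hlα, h1, h2⟩ := h.level_set_bounds hq hqp hl hφ
    rw [← hEeq, hμE]
    refine ENNReal.ofReal_le_ofReal (not_lt.1 fun hlt => ?_)
    have hα : α ∈ Icc β m := ⟨hδ.1.1.1.trans hlt.le, le_min h1 h2⟩
    have hαpos : 0 < α := (hβ0.trans hδ.1.1.1).trans_lt hlt
    have hle := F_add_T_le hq hqp hl hfl hαpos h2 (hdom α hα).1 (hdom α hα).2 hφ hE hμE hlα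
    obtain ⟨y, hy, hyA⟩ := intermediate_value_Icc hα.2
      (hcont.mono (Icc_subset_Icc_left hα.1)) (show A ∈ Icc _ _ from ⟨hle, hright⟩)
    exact not_le.2 (hlt.trans_le hy.1) (hδ.2 ⟨⟨hα.1.trans hy.1, hy.2⟩, hyA⟩)
  · rcases (hβ0.trans hδ.1.1.1).eq_or_lt with h0 | h0
    · rw [← h0]; simp
    · have hd := (hdom δ hδ.1.1).1
      refine h.le_B₁ hq hqp hf0 hf1 hA' hl h0 (hδ.1.1.2.trans (min_le_right _ _)) hd ?_
      rw [← F_eq_offMin hfl h0.le hd.2.1.le]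
      exact hδ.1.2.le

end Bellman

end DyadicBellman

/-! ### Assembly of the four ranges of levels -/

theorem theorem4p2 {X : Type*} [MeasurableSpace X] (μ : MeasureTheory.Measure X)
    [MeasureTheory.IsProbabilityMeasure μ] (hμ : DyadicBellman.NonAtomic μ)
    (𝒯 : Set (Set X)) (h𝒯 : DyadicBellman.IsTree μ 𝒯)
    (p q : ℝ) (hq : 1 < q) (hqp : q < p)
    (f A : ℝ) (hD : (f, A) ∈ DyadicBellman.D p q) (hA : DyadicBellman.Amin p q f < A) :
    (∃! l₁ : ℝ, DyadicBellman.IsLam₁ p q f A l₁) ∧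
    (∃! l₃ : ℝ, DyadicBellman.IsLam₃ p q f A l₃) ∧
    ∀ l₁ l₃ : ℝ, DyadicBellman.IsLam₁ p q f A l₁ → DyadicBellman.IsLam₃ p q f A l₃ →
      ∀ l : ℝ, 0 < l →
        (l ≤ f → DyadicBellman.B₁ μ 𝒯 p q f A l = 1) ∧
        (f < l → l ≤ l₃ → DyadicBellman.B₁ μ 𝒯 p q f A l = ENNReal.ofReal (f / l)) ∧
        (l₃ < l → l ≤ l₁ →
          ∃ δ : ℝ, IsGreatest {γ : ℝ | γ ∈ DyadicBellman.DeltaSet p f l ∧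
              DyadicBellman.F p q f l γ + DyadicBellman.T p q l γ = A} δ ∧
            DyadicBellman.B₁ μ 𝒯 p q f A l = ENNReal.ofReal δ) ∧
        (l₁ ≤ l → DyadicBellman.B₁ μ 𝒯 p q f A l = ENNReal.ofReal (1 / l ^ p)) := by
  open DyadicBellman in
  have hp : 1 < p := hq.trans hqp
  obtain ⟨C, h⟩ := h𝒯.exists_generates
  obtain ⟨hf0, hf1', -, hA'⟩ := hD
  simp only at hf0 hf1' hA'
  -- At `f = 1` the lower and upper limits for `A` coincide, which `A_f < A` forbids.
  have hf1 : f < 1 := by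
    refine lt_of_le_of_ne hf1' fun hf => ?_
    have hpq : 0 < (p - q) / (p - 1) := div_pos (by linarith) (by linarith)
    rw [hf, Amin, if_neg (not_le.2 (kappa_lt_one hp)), sub_self, mul_zero,
      Real.zero_rpow hpq.ne'] at hA
    rw [hf, Real.one_rpow, Gam] at hA'
    have : ((p - 1) / p) ^ q * (1 / (p - q)) * (p - q * 0) = ((p - 1) / p) ^ q * (p / (p - q)) * 1 := by
      ring
    linarith
  refine ⟨existsUnique_lam₁ hq hqp hf0 hf1 hA hA', existsUnique_lam₃ hq hqp hf0 hf1 hA hA',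
    fun l₁ l₃ h1 h3 l hl => ?_⟩
  have hf3 : f < l₃ := by
    refine lt_of_le_of_ne h3.1.1 fun hf => ?_
    have := h3.2
    rw [← hf, T_self hp hf0] at this
    exact hA.ne this
  -- levels at which the whole mass is placed on the level set
  have small : ∀ l, f < l → l ≤ l₃ → ENNReal.ofReal (f / l) ≤ B₁ μ 𝒯 p q f A l := by
    intro l hfl hl3
    have hl : 0 < l := hf0.trans hfl
    have hL := hl3.trans h3.1.2
    have hα1 : f / l < 1 := (div_lt_one hl).2 hfl
    have hα : 0 < f / l := by positivity
    have e : f - l * (f / l) = 0 := by rw [mul_div_cancel₀ _ hl.ne', sub_self]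
    refine h.le_B₁ hq hqp hf0 hf1 hA' hl hα ((div_le_inv_pow_iff hp hf0 hl).2 hL) ?_ ?_
    · rw [e]
      refine ⟨hα.le, hα1, le_rfl, ?_, zero_lt_one⟩
      simp only
      have := Real.rpow_le_one hα.le hα1.le (one_sub_inv_pos hp).le
      linarith
    · rw [e, offMin_right_zero hq hp hα1.le, zero_add, ← h3.2]
      rcases hl3.eq_or_lt with rfl | hlt
      · exact le_rfl
      · exact (T_div_lt hq hqp hf0 hl hlt h3.1.2).le
  refine ⟨fun hlf => ?_, fun hfl hl3 => ?_, fun hl3 hl1 => ?_, fun hl1 => ?_⟩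
  -- A competitor exists because the lower bound at the level `l₃` is positive.
  · refine h.B₁_eq_one hlf (competitors_nonempty_of_B₁_pos (𝒯 := 𝒯) (l := l₃) ?_)
    have := small l₃ hf3 le_rfl
    intro h0
    rw [h0, nonpos_iff_eq_zero, ENNReal.ofReal_eq_zero] at this
    exact not_lt.2 this (div_pos hf0 (hf0.trans hf3))
  · exact le_antisymm (h.B₁_le_div hq hqp hl) (small l hfl hl3)
  · have hfl := hf3.trans hl3
    exact h.exists_isGreatest_B₁_eq hq hqp hf0 hf1 hA hA' hfl
      (le_F_add_T_right hq hqp hf0 hf1 hfl h1 h3 hl3 hl1)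
  · have hL := h1.1.trans hl1
    have hl1' : 1 ≤ l := (one_le_threshold hp hf0 hf1.le).trans hL
    have hfl : f < l := hf1.trans_le hl1'
    have hα : 0 < 1 / l ^ p := by positivity
    have hd : (1 / l ^ p, f - l * (1 / l ^ p)) ∈ offDom p := by
      rw [← inv_pow_rpow hp hl]
      exact saturated_mem_offDom hp hf1 hα.le (inv_pow_rpow_le hp hf0 hL hl)
    refine le_antisymm (h.B₁_le_inv_pow hq hqp hl)
      (h.le_B₁ hq hqp hf0 hf1 hA' hl hα le_rfl hd ?_)
    rw [← F_eq_offMin hfl hα.le hd.2.1.le, T_full hp hqp hl hα.le (inv_pow_rpow hp hl).symm,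
      inv_pow_rpow_q hp hl, mul_one_div, F_add_eq_saturatedMin hp hf0 hf1 hL, ← h1.2,
      F_add_eq_saturatedMin hp hf0 hf1 h1.1]
    rcases hl1.eq_or_lt with rfl | hlt
    · exact le_rfl
    · exact (saturatedMin_inv_pow_lt hq hqp hf0 hf1 h1.1 hlt).le
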